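/- Let $n\ge 2$. Let $N$ be a compact (Hausdorff) smooth manifold without boundary of dimension $n-1$ with a smooth Riemannian metric $\breve h$ whose scalar curvature is $R_{\breve h}=(n-1)(n-2)k$, where $k\in\{0,1,-1\}$, and $k=1$ if $n=2$. Let $r_0\ge 0$ with $r_0^2+k\ge 0$, and on $(r_0,\infty)\times N$ let $$b_0=\frac{dr^2}{r^2+k}+r^2\breve h .$$ Let $M$ be a smooth manifold with a Riemannian metric $g$ of class $C^2$, let $\Phi$ be a diffeomorphism of $(r_0,\infty)\times N$ onto an open subset $M_{\rm ext}$ of $M$, and let $b=(\Phi^{-1})^*b_0$ be the reference metric on $M_{\rm ext}$. For a local $\breve h$-orthonormal frame $\epsilon_1,\dots,\epsilon_{n-1}$ of $N$, let $f_i$ be the $b$-orthonormal frame corresponding under $\Phi$ to $r^{-1}\epsilon_i$ ($i\le n-1$), $\sqrt{r^2+k}\,\partial_r$ ($i=n$), and put $g_{ij}=g(f_i,f_j)$. Assume: 1. $\displaystyle\int_{M_{\rm ext}}\Big(\sum_{i,j}|g_{ij}-\delta_{ij}|^2+\sum_{i,j,l}|f_l(g_{ij})|^2\Big)\,r\,d\mu_g<\infty$,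 in the sense that every point of $N$ has an open neighbourhood $W$ with a smooth orthonormal frame $\epsilon_i$ over $W$ for which the integral over the part of $M_{\rm ext}$ corresponding to $(r_0,\infty)\times W$ is finite; 2. $\displaystyle\int_{M_{\rm ext}}|R_g-R_b|\,r\,d\mu_g<\infty$, where $R$ denotes scalar curvature; 3. there is $C>0$ with $C^{-1}b(X,X)\le g(X,X)\le C\,b(X,X)$ for all tangent vectors $X$ on $M_{\rm ext}$. Let $V$ be a $C^2$ function on $(r_0,\infty)\times N$ in $\mathcal N_{b_0}$, i.e. $$\Delta_{b_0}V-nV=0,\qquad \mathring D_i\mathring D_jV=V\big(\mathrm{Ric}(b_0)_{ij}+n(b_0)_{ij}\big)$$ ($\mathring D$ is the Levi-Civita connection of the reference metric), and suppose that $V=O(r)$ and $|dV|_{b_0}=O(r)$ as $r\to\infty$, uniformly on $N$. With $V$ transported to $M_{\rm ext}$ by $\Phi$, let, in coordinate components, $e_{ij}=g_{ij}-b_{ij}$ and $$\mathbb U^i(V)=2\sqrt{\det g}\,\Big(V g^{i[k}g^{j]l}\mathring D_jg_{kl}+D^{[i}V\,g^{j]k}e_{jk}\Big),\qquad D^iV=g^{ij}\partial_jV,$$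 where brackets denote antisymmetrisation with the factor $\tfrac12$, and let $dS_i=\partial_i\rfloor(dr\wedge dv^1\wedge\dots\wedge dv^{n-1})$ in coordinates $(r,v^A)$, with $v^A$ local coordinates on $N$. Then for every $R>r_0$ the flux integral $\int_{r=R}\mathbb U^i(V\circ\Phi^{-1})\,dS_i$ is well defined (its integrand is integrable over $N$), and the limit $$H_\Phi(V)=\lim_{R\to\infty}\int_{r=R}\mathbb U^i(V\circ\Phi^{-1})\,dS_i$$ exists and is finite. -/

import Mathlib

open Set Filter MeasureTheory Topology Manifold Asymptotics
open scoped ContDiff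

noncomputable section

namespace WarpedMass

/-! ### Tensor calculus in a coordinate domain

`E` is a finite-dimensional real vector space with a fixed basis `e`; all components and partial
derivatives are taken with respect to `e`. A metric is given by the matrix field of its
components. -/

section Coordinates

variable {E : Type*} [NormedAddCommGroup E] [NormedSpace ℝ E]
  {ι : Type*} [Fintype ι] [DecidableEq ι]

/-- The partial derivative `∂ᵢ f`. -/
def pd (e : Module.Basis ι ℝ E) (i : ι) (f : E → ℝ) (y : E) : ℝ :=
  fderiv ℝ f y (e i)

/-- Christoffel symbols `Γᵏᵢⱼ` of the metric `G`. -/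
def christoffel (e : Module.Basis ι ℝ E) (G : E → Matrix ι ι ℝ) (k i j : ι) (y : E) : ℝ :=
  (1 / 2) * ∑ l, (G y)⁻¹ k l *
    (pd e i (fun z => G z l j) y + pd e j (fun z => G z l i) y - pd e l (fun z => G z i j) y)

/-- Ricci tensor
`Ricᵢⱼ = ∂ₖ Γᵏᵢⱼ - ∂ⱼ Γᵏₖᵢ + Γᵏₖₗ Γˡᵢⱼ - Γᵏⱼₗ Γˡₖᵢ` (positive on round spheres). -/
def ricci (e : Module.Basis ι ℝ E) (G : E → Matrix ι ι ℝ) (i j : ι) (y : E) : ℝ :=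
  ∑ k, (pd e k (christoffel e G k i j) y - pd e j (christoffel e G k k i) y)
    + ∑ k, ∑ l, (christoffel e G k k l y * christoffel e G l i j y
        - christoffel e G k j l y * christoffel e G l k i y)

/-- Scalar curvature `Gⁱʲ Ricᵢⱼ`. -/
def scalar (e : Module.Basis ι ℝ E) (G : E → Matrix ι ι ℝ) (y : E) : ℝ :=
  ∑ i, ∑ j, (G y)⁻¹ i j * ricci e G i j y

/-- Hessian `Dᵢ Dⱼ V` of a function with respect to the Levi-Civita connection of `G`. -/
def hessian (e : Module.Basis ι ℝ E) (G : E → Matrix ι ι ℝ) (V : E → ℝ) (i j : ι) (y : E) : ℝ :=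
  pd e i (pd e j V) y - ∑ k, christoffel e G k i j y * pd e k V y

/-- Laplacian `Gⁱʲ Dᵢ Dⱼ V`. -/
def laplacian (e : Module.Basis ι ℝ E) (G : E → Matrix ι ι ℝ) (V : E → ℝ) (y : E) : ℝ :=
  ∑ i, ∑ j, (G y)⁻¹ i j * hessian e G V i j y

/-- Norm `√(Gⁱʲ ∂ᵢV ∂ⱼV)` of the differential of `V`. -/
def gradNorm (e : Module.Basis ι ℝ E) (G : E → Matrix ι ι ℝ) (V : E → ℝ) (y : E) : ℝ :=
  Real.sqrt (∑ i, ∑ j, (G y)⁻¹ i j * pd e i V y * pd e j V y)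

/-- Covariant derivative `D̊ⱼ Tₖₗ` of a covariant 2-tensor `T` with respect to the Levi-Civita
connection of the metric `B`. -/
def covDeriv (e : Module.Basis ι ℝ E) (B T : E → Matrix ι ι ℝ) (j k l : ι) (y : E) : ℝ :=
  pd e j (fun z => T z k l) y
    - ∑ q, (christoffel e B q j k y * T y q l + christoffel e B q j l y * T y k q)

/-- `Dⁱ V = gⁱʲ ∂ⱼ V`, the index being raised with the metric `G`. -/
def gradUp (e : Module.Basis ι ℝ E) (G : E → Matrix ι ι ℝ) (V : E → ℝ) (i : ι) (y : E) : ℝ :=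
  ∑ j, (G y)⁻¹ i j * pd e j V y

/-- The mass integrand, for the metric `G` and the reference metric `B`:
`Uⁱ(V) = 2 √det g (V g^{i[k} g^{j]l} D̊ⱼ gₖₗ + D^{[i}V g^{j]k} eⱼₖ)` with `e = g - b`, where
brackets denote antisymmetrisation with the factor `1/2`. -/
def massVector (e : Module.Basis ι ℝ E) (G B : E → Matrix ι ι ℝ) (V : E → ℝ) (i : ι) (y : E) : ℝ :=
  2 * Real.sqrt (G y).det *
    (V y * (∑ j, ∑ k, ∑ l,
        (1 / 2) * ((G y)⁻¹ i k * (G y)⁻¹ j l - (G y)⁻¹ i j * (G y)⁻¹ k l) * covDeriv e B G j k l y)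
      + ∑ j, ∑ k,
        (1 / 2) * (gradUp e G V i y * (G y)⁻¹ j k - gradUp e G V j y * (G y)⁻¹ i k)
          * (G y j k - B y j k))

end Coordinates

/-! ### Covariant 2-tensors on manifolds without boundary -/

section Manifold

variable {E : Type*} [NormedAddCommGroup E] [NormedSpace ℝ E]
  {H : Type*} [TopologicalSpace H] (I : ModelWithCorners ℝ E H)
  {X : Type*} [TopologicalSpace X] [ChartedSpace H X]
  {ι : Type*} [Fintype ι] [DecidableEq ι]

variable (X) in
/-- A field of (bilinear) forms on the tangent spaces of `X`. -/
abbrev FormField : Type _ := ∀ p : X, TangentSpace I p → TangentSpace I p → ℝ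

/-- The components of the form field `T` in the preferred chart at `p`. -/
def localForm (e : Module.Basis ι ℝ E) (T : FormField I X) (p : X) (y : E) : Matrix ι ι ℝ :=
  Matrix.of fun i j =>
    T ((extChartAt I p).symm y)
      (mfderiv 𝓘(ℝ, E) I (extChartAt I p).symm y (e i))
      (mfderiv 𝓘(ℝ, E) I (extChartAt I p).symm y (e j))

/-- The expression of the function `V` in the preferred chart at `p`. -/
def localFun (V : X → ℝ) (p : X) (y : E) : ℝ := V ((extChartAt I p).symm y)

/-- Scalar curvature of the metric `T` at `p`. -/
def scalarCurvature (e : Module.Basis ι ℝ E) (T : FormField I X) (p : X) : ℝ :=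
  scalar e (localForm I e T p) (extChartAt I p p)

/-- The measure `√det(Tᵢⱼ) dy¹⋯dyⁿ` of the preferred chart at `p`, as a measure on `X` which
vanishes outside of the chart domain. -/
def chartVolume [FiniteDimensional ℝ E] [MeasurableSpace E] [BorelSpace E] [MeasurableSpace X]
    (e : Module.Basis ι ℝ E) (T : FormField I X) (p : X) : Measure X :=
  ((e.addHaar.restrict (extChartAt I p).target).withDensity
    fun y => ENNReal.ofReal (Real.sqrt (localForm I e T p y).det)).map (extChartAt I p).symm

/-- The Riemannian measure of the metric `T`: the supremum of the chart measures. (They agree on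
overlaps of chart domains, so this is the measure that restricts to each of them.) -/
def riemannianVolume [FiniteDimensional ℝ E] [MeasurableSpace E] [BorelSpace E] [MeasurableSpace X]
    (e : Module.Basis ι ℝ E) (T : FormField I X) : Measure X :=
  ⨆ p : X, chartVolume I e T p

/-- The functions `V`, twice continuously differentiable on the open set `S`, which satisfy
`Δ V + λ V = 0` and `Dᵢ Dⱼ V = V (Ricᵢⱼ - λ bᵢⱼ)` there for the metric `b` and for
`λ = -n`, where `n` is the dimension. -/
def staticPotentials (e : Module.Basis ι ℝ E) (b : FormField I X) (S : Set X) : Set (X → ℝ) :=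
  {V | ContMDiffOn I 𝓘(ℝ, ℝ) 2 V S ∧ ∀ p ∈ S,
    laplacian e (localForm I e b p) (localFun I V p) (extChartAt I p p)
        + (-(Fintype.card ι : ℝ)) * V p = 0 ∧
    ∀ i j, hessian e (localForm I e b p) (localFun I V p) i j (extChartAt I p p) =
      V p * (ricci e (localForm I e b p) i j (extChartAt I p p)
        - (-(Fintype.card ι : ℝ)) * localForm I e b p (extChartAt I p p) i j)}

/-- The norm `|dV|_b` at `p`. -/
def differentialNorm (e : Module.Basis ι ℝ E) (b : FormField I X) (V : X → ℝ) (p : X) : ℝ :=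
  gradNorm e (localForm I e b p) (localFun I V p) (extChartAt I p p)

end Manifold

/-! ### The end `(r₀, ∞) × N`

`N` is a manifold of dimension `m = n - 1`. -/

section End

/-- Model vector space of `N`. -/
abbrev ModelN (m : ℕ) : Type := EuclideanSpace ℝ (Fin m)

/-- Model with corners of `ℝ × N`. -/
abbrev modelEnd (m : ℕ) : ModelWithCorners ℝ (ℝ × ModelN m) (ModelProd ℝ (ModelN m)) :=
  𝓘(ℝ, ℝ).prod (𝓡 m)

/-- Standard basis of the model space of `N`. -/
def basisN (m : ℕ) : Module.Basis (Fin m) ℝ (ModelN m) :=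
  (EuclideanSpace.basisFun (Fin m) ℝ).toBasis

/-- Standard basis of the model space of `ℝ × N`; the index `Sum.inl ()` is the `r` direction. -/
def basisEnd (m : ℕ) : Module.Basis (Unit ⊕ Fin m) ℝ (ℝ × ModelN m) :=
  (Module.Basis.singleton Unit ℝ).prod (basisN m)

variable {m : ℕ} {N : Type*} [TopologicalSpace N] [ChartedSpace (ModelN m) N]

variable (N) in
/-- The set `(r₀, ∞) × N`. -/
def endSet (r₀ : ℝ) : Set (ℝ × N) := Ioi r₀ ×ˢ univ

/-- The tangent vector `s ∂_r + u` to `ℝ × N` at `p`. -/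
def tangentEnd (p : ℝ × N) (s : ℝ) (u : TangentSpace (𝓡 m) p.2) : TangentSpace (modelEnd m) p :=
  ((s, u) : ℝ × ModelN m)

/-- The `r` component `dr(w)` of a tangent vector to `ℝ × N`. -/
def radialPart {p : ℝ × N} (w : TangentSpace (modelEnd m) p) : ℝ :=
  Prod.fst (α := ℝ) (β := ModelN m) w

/-- The `N` component of a tangent vector to `ℝ × N`. -/
def tangentialPart {p : ℝ × N} (w : TangentSpace (modelEnd m) p) : TangentSpace (𝓡 m) p.2 :=
  Prod.snd (α := ℝ) (β := ModelN m) w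

/-- The reference metric `b₀ = dr² / (r² + k) + r² h`. -/
def refMetric (h : FormField (𝓡 m) N) (k : ℝ) : FormField (modelEnd m) (ℝ × N) :=
  fun p v w => radialPart v * radialPart w / (p.1 ^ 2 + k)
    + p.1 ^ 2 * h p.2 (tangentialPart v) (tangentialPart w)

/-- The pull-back `Φ^* g` to `ℝ × N` of a form field on `M`. -/
def pullback {E' : Type*} [NormedAddCommGroup E'] [NormedSpace ℝ E']
    {H' : Type*} [TopologicalSpace H'] (J : ModelWithCorners ℝ E' H')
    {M : Type*} [TopologicalSpace M] [ChartedSpace H' M]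
    (Φ : ℝ × N → M) (g : FormField J M) : FormField (modelEnd m) (ℝ × N) :=
  fun p v w => g (Φ p) (mfderiv (modelEnd m) J Φ p v) (mfderiv (modelEnd m) J Φ p w)

/-- The frame `f` on `ℝ × N` built on a frame `ε` of `N`: `f_n = √(r² + k) ∂_r` and
`f_i = r⁻¹ ε_i`. -/
def frame (k : ℝ) (ε : Fin m → ∀ x : N, TangentSpace (𝓡 m) x) :
    Unit ⊕ Fin m → ∀ p : ℝ × N, TangentSpace (modelEnd m) p
  | Sum.inl _, p => tangentEnd p (Real.sqrt (p.1 ^ 2 + k)) 0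
  | Sum.inr i, p => tangentEnd p 0 (p.1⁻¹ • ε i p.2)

/-- The derivative `w(F)` of the function `F` in the direction of the tangent vector `w` at `p`. -/
def dirDeriv (F : ℝ × N → ℝ) (p : ℝ × N) (w : TangentSpace (modelEnd m) p) : ℝ :=
  mfderiv (modelEnd m) 𝓘(ℝ, ℝ) F p w

/-- `ε` is a smooth frame over `W`, orthonormal for `h`. -/
def IsOrthonormalFrameOn [IsManifold (𝓡 m) ∞ N] (h : FormField (𝓡 m) N) (W : Set N)
    (ε : Fin m → ∀ x : N, TangentSpace (𝓡 m) x) : Prop :=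
  (∀ i, ContMDiffOn (𝓡 m) ((𝓡 m).prod 𝓘(ℝ, ModelN m)) ∞
    (fun x => (⟨x, ε i x⟩ : TangentBundle (𝓡 m) N)) W) ∧
  ∀ x ∈ W, ∀ i j, h x (ε i x) (ε j x) = if i = j then 1 else 0

/-- The integrand `∑ |g_ij - δ_ij|² + ∑ |f_k(g_ij)|²`, with `g_ij = g(f_i, f_j)`. -/
def frameEnergy (g : FormField (modelEnd m) (ℝ × N))
    (f : Unit ⊕ Fin m → ∀ p : ℝ × N, TangentSpace (modelEnd m) p) (p : ℝ × N) : ℝ :=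
  ∑ i, ∑ j, |g p (f i p) (f j p) - (if i = j then 1 else 0)| ^ 2
    + ∑ i, ∑ j, ∑ k,
      |dirDeriv (fun q => g q (f i q) (f j q)) p (f k p)| ^ 2

/-- The weighted integral condition on the metric `g`:
`∫ (∑ |g_ij - δ_ij|² + ∑ |f_k(g_ij)|²) r dμ_g < ∞`. As `N` need not be parallelisable, the frames
are local ones on `N`: every point of the compact manifold `N` has a neighbourhood `W` carrying an
orthonormal frame for which the integral over `(r₀, ∞) × W` is finite. -/
def MetricDecay [IsManifold (𝓡 m) ∞ N] [MeasurableSpace N] (h : FormField (𝓡 m) N) (k r₀ : ℝ)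
    (g : FormField (modelEnd m) (ℝ × N)) : Prop :=
  ∀ x₀ : N, ∃ W : Set N, IsOpen W ∧ x₀ ∈ W ∧
    ∃ ε : Fin m → ∀ x : N, TangentSpace (𝓡 m) x, IsOrthonormalFrameOn h W ε ∧
      ∫⁻ p in Ioi r₀ ×ˢ W, ENNReal.ofReal (frameEnergy g (frame k ε) p * p.1)
        ∂(riemannianVolume (modelEnd m) (basisEnd m) g) < ⊤

/-- The weighted integral condition on the scalar curvatures: `∫ |R_g - R_b| r dμ_g < ∞`. -/
def ScalarDecay [MeasurableSpace N] (r₀ : ℝ) (g b : FormField (modelEnd m) (ℝ × N)) : Prop :=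
  ∫⁻ p in endSet N r₀, ENNReal.ofReal
      (|scalarCurvature (modelEnd m) (basisEnd m) g p
        - scalarCurvature (modelEnd m) (basisEnd m) b p| * p.1)
    ∂(riemannianVolume (modelEnd m) (basisEnd m) g) < ⊤

/-- Uniform equivalence of the metrics `g` and `b` on `(r₀, ∞) × N`. -/
def UniformlyEquivalent (r₀ : ℝ) (g b : FormField (modelEnd m) (ℝ × N)) : Prop :=
  ∃ C : ℝ, 0 < C ∧ ∀ p ∈ endSet N r₀, ∀ v : TangentSpace (modelEnd m) p,
    C⁻¹ * b p v v ≤ g p v v ∧ g p v v ≤ C * b p v v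

/-- `V = O(r)` and `|dV|_b = O(r)` as `r → ∞`, uniformly on `N`. -/
def LinearGrowth (b : FormField (modelEnd m) (ℝ × N)) (V : ℝ × N → ℝ) : Prop :=
  V =O[atTop ×ˢ (⊤ : Filter N)] (fun p => p.1) ∧
  differentialNorm (modelEnd m) (basisEnd m) b V =O[atTop ×ˢ (⊤ : Filter N)] (fun p => p.1)

/-- The density, with respect to the Riemannian measure of `h`, of the form
`Uⁱ dS_i = Uⁱ ∂_i ⌟ (dr ∧ dv¹ ∧ ⋯ ∧ dvᵐ)` restricted to `{r = R} ≅ N`: in the product of the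
coordinate `r` with local coordinates `v` of `N`, it is `Uʳ / √det h`. -/
def fluxDensity (h : FormField (𝓡 m) N) (g b : FormField (modelEnd m) (ℝ × N)) (V : ℝ × N → ℝ)
    (R : ℝ) (x : N) : ℝ :=
  massVector (basisEnd m) (localForm (modelEnd m) (basisEnd m) g (R, x))
      (localForm (modelEnd m) (basisEnd m) b (R, x)) (localFun (modelEnd m) V (R, x)) (Sum.inl ())
      (extChartAt (modelEnd m) (R, x) (R, x))
    / Real.sqrt (localForm (𝓡 m) (basisN m) h x (extChartAt (𝓡 m) x x)).det

/-- The flux `∫_{r = R} Uⁱ(V) dS_i`. -/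
def flux [MeasurableSpace N] (h : FormField (𝓡 m) N) (g b : FormField (modelEnd m) (ℝ × N))
    (V : ℝ × N → ℝ) (R : ℝ) : ℝ :=
  ∫ x, fluxDensity h g b V R x ∂(riemannianVolume (𝓡 m) (basisN m) h)

end End

end WarpedMass

end

open Set Filter MeasureTheory Topology Manifold Asymptotics
open scoped ContDiff

set_option linter.unusedSectionVars false

noncomputable section

namespace WarpedMass

/-! ### Partial derivatives of functions and of matrix fields in a fixed basis. -/

section PartialDerivatives

variable {E : Type*} [NormedAddCommGroup E] [NormedSpace ℝ E]
  {ι : Type*} [Fintype ι] [DecidableEq ι]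

/-! The radial derivative of the flux is the integral over the slice of the coordinate divergence
`∂ᵢUⁱ`. A function whose derivative is integrable near infinity has a finite limit there, so
everything reduces to the integrability of this divergence over `{r > R₀}`.

Divergence identity. Let `C` be the difference of the Levi-Civita connections of `g` and `b`, and `e
= g - b`. Since `g` is parallel for its own connection, `D̊g` is algebraic in `C`, and the mass
vector becomes `√det g (V X + g⁻¹ Y)` with `Xⁱ = gᵃᵇ Cⁱₐᵦ - gⁱᵃ Cᵇᵦₐ` and `Y = dV tr e - e(grad V)`
(`massVector_eq`). The divergence of `√det g X` is `√det g gʲᵏ(Ric_g - Ric_b)ⱼₖ` up to terms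
quadratic in `C` (`sum_pd_connVec`, resting on `contraction_identity`). The product `dV · X` cancels
the terms linear in `C` in the divergence of `g⁻¹ Y`. The terms linear in `e`, which come from the
Hessian of `V` and from exchanging `g⁻¹` for `b⁻¹` in front of `Ric_b`, cancel by the two static
equations. What is left is `∂ᵢUⁱ = √det g (V (R_g - R_b) + Q)` with `Q` quadratic in `(e, C)` and
linear in `(V, dV)` (`sum_pd_massVector`).

Estimate. In a `b`-orthonormal frame the reference geometry is bounded, and `e` and `C` are
controlled by `g_ij - δ_ij` and the frame derivatives of `g_ij`. The growth of `V` and `dV` then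
gives `Q = O(r · energy)` (`massRemainder_isBigO_of_frame`), so `|∂ᵢUⁱ|` is at most a constant times
`√det g (|R_g - R_b| r + energy · r)` (`exists_abs_divergence_le`), which the two integral
assumptions control.

Change of charts. Curvature, `|dV|`, the static equations and the flux density are all evaluated, at
each point, in the chart preferred at that point, whereas differentiation and integration need one
chart. The transformation laws for `IsCoordChangeAt` bridge this: they show that the scalars are
invariant, that the static equations are tensorial and that the mass vector is a vector density.

Globalisation. A smooth partition of unity on the compact `N` localises the flux in charts.
Tangential divergences integrate to zero, and the terms in which a derivative hits a cutoff add up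
to zero because the cutoffs sum to one (`hasDerivAt_flux`). Fubini turns integrability of the
divergence in each chart into integrability of the derivative of the flux
(`integrableOn_integral_divergence`). -/

lemma pd_congr (e : Module.Basis ι ℝ E) (i : ι) {f f' : E → ℝ} {y : E} (h : f =ᶠ[𝓝 y] f') :
    pd e i f y = pd e i f' y := by
  simp only [pd, h.fderiv_eq]

lemma pd_eventuallyEq (e : Module.Basis ι ℝ E) (i : ι) {f f' : E → ℝ} {y : E}
    (h : f =ᶠ[𝓝 y] f') : pd e i f =ᶠ[𝓝 y] pd e i f' := by
  filter_upwards [h.eventuallyEq_nhds] with z hz using pd_congr e i hz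

lemma pd_add (e : Module.Basis ι ℝ E) (i : ι) {f f' : E → ℝ} {y : E}
    (hf : DifferentiableAt ℝ f y) (hf' : DifferentiableAt ℝ f' y) :
    pd e i (fun z => f z + f' z) y = pd e i f y + pd e i f' y := by
  simp [pd, fderiv_fun_add hf hf']

lemma pd_sub (e : Module.Basis ι ℝ E) (i : ι) {f f' : E → ℝ} {y : E}
    (hf : DifferentiableAt ℝ f y) (hf' : DifferentiableAt ℝ f' y) :
    pd e i (fun z => f z - f' z) y = pd e i f y - pd e i f' y := by
  simp [pd, fderiv_fun_sub hf hf']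

lemma pd_mul (e : Module.Basis ι ℝ E) (i : ι) {f f' : E → ℝ} {y : E}
    (hf : DifferentiableAt ℝ f y) (hf' : DifferentiableAt ℝ f' y) :
    pd e i (fun z => f z * f' z) y = pd e i f y * f' y + f y * pd e i f' y := by
  simp [pd, fderiv_fun_mul hf hf']
  ring

lemma pd_sum {α : Type*} (s : Finset α) (e : Module.Basis ι ℝ E) (i : ι) {f : α → E → ℝ} {y : E}
    (hf : ∀ a ∈ s, DifferentiableAt ℝ (f a) y) :
    pd e i (fun z => ∑ a ∈ s, f a z) y = ∑ a ∈ s, pd e i (f a) y := by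
  simp [pd, fderiv_fun_sum hf]

lemma pd_const (e : Module.Basis ι ℝ E) (i : ι) (c : ℝ) (y : E) :
    pd e i (fun _ => c) y = 0 := by
  simp [pd]

lemma pd_const_mul (e : Module.Basis ι ℝ E) (i : ι) (c : ℝ) {f : E → ℝ} {y : E}
    (hf : DifferentiableAt ℝ f y) : pd e i (fun z => c * f z) y = c * pd e i f y := by
  rw [pd_mul e i (differentiableAt_const c) hf, pd_const]; ring

lemma pd_sqrt (e : Module.Basis ι ℝ E) (i : ι) {f : E → ℝ} {y : E}
    (hf : DifferentiableAt ℝ f y) (h0 : f y ≠ 0) :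
    pd e i (fun z => Real.sqrt (f z)) y = pd e i f y / (2 * Real.sqrt (f y)) := by
  simp only [pd, (hf.hasFDerivAt.sqrt h0).fderiv]
  simp
  ring

/-- The chain rule in coordinates. -/
lemma pd_comp (e : Module.Basis ι ℝ E) (i : ι) {f : E → ℝ} {ψ : E → E} {y : E}
    (hf : DifferentiableAt ℝ f (ψ y)) (hψ : DifferentiableAt ℝ ψ y) :
    pd e i (fun z => f (ψ z)) y = ∑ a, e.repr (fderiv ℝ ψ y (e i)) a * pd e a f (ψ y) := by
  have h : fderiv ℝ (fun z => f (ψ z)) y = (fderiv ℝ f (ψ y)).comp (fderiv ℝ ψ y) :=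
    fderiv_comp y hf hψ
  simp only [pd, h, ContinuousLinearMap.comp_apply]
  conv_lhs => rw [← e.sum_repr (fderiv ℝ ψ y (e i))]
  simp only [map_sum, map_smul, smul_eq_mul]

lemma contDiffAt_pd (e : Module.Basis ι ℝ E) (i : ι) {f : E → ℝ} {y : E} {n : ℕ∞ω} {k : ℕ∞ω}
    (hf : ContDiffAt ℝ n f y) (hk : k + 1 ≤ n) : ContDiffAt ℝ k (pd e i f) y :=
  (hf.fderiv_right hk).clm_apply contDiffAt_const

lemma pd_comm (e : Module.Basis ι ℝ E) (i j : ι) {f : E → ℝ} {y : E}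
    (hf : ContDiffAt ℝ 2 f y) : pd e i (pd e j f) y = pd e j (pd e i f) y := by
  have hs := hf.isSymmSndFDerivAt (by simp)
  have hd : DifferentiableAt ℝ (fderiv ℝ f) y :=
    (hf.fderiv_right (m := 1) (by norm_num)).differentiableAt (by norm_num)
  have key : ∀ a b, pd e a (pd e b f) y = fderiv ℝ (fderiv ℝ f) y (e a) (e b) := by
    intro a b
    change fderiv ℝ (fun z => fderiv ℝ f z (e b)) y (e a) = _
    rw [fderiv_clm_apply hd (differentiableAt_const _)]
    simp
  rw [key, key]
  exact hs _ _

/-- Entrywise partial derivative of a matrix field. -/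
def pdMat (e : Module.Basis ι ℝ E) (i : ι) (A : E → Matrix ι ι ℝ) (y : E) : Matrix ι ι ℝ :=
  Matrix.of fun a b => pd e i (fun z => A z a b) y

/-- Entrywise differentiability of a matrix field. -/
def MatDiffAt (A : E → Matrix ι ι ℝ) (y : E) : Prop :=
  ∀ i j, DifferentiableAt ℝ (fun z => A z i j) y

lemma MatDiffAt.mul {A B : E → Matrix ι ι ℝ} {y : E} (hA : MatDiffAt A y) (hB : MatDiffAt B y) :
    MatDiffAt (fun z => A z * B z) y := by
  intro i j
  simp only [Matrix.mul_apply]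
  exact DifferentiableAt.fun_sum fun a _ => (hA i a).mul (hB a j)

lemma MatDiffAt.transpose {A : E → Matrix ι ι ℝ} {y : E} (hA : MatDiffAt A y) :
    MatDiffAt (fun z => (A z).transpose) y := fun i j => hA j i

lemma MatDiffAt.sub {A B : E → Matrix ι ι ℝ} {y : E} (hA : MatDiffAt A y) (hB : MatDiffAt B y) :
    MatDiffAt (fun z => A z - B z) y := fun i j => (hA i j).sub (hB i j)

lemma pdMat_mul (e : Module.Basis ι ℝ E) (i : ι) {A B : E → Matrix ι ι ℝ} {y : E}
    (hA : MatDiffAt A y) (hB : MatDiffAt B y) :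
    pdMat e i (fun z => A z * B z) y = pdMat e i A y * B y + A y * pdMat e i B y := by
  ext a b
  simp only [pdMat, Matrix.of_apply, Matrix.mul_apply, Matrix.add_apply]
  rw [pd_sum _ _ _ fun c _ => (hA a c).fun_mul (hB c b), ← Finset.sum_add_distrib]
  exact Finset.sum_congr rfl fun c _ => pd_mul e i (hA a c) (hB c b)

lemma pdMat_sub (e : Module.Basis ι ℝ E) (i : ι) {A B : E → Matrix ι ι ℝ} {y : E}
    (hA : MatDiffAt A y) (hB : MatDiffAt B y) :
    pdMat e i (fun z => A z - B z) y = pdMat e i A y - pdMat e i B y := by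
  ext a b
  simp only [pdMat, Matrix.of_apply, Matrix.sub_apply]
  exact pd_sub e i (hA a b) (hB a b)

lemma pdMat_congr (e : Module.Basis ι ℝ E) (i : ι) {A B : E → Matrix ι ι ℝ} {y : E}
    (h : A =ᶠ[𝓝 y] B) : pdMat e i A y = pdMat e i B y := by
  ext a b
  exact pd_congr e i (h.mono fun z hz => by simp [hz])

lemma pdMat_transpose (e : Module.Basis ι ℝ E) (i : ι) (A : E → Matrix ι ι ℝ) (y : E) :
    pdMat e i (fun z => (A z).transpose) y = (pdMat e i A y).transpose := rfl

/-- Jacobi's formula. -/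
lemma pd_det (e : Module.Basis ι ℝ E) (i : ι) {A : E → Matrix ι ι ℝ} {y : E}
    (hA : MatDiffAt A y) :
    pd e i (fun z => (A z).det) y = ((A y).adjugate * pdMat e i A y).trace := by
  have h1 : ∀ σ : Equiv.Perm ι, HasFDerivAt (fun z => ∏ j, A z (σ j) j)
      (∑ j, (∏ l ∈ Finset.univ.erase j, A y (σ l) l) •
        fderiv ℝ (fun z => A z (σ j) j) y) y := fun σ =>
    HasFDerivAt.finsetProd fun j _ => (hA (σ j) j).hasFDerivAt
  have h2 : HasFDerivAt (fun z => (A z).det) (∑ σ : Equiv.Perm ι,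
      ((Equiv.Perm.sign σ : ℤ) : ℝ) • (∑ j, (∏ l ∈ Finset.univ.erase j, A y (σ l) l) •
        fderiv ℝ (fun z => A z (σ j) j) y)) y := by
    simp only [Matrix.det_apply']
    exact HasFDerivAt.fun_sum fun σ _ => (h1 σ).const_mul _
  -- Cramer's rule: the `j`-th diagonal entry is the determinant with column `j` replaced by its
  -- derivative. Expanding these determinants gives the product rule for the Leibniz formula term by
  -- term.
  have h3 : ∀ j, ((A y).adjugate * pdMat e i A y) j j =
      ((A y).updateCol j fun a => pdMat e i A y a j).det := by
    intro j
    rw [← Matrix.cramer_apply, Matrix.cramer_eq_adjugate_mulVec]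
    rfl
  have h4 : pd e i (fun z => (A z).det) y = _ := congrArg (fun T => T (e i)) h2.fderiv
  rw [h4]
  simp only [Matrix.trace, Matrix.diag, h3, Matrix.det_apply']
  rw [Finset.sum_comm]
  simp only [_root_.sum_apply, _root_.smul_apply, smul_eq_mul]
  refine Finset.sum_congr rfl fun σ _ => ?_
  rw [Finset.mul_sum]
  refine Finset.sum_congr rfl fun j _ => ?_
  rw [← Finset.mul_prod_erase Finset.univ
    (fun l => (A y).updateCol j (fun a => pdMat e i A y a j) (σ l) l) (Finset.mem_univ j)]
  have h5 : ∏ l ∈ Finset.univ.erase j, (A y).updateCol j (fun a => pdMat e i A y a j) (σ l) l =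
      ∏ l ∈ Finset.univ.erase j, A y (σ l) l := by
    refine Finset.prod_congr rfl fun l hl => ?_
    simp [Finset.ne_of_mem_erase hl]
  rw [h5]
  simp [pdMat, pd]
  ring

end PartialDerivatives

/-! ### The Levi-Civita connection of a `C²` metric in matrix form. -/

section Connection

variable {E : Type*} [NormedAddCommGroup E] [NormedSpace ℝ E]
  {ι : Type*} [Fintype ι] [DecidableEq ι]

/-- `G` is the matrix field of a `C²` metric near `y`. -/
structure IsMetricAt (G : E → Matrix ι ι ℝ) (y : E) : Prop where
  contDiff : ∀ i j, ContDiffAt ℝ 2 (fun z => G z i j) y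
  symm : ∀ᶠ z in 𝓝 y, (G z).IsSymm
  det_pos : 0 < (G y).det

/-- The connection matrix `(A_k)ⁱⱼ = Γⁱₖⱼ`. -/
def connMat (e : Module.Basis ι ℝ E) (G : E → Matrix ι ι ℝ) (k : ι) (y : E) : Matrix ι ι ℝ :=
  Matrix.of fun i j => christoffel e G i k j y

namespace IsMetricAt

variable {G : E → Matrix ι ι ℝ} {y : E}

lemma contDiffAt_det (hG : IsMetricAt G y) : ContDiffAt ℝ 2 (fun z => (G z).det) y := by
  simp only [Matrix.det_apply']
  exact ContDiffAt.sum fun σ _ => contDiffAt_const.mul (contDiffAt_prod fun i _ => hG.contDiff _ _)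

/-- Positivity of the determinant is imposed only at `y` and spreads by continuity. Differentiating
the inverse or the Christoffel symbols requires the algebraic identities on a whole neighbourhood.
-/
lemma eventually (hG : IsMetricAt G y) : ∀ᶠ z in 𝓝 y, IsMetricAt G z := by
  have h1 : ∀ᶠ z in 𝓝 y, ∀ i j, ContDiffAt ℝ 2 (fun z => G z i j) z := by
    simp only [Filter.eventually_all]
    exact fun i j => (hG.contDiff i j).eventually (by simp)
  have h2 : ∀ᶠ z in 𝓝 y, 0 < (G z).det :=
    hG.contDiffAt_det.continuousAt.eventually (lt_mem_nhds hG.det_pos)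
  filter_upwards [h1, h2, hG.symm.eventually_nhds] with z a b c using ⟨a, c, b⟩

lemma symm_self (hG : IsMetricAt G y) : (G y).IsSymm := hG.symm.self_of_nhds

lemma apply_comm (hG : IsMetricAt G y) (i j : ι) : G y i j = G y j i := hG.symm_self.apply j i

lemma isUnit_det (hG : IsMetricAt G y) : IsUnit (G y).det := hG.det_pos.ne'.isUnit

lemma mul_inv (hG : IsMetricAt G y) : G y * (G y)⁻¹ = 1 := Matrix.mul_nonsing_inv _ hG.isUnit_det

lemma inv_mul (hG : IsMetricAt G y) : (G y)⁻¹ * G y = 1 := Matrix.nonsing_inv_mul _ hG.isUnit_det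

lemma inv_symm (hG : IsMetricAt G y) : ((G y)⁻¹).IsSymm := by
  rw [Matrix.IsSymm, Matrix.transpose_nonsing_inv, hG.symm_self]

lemma inv_comm (hG : IsMetricAt G y) (i j : ι) : (G y)⁻¹ i j = (G y)⁻¹ j i :=
  hG.inv_symm.apply j i

lemma contDiffAt_inv (hG : IsMetricAt G y) (i j : ι) :
    ContDiffAt ℝ 2 (fun z => (G z)⁻¹ i j) y := by
  have h : (fun z => (G z)⁻¹ i j) = fun z => ((G z).det)⁻¹ * (G z).adjugate i j := by
    ext z
    simp [Matrix.inv_def, Ring.inverse_eq_inv']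
  rw [h]
  refine (hG.contDiffAt_det.inv hG.det_pos.ne').mul ?_
  simp only [Matrix.adjugate_apply, Matrix.det_apply']
  refine ContDiffAt.sum fun σ _ => contDiffAt_const.mul (contDiffAt_prod fun l _ => ?_)
  simp only [Matrix.updateRow_apply]
  split_ifs
  · exact contDiffAt_const
  · exact hG.contDiff _ _

lemma contDiffAt_sqrt_det (hG : IsMetricAt G y) :
    ContDiffAt ℝ 2 (fun z => Real.sqrt (G z).det) y :=
  hG.contDiffAt_det.sqrt hG.det_pos.ne'

lemma matDiffAt (hG : IsMetricAt G y) : MatDiffAt G y :=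
  fun i j => (hG.contDiff i j).differentiableAt (by norm_num)

lemma matDiffAt_inv (hG : IsMetricAt G y) : MatDiffAt (fun z => (G z)⁻¹) y :=
  fun i j => (hG.contDiffAt_inv i j).differentiableAt (by norm_num)

lemma contDiffAt_christoffel (hG : IsMetricAt G y) (e : Module.Basis ι ℝ E) (k i j : ι) :
    ContDiffAt ℝ 1 (christoffel e G k i j) y := by
  have hp : ∀ a b c, ContDiffAt ℝ 1 (pd e a fun z => G z b c) y := fun a b c =>
    contDiffAt_pd e a (hG.contDiff b c) (by norm_num)
  unfold christoffel
  refine contDiffAt_const.mul (ContDiffAt.sum fun l _ => ?_)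
  exact ((hG.contDiffAt_inv k l).of_le (by norm_num)).mul (((hp _ _ _).add (hp _ _ _)).sub (hp _ _ _))

lemma differentiableAt_christoffel (hG : IsMetricAt G y) (e : Module.Basis ι ℝ E) (k i j : ι) :
    DifferentiableAt ℝ (christoffel e G k i j) y :=
  (hG.contDiffAt_christoffel e k i j).differentiableAt (by norm_num)

lemma matDiffAt_connMat (hG : IsMetricAt G y) (e : Module.Basis ι ℝ E) (k : ι) :
    MatDiffAt (connMat e G k) y :=
  fun i j => hG.differentiableAt_christoffel e i k j

lemma pd_comm_indices (hG : IsMetricAt G y) (e : Module.Basis ι ℝ E) (k i j : ι) :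
    pd e k (fun z => G z i j) y = pd e k (fun z => G z j i) y :=
  pd_congr e k (hG.symm.mono fun _ hz => hz.apply j i)

lemma christoffel_comm (hG : IsMetricAt G y) (e : Module.Basis ι ℝ E) (k i j : ι) :
    christoffel e G k i j y = christoffel e G k j i y := by
  unfold christoffel
  congr 1
  refine Finset.sum_congr rfl fun l _ => ?_
  rw [hG.pd_comm_indices e l i j]
  ring

/-- Christoffel symbols of the first kind. -/
lemma sum_mul_christoffel (hG : IsMetricAt G y) (e : Module.Basis ι ℝ E) (l i j : ι) :
    ∑ k, G y l k * christoffel e G k i j y = (1 / 2) *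
      (pd e i (fun z => G z l j) y + pd e j (fun z => G z l i) y - pd e l (fun z => G z i j) y) := by
  set u : ι → ℝ := fun l => (1 / 2) *
      (pd e i (fun z => G z l j) y + pd e j (fun z => G z l i) y - pd e l (fun z => G z i j) y) with hu
  have h1 : ∀ k, christoffel e G k i j y = ((G y)⁻¹.mulVec u) k := by
    intro k
    simp only [christoffel, Matrix.mulVec, dotProduct, Finset.mul_sum, hu]
    exact Finset.sum_congr rfl fun _ _ => by ring
  have h2 : ∑ k, G y l k * christoffel e G k i j y = ((G y).mulVec ((G y)⁻¹.mulVec u)) l := by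
    simp only [h1]; rfl
  rw [h2, Matrix.mulVec_mulVec, hG.mul_inv, Matrix.one_mulVec]

lemma mul_connMat (hG : IsMetricAt G y) (e : Module.Basis ι ℝ E) (k i j : ι) :
    (G y * connMat e G k y) i j = (1 / 2) *
      (pd e k (fun z => G z i j) y + pd e j (fun z => G z i k) y - pd e i (fun z => G z k j) y) := by
  rw [← hG.sum_mul_christoffel e i k j]
  rfl

/-- The Levi-Civita connection is compatible with the metric. -/
lemma pdMat_eq (hG : IsMetricAt G y) (e : Module.Basis ι ℝ E) (k : ι) :
    pdMat e k G y = (connMat e G k y).transpose * G y + G y * connMat e G k y := by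
  have h : (connMat e G k y).transpose * G y = (G y * connMat e G k y).transpose := by
    rw [Matrix.transpose_mul, hG.symm_self]
  rw [h]
  ext i j
  rw [Matrix.add_apply, Matrix.transpose_apply, hG.mul_connMat, hG.mul_connMat,
    hG.pd_comm_indices e k j i, hG.pd_comm_indices e i k j, hG.pd_comm_indices e j k i]
  simp only [pdMat, Matrix.of_apply]
  ring

/-- A symmetric connection compatible with the metric is the Levi-Civita connection. -/
lemma connMat_eq (hG : IsMetricAt G y) (e : Module.Basis ι ℝ E) (S : ι → Matrix ι ι ℝ)
    (hsymm : ∀ i j k, S j i k = S k i j)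
    (hcompat : ∀ k, pdMat e k G y = (S k).transpose * G y + G y * S k) (k : ι) :
    connMat e G k y = S k := by
  have h0 : ∀ a i j, pd e a (fun z => G z i j) y = (G y * S a) j i + (G y * S a) i j := by
    intro a i j
    have h1 := congrFun (congrFun (hcompat a) i) j
    have h : (S a).transpose * G y = (G y * S a).transpose := by
      rw [Matrix.transpose_mul, hG.symm_self]
    rw [h] at h1
    exact h1
  have hs : ∀ a b i, (G y * S a) i b = (G y * S b) i a := by
    intro a b i
    simp only [Matrix.mul_apply]
    exact Finset.sum_congr rfl fun c _ => by rw [hsymm]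
  -- Koszul's argument: compatibility writes each derivative of the metric as two entries of
  -- products `G S`, and in the combination defining the Christoffel symbols of the first kind the
  -- symmetry of `S` makes four of the six entries cancel.
  have h1 : G y * connMat e G k y = G y * S k := by
    ext i j
    rw [hG.mul_connMat, h0, h0, h0, hs j i k, hs i k j, hs j k i]
    ring
  have h2 := congrArg (fun T => (G y)⁻¹ * T) h1
  simpa only [← Matrix.mul_assoc, hG.inv_mul, Matrix.one_mul] using h2

/-- The derivative of the inverse metric. -/
lemma pdMat_inv (hG : IsMetricAt G y) (e : Module.Basis ι ℝ E) (k : ι) :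
    pdMat e k (fun z => (G z)⁻¹) y =
      -(connMat e G k y * (G y)⁻¹) - (G y)⁻¹ * (connMat e G k y).transpose := by
  -- Differentiate `G⁻¹ G = 1`, an identity valid near `y`, and solve for the derivative of `G⁻¹`.
  have h1 : pdMat e k (fun z => (G z)⁻¹ * G z) y = 0 := by
    rw [pdMat_congr (B := fun _ => 1) e k (hG.eventually.mono fun z hz => hz.inv_mul)]
    ext a b
    exact pd_const e k _ y
  rw [pdMat_mul e k hG.matDiffAt_inv hG.matDiffAt, hG.pdMat_eq] at h1
  have h2 := congrArg (fun T => T * (G y)⁻¹) h1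
  simp only [add_mul, mul_add, Matrix.mul_assoc, hG.mul_inv, Matrix.mul_one, zero_mul] at h2
  rw [← Matrix.mul_assoc (G y)⁻¹ (G y), hG.inv_mul, Matrix.one_mul] at h2
  rw [eq_sub_iff_add_eq, eq_neg_iff_add_eq_zero, ← h2]
  abel

/-- The derivative of the volume density. -/
lemma pd_sqrt_det (hG : IsMetricAt G y) (e : Module.Basis ι ℝ E) (k : ι) :
    pd e k (fun z => Real.sqrt (G z).det) y = Real.sqrt (G y).det * (connMat e G k y).trace := by
  have hd : DifferentiableAt ℝ (fun z => (G z).det) y :=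
    hG.contDiffAt_det.differentiableAt (by norm_num)
  have hadj : (G y).adjugate = (G y).det • (G y)⁻¹ := by
    rw [Matrix.inv_def, smul_smul, Ring.inverse_eq_inv', mul_inv_cancel₀ hG.det_pos.ne', one_smul]
  rw [pd_sqrt e k hd hG.det_pos.ne', pd_det e k hG.matDiffAt, hG.pdMat_eq, hadj]
  -- Metric compatibility splits `∂G` into two halves, each contributing one trace of the connection
  -- matrix; the resulting factor 2 cancels the one from differentiating the square root.
  have ht : ((G y)⁻¹ * ((connMat e G k y).transpose * G y + G y * connMat e G k y)).trace =
      2 * (connMat e G k y).trace := by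
    rw [mul_add, Matrix.trace_add, Matrix.trace_mul_comm, Matrix.mul_assoc, hG.mul_inv,
      ← Matrix.mul_assoc, hG.inv_mul, Matrix.mul_one, Matrix.one_mul, Matrix.trace_transpose]
    ring
  rw [Matrix.smul_mul, Matrix.trace_smul, ht, smul_eq_mul]
  have hs := Real.mul_self_sqrt hG.det_pos.le
  have hp := Real.sqrt_pos.2 hG.det_pos
  field_simp
  linear_combination (-(connMat e G k y).trace) * hs

end IsMetricAt

end Connection

/-! ### The mass vector in terms of the difference of the two connections. -/

section Divergence

open Matrix

variable {E : Type*} [NormedAddCommGroup E] [NormedSpace ℝ E]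
  {ι : Type*} [Fintype ι] [DecidableEq ι]

/-- The difference `(C_k)ⁱⱼ` of the Levi-Civita connections of `G` and `B`. -/
def connDiff (e : Module.Basis ι ℝ E) (G B : E → Matrix ι ι ℝ) (k : ι) (y : E) : Matrix ι ι ℝ :=
  connMat e G k y - connMat e B k y

/-- The differential of `V` as a vector of components. -/
def pdVec (e : Module.Basis ι ℝ E) (V : E → ℝ) (y : E) : ι → ℝ := fun i => pd e i V y

/-- The vector `gᵃᵇ Cⁱₐᵦ - gⁱᵃ Cᵇᵦₐ`. -/
def connVec (e : Module.Basis ι ℝ E) (G B : E → Matrix ι ι ℝ) (i : ι) (y : E) : ℝ :=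
  ∑ k, ((connDiff e G B k y * (G y)⁻¹) i k - (G y)⁻¹ i k * (connDiff e G B k y).trace)

/-- The covector `v tr e - e(grad V)` for `v = dV`, `e = G - B`. -/
def traceVec (e : Module.Basis ι ℝ E) (G B : E → Matrix ι ι ℝ) (V : E → ℝ) (y : E) : ι → ℝ :=
  ((G y)⁻¹ * (G y - B y)).trace • pdVec e V y - (G y - B y) *ᵥ ((G y)⁻¹ *ᵥ pdVec e V y)

/-- Ricci tensor as a matrix. -/
def ricMat (e : Module.Basis ι ℝ E) (G : E → Matrix ι ι ℝ) (y : E) : Matrix ι ι ℝ :=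
  Matrix.of fun i j => ricci e G i j y

/-- The double sum pairs equal index positions, so the matrix form carries a transpose; in this form
symmetry of the Ricci tensor is never needed. -/
lemma scalar_eq_trace (e : Module.Basis ι ℝ E) (G : E → Matrix ι ι ℝ) (y : E) :
    scalar e G y = ((G y)⁻¹ * (ricMat e G y).transpose).trace := rfl

lemma gradUp_eq (e : Module.Basis ι ℝ E) (G : E → Matrix ι ι ℝ) (V : E → ℝ) (i : ι) (y : E) :
    gradUp e G V i y = ((G y)⁻¹ *ᵥ pdVec e V y) i := rfl

/-- The connection of `G` annihilates `G`, so differentiating `G` with the connection of `B` sees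
only the difference of the two connections. First derivatives of the metric thereby become algebraic
in `connDiff`. -/
lemma covDeriv_eq {G B : E → Matrix ι ι ℝ} {y : E} (hG : IsMetricAt G y)
    (e : Module.Basis ι ℝ E) (j k l : ι) :
    covDeriv e B G j k l y =
      ((connDiff e G B j y).transpose * G y + G y * connDiff e G B j y) k l := by
  have h1 : covDeriv e B G j k l y = (pdMat e j G y -
      ((connMat e B j y).transpose * G y + G y * connMat e B j y)) k l := by
    simp only [covDeriv, pdMat, Matrix.sub_apply, Matrix.add_apply, Matrix.mul_apply,
      Matrix.transpose_apply, connMat, Matrix.of_apply, ← Finset.sum_add_distrib]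
    congr 1
    exact Finset.sum_congr rfl fun q _ => by ring
  have h2 : pdMat e j G y - ((connMat e B j y).transpose * G y + G y * connMat e B j y) =
      (connDiff e G B j y).transpose * G y + G y * connDiff e G B j y := by
    rw [hG.pdMat_eq]
    simp only [connDiff, Matrix.transpose_sub, sub_mul, mul_sub]
    abel
  rw [h1, h2]

lemma connMat_comm {G : E → Matrix ι ι ℝ} {y : E} (hG : IsMetricAt G y)
    (e : Module.Basis ι ℝ E) (i j k : ι) : connMat e G i y k j = connMat e G j y k i :=
  hG.christoffel_comm e k i j

lemma connDiff_comm {G B : E → Matrix ι ι ℝ} {y : E} (hG : IsMetricAt G y) (hB : IsMetricAt B y)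
    (e : Module.Basis ι ℝ E) (i j k : ι) : connDiff e G B i y k j = connDiff e G B j y k i := by
  simp only [connDiff, Matrix.sub_apply, connMat_comm hG e i j k, connMat_comm hB e i j k]

/-- After `covDeriv_eq` both contractions of `D̊g` are linear in `C`. Vanishing torsion identifies
one part of the first contraction with half of the trace contraction, and what remains is `connVec`.
The antisymmetrisation factors and the overall factor 2 of the definition cancel. -/
lemma massVector_eq {G B : E → Matrix ι ι ℝ} {y : E} (hG : IsMetricAt G y) (hB : IsMetricAt B y)
    (e : Module.Basis ι ℝ E) (V : E → ℝ) (i : ι) :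
    massVector e G B V i y = Real.sqrt (G y).det *
      (V y * connVec e G B i y + ((G y)⁻¹ *ᵥ traceVec e G B V y) i) := by
  set gi := (G y)⁻¹ with hgi
  have gis : ∀ a b, gi a b = gi b a := hG.inv_comm
  set C := fun j => connDiff e G B j y with hC
  have hCs : ∀ i j k, C i k j = C j k i := connDiff_comm hG hB e
  have h1 : ∀ j, ∑ k, ∑ l, (1 / 2) * (gi i k * gi j l - gi i j * gi k l) * covDeriv e B G j k l y =
      (1 / 2) * ((gi * (C j).transpose + C j * gi) i j - gi i j * (2 * (C j).trace)) := by
    intro j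
    set M := (C j).transpose * G y + G y * C j with hM
    have hc : ∀ k l, covDeriv e B G j k l y = M k l := fun k l => covDeriv_eq hG e j k l
    have h2 : (gi * M * gi) i j = (gi * (C j).transpose + C j * gi) i j := by
      rw [hM, mul_add, add_mul, Matrix.mul_assoc, Matrix.mul_assoc, hG.mul_inv, Matrix.mul_one,
        ← Matrix.mul_assoc gi (G y), hG.inv_mul, Matrix.one_mul]
    have h3 : (gi * M).trace = 2 * (C j).trace := by
      rw [hM, mul_add, Matrix.trace_add, Matrix.trace_mul_comm, Matrix.mul_assoc, hG.mul_inv,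
        ← Matrix.mul_assoc, hG.inv_mul, Matrix.mul_one, Matrix.one_mul, Matrix.trace_transpose]
      ring
    have h4 : (gi * M * gi) i j = ∑ k, ∑ l, gi i k * gi j l * M k l := by
      simp only [Matrix.mul_apply, Finset.sum_mul]
      rw [Finset.sum_comm]
      refine Finset.sum_congr rfl fun k _ => Finset.sum_congr rfl fun l _ => ?_
      rw [gis l j]; ring
    have h5 : (gi * M).trace = ∑ k, ∑ l, gi k l * M k l := by
      simp only [Matrix.trace, Matrix.diag, Matrix.mul_apply]
      rw [Finset.sum_comm]
      exact Finset.sum_congr rfl fun k _ => Finset.sum_congr rfl fun l _ => by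
        rw [gis l k]
    rw [← h2, ← h3, h4, h5]
    simp only [Finset.mul_sum, ← Finset.sum_sub_distrib]
    exact Finset.sum_congr rfl fun k _ => Finset.sum_congr rfl fun l _ => by rw [hc]; ring
  -- By symmetry of `C` in its lower indices this contraction equals the trace term, and so cancels
  -- half of the subtracted `2 tr C`.
  have h6 : ∑ j, (gi * (C j).transpose) i j = ∑ j, gi i j * (C j).trace := by
    simp only [Matrix.mul_apply, Matrix.transpose_apply, Matrix.trace, Matrix.diag, Finset.mul_sum]
    rw [Finset.sum_comm]
    exact Finset.sum_congr rfl fun k _ => Finset.sum_congr rfl fun l _ => by rw [hCs]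
  have h7 : ∑ j, ∑ k, ∑ l, (1 / 2) * (gi i k * gi j l - gi i j * gi k l) * covDeriv e B G j k l y =
      (1 / 2) * connVec e G B i y := by
    simp only [h1]
    rw [← Finset.mul_sum]
    congr 1
    simp only [Matrix.add_apply, Finset.sum_sub_distrib, Finset.sum_add_distrib, h6, connVec,
      ← hgi]
    have : ∑ j, gi i j * (2 * (C j).trace) = 2 * ∑ j, gi i j * (C j).trace := by
      rw [Finset.mul_sum]
      exact Finset.sum_congr rfl fun k _ => by ring
    rw [this]
    ring
  have h8 : ∑ j, ∑ k, (1 / 2) * (gradUp e G V i y * gi j k - gradUp e G V j y * gi i k)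
      * (G y j k - B y j k) = (1 / 2) * (gi *ᵥ traceVec e G B V y) i := by
    set w := gi *ᵥ pdVec e V y with hw
    have hg : ∀ j, gradUp e G V j y = w j := fun j => gradUp_eq e G V j y
    have hsd : ∀ a b, (G y - B y) a b = (G y - B y) b a := by
      intro a b
      simp only [Matrix.sub_apply, hG.apply_comm a b, hB.apply_comm a b]
    have ht : (gi * (G y - B y)).trace = ∑ j, ∑ k, gi j k * (G y - B y) j k := by
      simp only [Matrix.trace, Matrix.diag, Matrix.mul_apply]
      exact Finset.sum_congr rfl fun k _ => Finset.sum_congr rfl fun l _ => by rw [hsd]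
    have hz : (gi *ᵥ ((G y - B y) *ᵥ w)) i = ∑ j, ∑ k, w j * gi i k * (G y - B y) j k := by
      simp only [Matrix.mulVec, dotProduct, Finset.mul_sum]
      rw [Finset.sum_comm]
      exact Finset.sum_congr rfl fun k _ => Finset.sum_congr rfl fun l _ => by
        rw [hsd]; ring
    rw [traceVec, ← hw, Matrix.mulVec_sub, Matrix.mulVec_smul, Pi.sub_apply, Pi.smul_apply, ← hw,
      smul_eq_mul, hz, ht]
    simp only [Finset.mul_sum, Finset.sum_mul, ← Finset.sum_sub_distrib, hg]
    exact Finset.sum_congr rfl fun k _ => Finset.sum_congr rfl fun l _ => by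
      simp only [Matrix.sub_apply]; ring
  simp only [massVector]
  rw [h7, h8]
  ring

end Divergence

/-! ### The index identity behind the variation of the scalar curvature. -/

section Contraction

variable {ι : Type*} [Fintype ι]

lemma sum3_rotate (f : ι → ι → ι → ℝ) : ∑ i, ∑ j, ∑ k, f i j k = ∑ j, ∑ k, ∑ i, f i j k := by
  rw [Finset.sum_comm]
  exact Finset.sum_congr rfl fun j _ => Finset.sum_comm

/-- Adjacent transpositions of four summation indices; their composites bring every term of
`contraction_identity` to a common order. -/
lemma sum4_swap₁ (f : ι → ι → ι → ι → ℝ) :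
    ∑ i, ∑ j, ∑ k, ∑ l, f i j k l = ∑ i, ∑ j, ∑ k, ∑ l, f j i k l := Finset.sum_comm

lemma sum4_swap₂ (f : ι → ι → ι → ι → ℝ) :
    ∑ i, ∑ j, ∑ k, ∑ l, f i j k l = ∑ i, ∑ j, ∑ k, ∑ l, f i k j l :=
  Finset.sum_congr rfl fun _ _ => Finset.sum_comm

lemma sum4_swap₃ (f : ι → ι → ι → ι → ℝ) :
    ∑ i, ∑ j, ∑ k, ∑ l, f i j k l = ∑ i, ∑ j, ∑ k, ∑ l, f i j l k :=
  Finset.sum_congr rfl fun _ _ => Finset.sum_congr rfl fun _ _ => Finset.sum_comm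

lemma sum4_congr {f f' : ι → ι → ι → ι → ℝ} (h : ∀ i j k l, f i j k l = f' i j k l) :
    ∑ i, ∑ j, ∑ k, ∑ l, f i j k l = ∑ i, ∑ j, ∑ k, ∑ l, f' i j k l := by
  simp only [h]

/-- The contraction identity behind the variation of the scalar curvature: `A` and `A - C` are two
symmetric connections, `gi` an inverse metric parallel for `A`. -/
lemma contraction_identity (gi : ι → ι → ℝ) (A C : ι → ι → ι → ℝ) (dC : ι → ι → ι → ι → ℝ)
    (hgi : ∀ i j, gi i j = gi j i) (hA : ∀ i j k, A i k j = A j k i)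
    (hC : ∀ i j k, C i k j = C j k i) (hdC : ∀ l i j k, dC l i k j = dC l j k i) :
    ∑ i, ∑ k, (∑ j, (dC i k i j * gi j k + C k i j * (∑ l, (A i l l * gi j k - A i j l * gi l k
          - gi j l * A i k l)))
        - ((∑ l, (A i l l * gi i k - A i i l * gi l k - gi i l * A i k l)) * ∑ a, C k a a
          + gi i k * ∑ a, dC i k a a)) =
      ∑ j, ∑ k, gi j k * ((∑ i, (dC i j i k - dC k i i j)) + ∑ i, ∑ l,
        (A i i l * A j l k - A k i l * A i l j
          - ((A i i l - C i i l) * (A j l k - C j l k) - (A k i l - C k i l) * (A i l j - C i l j))))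
      - ∑ j, ∑ k, gi j k * ∑ i, ∑ l, (C j i l * C k l i - C l i i * C j l k) := by
  have e1 : ∑ i, ∑ k, ∑ j, dC i k i j * gi j k = ∑ j, ∑ k, ∑ i, gi j k * dC i j i k := by
    rw [sum3_rotate]
    exact Finset.sum_congr rfl fun a _ => Finset.sum_congr rfl fun b _ =>
      Finset.sum_congr rfl fun c _ => by rw [hgi]; ring
  have e2 : ∑ i, ∑ k, ∑ a, gi i k * dC i k a a = ∑ j, ∑ k, ∑ i, gi j k * dC k i i j := by
    rw [Finset.sum_comm]
    exact Finset.sum_congr rfl fun a _ => Finset.sum_congr rfl fun b _ =>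
      Finset.sum_congr rfl fun c _ => by rw [hgi, hdC b c a c]
  -- The terms bilinear in `A` and `C`: `a1`, `a2`, `a3` and `a6` match the mixed terms of the
  -- difference of the two curvature expressions, while `a4` makes the remaining two terms cancel
  -- each other.
  have a1 : ∑ i, ∑ k, ∑ j, ∑ l, C k i j * (A i l l * gi j k) =
      ∑ j, ∑ k, ∑ i, ∑ l, gi j k * (A i i l * C j l k) :=
    (sum4_swap₁ _).trans <| (sum4_swap₂ _).trans <| (sum4_swap₃ _).trans <|
      sum4_congr fun p q s t => by rw [hgi q p, hA t s s]; ring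
  have a2 : ∑ i, ∑ k, ∑ j, ∑ l, C k i j * (A i j l * gi l k) =
      ∑ j, ∑ k, ∑ i, ∑ l, gi j k * (C k i l * A i l j) :=
    (sum4_swap₃ _).trans <| (sum4_swap₁ _).trans <| (sum4_swap₂ _).trans <| (sum4_swap₁ _).trans <|
      sum4_congr fun p q s t => by ring
  have a3 : ∑ i, ∑ k, ∑ j, ∑ l, C k i j * (gi j l * A i k l) =
      ∑ j, ∑ k, ∑ i, ∑ l, gi j k * (A k i l * C i l j) :=
    (sum4_swap₂ _).trans <| (sum4_swap₃ _).trans <| (sum4_swap₁ _).trans <| (sum4_swap₂ _).trans <|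
      (sum4_swap₃ _).trans <| sum4_congr fun p q s t => by rw [hA t q s]; ring
  have a4 : ∑ i, ∑ k, ∑ l, ∑ a, A i i l * gi l k * C k a a =
      ∑ i, ∑ k, ∑ l, ∑ a, A i l l * gi i k * C k a a :=
    (sum4_swap₁ _).trans <| (sum4_swap₂ _).trans <| (sum4_swap₁ _).trans <|
      sum4_congr fun p q s t => by rw [hA s p s]
  have a6 : ∑ i, ∑ k, ∑ l, ∑ a, gi i l * A i k l * C k a a =
      ∑ j, ∑ k, ∑ i, ∑ l, gi j k * (C i i l * A j l k) :=
    (sum4_swap₂ _).trans <| (sum4_swap₃ _).trans <|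
      sum4_congr fun p q s t => by rw [hC t s s]; ring
  -- Expanding the products of `A - C` leaves terms quadratic in `C`; by `b3` and `b6` they are
  -- exactly compensated by the last sum of the identity.
  have b3 : ∑ j, ∑ k, ∑ i, ∑ l, gi j k * (C i i l * C j l k) =
      ∑ j, ∑ k, ∑ i, ∑ l, gi j k * (C l i i * C j l k) :=
    sum4_congr fun p q s t => by rw [hC s t s]
  have b6 : ∑ j, ∑ k, ∑ i, ∑ l, gi j k * (C k i l * C i l j) =
      ∑ j, ∑ k, ∑ i, ∑ l, gi j k * (C j i l * C k l i) :=
    (sum4_swap₃ _).trans <| sum4_congr fun p q s t => by rw [hC t p s]; ring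
  have lhs : ∑ i, ∑ k, (∑ j, (dC i k i j * gi j k + C k i j * (∑ l, (A i l l * gi j k
        - A i j l * gi l k - gi j l * A i k l)))
        - ((∑ l, (A i l l * gi i k - A i i l * gi l k - gi i l * A i k l)) * ∑ a, C k a a
          + gi i k * ∑ a, dC i k a a)) =
      ((∑ i, ∑ k, ∑ j, dC i k i j * gi j k) + ((∑ i, ∑ k, ∑ j, ∑ l, C k i j * (A i l l * gi j k))
        - (∑ i, ∑ k, ∑ j, ∑ l, C k i j * (A i j l * gi l k))
        - (∑ i, ∑ k, ∑ j, ∑ l, C k i j * (gi j l * A i k l))))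
      - (((∑ i, ∑ k, ∑ l, ∑ a, A i l l * gi i k * C k a a)
        - (∑ i, ∑ k, ∑ l, ∑ a, A i i l * gi l k * C k a a)
        - (∑ i, ∑ k, ∑ l, ∑ a, gi i l * A i k l * C k a a))
        + ∑ i, ∑ k, ∑ a, gi i k * dC i k a a) := by
    simp only [← Finset.sum_add_distrib, ← Finset.sum_sub_distrib]
    refine Finset.sum_congr rfl fun i _ => Finset.sum_congr rfl fun k _ => ?_
    simp only [Finset.sum_add_distrib, Finset.sum_sub_distrib, Finset.mul_sum, mul_sub, sub_mul,
      Finset.sum_mul]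
    exact congrArg₂ _ rfl (congrArg₂ _ (congrArg₂ _ (congrArg₂ _ Finset.sum_comm Finset.sum_comm)
      Finset.sum_comm) rfl)
  have rhs : ∑ j, ∑ k, gi j k * ((∑ i, (dC i j i k - dC k i i j)) + ∑ i, ∑ l,
        (A i i l * A j l k - A k i l * A i l j
          - ((A i i l - C i i l) * (A j l k - C j l k) - (A k i l - C k i l) * (A i l j - C i l j))))
      - ∑ j, ∑ k, gi j k * ∑ i, ∑ l, (C j i l * C k l i - C l i i * C j l k) =
      (∑ j, ∑ k, ∑ i, gi j k * dC i j i k) - (∑ j, ∑ k, ∑ i, gi j k * dC k i i j)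
        + (∑ j, ∑ k, ∑ i, ∑ l, gi j k * (A i i l * C j l k))
        + (∑ j, ∑ k, ∑ i, ∑ l, gi j k * (C i i l * A j l k))
        - (∑ j, ∑ k, ∑ i, ∑ l, gi j k * (C i i l * C j l k))
        - (∑ j, ∑ k, ∑ i, ∑ l, gi j k * (A k i l * C i l j))
        - (∑ j, ∑ k, ∑ i, ∑ l, gi j k * (C k i l * A i l j))
        + (∑ j, ∑ k, ∑ i, ∑ l, gi j k * (C k i l * C i l j))
        - (∑ j, ∑ k, ∑ i, ∑ l, gi j k * (C j i l * C k l i))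
        + (∑ j, ∑ k, ∑ i, ∑ l, gi j k * (C l i i * C j l k)) := by
    simp only [← Finset.sum_add_distrib, ← Finset.sum_sub_distrib]
    refine Finset.sum_congr rfl fun j _ => Finset.sum_congr rfl fun k _ => ?_
    simp only [mul_add, Finset.mul_sum, ← Finset.sum_sub_distrib]
    refine Finset.sum_congr rfl fun i _ => ?_
    simp only [Finset.sum_sub_distrib, mul_sub, sub_mul]
    ring
  rw [lhs, rhs]
  linear_combination e1 - e2 + a1 - a2 - a3 + a4 + a6 + b3 - b6

end Contraction

/-! ### The divergence of the connection part of the mass vector. -/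

section DivergenceIdentity

open Matrix

variable {E : Type*} [NormedAddCommGroup E] [NormedSpace ℝ E]
  {ι : Type*} [Fintype ι] [DecidableEq ι] {G B : E → Matrix ι ι ℝ} {V : E → ℝ} {y : E}

lemma matDiffAt_connDiff (hG : IsMetricAt G y) (hB : IsMetricAt B y) (e : Module.Basis ι ℝ E)
    (k : ι) : MatDiffAt (connDiff e G B k) y :=
  (hG.matDiffAt_connMat e k).sub (hB.matDiffAt_connMat e k)

/-- The derivative of the density `√det g gʲᵏ`. -/
lemma pd_sqrt_det_mul_inv (hG : IsMetricAt G y) (e : Module.Basis ι ℝ E) (i j k : ι) :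
    pd e i (fun z => Real.sqrt (G z).det * (G z)⁻¹ j k) y = Real.sqrt (G y).det *
      ∑ l, (connMat e G i y l l * (G y)⁻¹ j k - connMat e G i y j l * (G y)⁻¹ l k
        - (G y)⁻¹ j l * connMat e G i y k l) := by
  have h1 : pd e i (fun z => (G z)⁻¹ j k) y = (-(connMat e G i y * (G y)⁻¹) -
      (G y)⁻¹ * (connMat e G i y).transpose) j k := by
    rw [← hG.pdMat_inv]; rfl
  rw [pd_mul e i (hG.contDiffAt_sqrt_det.differentiableAt (by norm_num))
    (hG.matDiffAt_inv j k), hG.pd_sqrt_det, h1]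
  simp only [Matrix.sub_apply, Matrix.neg_apply, Matrix.mul_apply, Matrix.transpose_apply,
    Matrix.trace, Matrix.diag, Finset.sum_sub_distrib, ← Finset.sum_mul]
  ring

/-- The derivative part of the Ricci tensor is linear in the Christoffel symbols and so passes to
the tensor `connDiff`; the quadratic parts stay separate until `contraction_identity` combines them.
-/
lemma ricci_sub_ricci (hG : IsMetricAt G y) (hB : IsMetricAt B y) (e : Module.Basis ι ℝ E)
    (j k : ι) :
    ricci e G j k y - ricci e B j k y =
      (∑ i, (pd e i (fun z => connDiff e G B j z i k) y - pd e k (fun z => connDiff e G B i z i j) y))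
      + ∑ i, ∑ l, (connMat e G i y i l * connMat e G j y l k - connMat e G k y i l * connMat e G i y l j
        - (connMat e B i y i l * connMat e B j y l k - connMat e B k y i l * connMat e B i y l j)) := by
  have h1 : ∀ a b c d, pd e a (fun z => connDiff e G B b z c d) y =
      pd e a (christoffel e G c b d) y - pd e a (christoffel e B c b d) y := fun a b c d =>
    pd_sub e a (hG.differentiableAt_christoffel e c b d) (hB.differentiableAt_christoffel e c b d)
  simp only [ricci, h1, Finset.sum_sub_distrib, connMat, Matrix.of_apply]
  ring

/-- The contracted difference of the Ricci tensors is a divergence up to quadratic terms. -/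
lemma sum_pd_connVec (hG : IsMetricAt G y) (hB : IsMetricAt B y) (e : Module.Basis ι ℝ E) :
    ∑ i, pd e i (fun z => Real.sqrt (G z).det * connVec e G B i z) y = Real.sqrt (G y).det *
      (∑ j, ∑ k, (G y)⁻¹ j k * (ricci e G j k y - ricci e B j k y)
      - ∑ j, ∑ k, (G y)⁻¹ j k * ∑ i, ∑ l, (connDiff e G B j y i l * connDiff e G B k y l i
        - connDiff e G B l y i i * connDiff e G B j y l k)) := by
  set C : ι → ι → ι → ℝ := fun k i j => connDiff e G B k y i j with hC
  set A : ι → ι → ι → ℝ := fun k i j => connMat e G k y i j with hA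
  set dC : ι → ι → ι → ι → ℝ := fun l k i j => pd e l (fun z => connDiff e G B k z i j) y with hdC
  have hCB : ∀ k i j, connMat e B k y i j = A k i j - C k i j := fun k i j => by
    simp [hC, hA, connDiff]
  -- The symmetry of `connDiff` has to hold near `y`, not only at `y`, in order to be inherited by
  -- its derivatives.
  have hdCs : ∀ l i j k, dC l i k j = dC l j k i := fun l i j k =>
    pd_congr e l (by
      filter_upwards [hG.eventually, hB.eventually] with z h1 h2
      exact connDiff_comm h1 h2 e i j k)
  have key := contraction_identity (fun i j => (G y)⁻¹ i j) A C dC hG.inv_comm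
    (connMat_comm hG e) (connDiff_comm hG hB e) hdCs
  have hP : ∀ j k, DifferentiableAt ℝ (fun z => Real.sqrt (G z).det * (G z)⁻¹ j k) y := fun j k =>
    (hG.contDiffAt_sqrt_det.differentiableAt (by norm_num)).fun_mul (hG.matDiffAt_inv j k)
  have hCd := matDiffAt_connDiff hG hB e
  -- The density `√det g gʲᵏ` is grouped as one factor, since its derivative involves only
  -- connection coefficients.
  have h1 : ∀ i, (fun z => Real.sqrt (G z).det * connVec e G B i z) = fun z =>
      ∑ k, (∑ j, connDiff e G B k z i j * (Real.sqrt (G z).det * (G z)⁻¹ j k)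
        - (Real.sqrt (G z).det * (G z)⁻¹ i k) * ∑ a, connDiff e G B k z a a) := by
    intro i
    ext z
    simp only [connVec, Matrix.mul_apply, Matrix.trace, Matrix.diag, Finset.mul_sum]
    refine Finset.sum_congr rfl fun k _ => ?_
    rw [mul_sub, Finset.mul_sum, Finset.mul_sum]
    congr 1 <;> exact Finset.sum_congr rfl fun _ _ => by ring
  have h2 : ∀ i, pd e i (fun z => Real.sqrt (G z).det * connVec e G B i z) y =
      Real.sqrt (G y).det * ∑ k, (∑ j, (dC i k i j * (G y)⁻¹ j k + C k i j *
          (∑ l, (A i l l * (G y)⁻¹ j k - A i j l * (G y)⁻¹ l k - (G y)⁻¹ j l * A i k l)))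
        - ((∑ l, (A i l l * (G y)⁻¹ i k - A i i l * (G y)⁻¹ l k - (G y)⁻¹ i l * A i k l)) *
            ∑ a, C k a a + (G y)⁻¹ i k * ∑ a, dC i k a a)) := by
    intro i
    have d1 : ∀ k j, DifferentiableAt ℝ
        (fun z => connDiff e G B k z i j * (Real.sqrt (G z).det * (G z)⁻¹ j k)) y := fun k j =>
      (hCd k i j).fun_mul (hP j k)
    have d2 : ∀ k, DifferentiableAt ℝ (fun z => ∑ a, connDiff e G B k z a a) y := fun k =>
      DifferentiableAt.fun_sum fun a _ => hCd k a a
    rw [h1, pd_sum _ _ _ fun k _ => (DifferentiableAt.fun_sum fun j _ => d1 k j).fun_sub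
      ((hP i k).fun_mul (d2 k)), Finset.mul_sum]
    refine Finset.sum_congr rfl fun k _ => ?_
    rw [pd_sub _ _ (DifferentiableAt.fun_sum fun j _ => d1 k j) ((hP i k).fun_mul (d2 k)),
      pd_sum _ _ _ fun j _ => d1 k j, pd_mul _ _ (hP i k) (d2 k), pd_sum _ _ _ fun a _ => hCd k a a,
      pd_sqrt_det_mul_inv hG]
    have e1 : ∑ j, pd e i (fun z => connDiff e G B k z i j *
          (Real.sqrt (G z).det * (G z)⁻¹ j k)) y = Real.sqrt (G y).det *
        ∑ j, (dC i k i j * (G y)⁻¹ j k + C k i j *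
          (∑ l, (A i l l * (G y)⁻¹ j k - A i j l * (G y)⁻¹ l k - (G y)⁻¹ j l * A i k l))) := by
      rw [Finset.mul_sum]
      refine Finset.sum_congr rfl fun j _ => ?_
      rw [pd_mul _ _ (hCd k i j) (hP j k), pd_sqrt_det_mul_inv hG, mul_add]
      exact congrArg₂ _ (by ring) (mul_left_comm _ _ _)
    rw [e1, mul_sub, mul_add]
    refine congrArg₂ _ rfl (congrArg₂ _ (mul_assoc _ _ _) (mul_assoc _ _ _))
  simp only [h2]
  rw [← Finset.mul_sum, key]
  congr 2
  refine Finset.sum_congr rfl fun j _ => Finset.sum_congr rfl fun k _ => ?_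
  rw [ricci_sub_ricci hG hB]
  simp only [hCB]
  rfl

end DivergenceIdentity

/-! ### The divergence of the full mass vector for a static potential. -/

section MassDivergence

open Matrix

variable {E : Type*} [NormedAddCommGroup E] [NormedSpace ℝ E]
  {ι : Type*} [Fintype ι] [DecidableEq ι] {G B : E → Matrix ι ι ℝ} {V : E → ℝ} {y : E}

lemma pd_trace (e : Module.Basis ι ℝ E) (i : ι) {A : E → Matrix ι ι ℝ} (hA : MatDiffAt A y) :
    pd e i (fun z => (A z).trace) y = (pdMat e i A y).trace :=
  pd_sum _ _ _ fun a _ => hA a a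

lemma differentiableAt_mulVec {A : E → Matrix ι ι ℝ} {u : E → ι → ℝ} (hA : MatDiffAt A y)
    (hu : ∀ a, DifferentiableAt ℝ (fun z => u z a) y) (l : ι) :
    DifferentiableAt ℝ (fun z => (A z *ᵥ u z) l) y :=
  DifferentiableAt.fun_sum fun a _ => (hA l a).fun_mul (hu a)

lemma pd_mulVec (e : Module.Basis ι ℝ E) (i : ι) {A : E → Matrix ι ι ℝ} {u : E → ι → ℝ}
    (hA : MatDiffAt A y) (hu : ∀ a, DifferentiableAt ℝ (fun z => u z a) y) (l : ι) :
    pd e i (fun z => (A z *ᵥ u z) l) y =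
      (pdMat e i A y *ᵥ u y + A y *ᵥ fun a => pd e i (fun z => u z a) y) l := by
  have h := pd_sum Finset.univ e i (f := fun a z => A z l a * u z a) (y := y)
    fun a _ => (hA l a).fun_mul (hu a)
  refine h.trans ?_
  rw [Pi.add_apply, Matrix.mulVec, Matrix.mulVec, dotProduct, dotProduct, ← Finset.sum_add_distrib]
  exact Finset.sum_congr rfl fun a _ => pd_mul e i (hA l a) (hu a)

/-- The Hessian as a matrix. -/
def hessMat (e : Module.Basis ι ℝ E) (B : E → Matrix ι ι ℝ) (V : E → ℝ) (y : E) : Matrix ι ι ℝ :=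
  Matrix.of fun i j => hessian e B V i j y

lemma differentiableAt_pd (hV : ContDiffAt ℝ 2 V y) (e : Module.Basis ι ℝ E) (l : ι) :
    DifferentiableAt ℝ (pd e l V) y :=
  (contDiffAt_pd e l hV (k := 1) (by norm_num)).differentiableAt (by norm_num)

lemma traceVec_eq (e : Module.Basis ι ℝ E) (G B : E → Matrix ι ι ℝ) (V : E → ℝ) (y : E) :
    traceVec e G B V y = ((G y)⁻¹ * (G y - B y)).trace • pdVec e V y -
      ((G y - B y) * (G y)⁻¹) *ᵥ pdVec e V y := by
  rw [traceVec, Matrix.mulVec_mulVec]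

lemma differentiableAt_traceVec (hG : IsMetricAt G y) (hB : IsMetricAt B y)
    (hV : ContDiffAt ℝ 2 V y) (e : Module.Basis ι ℝ E) (l : ι) :
    DifferentiableAt ℝ (fun z => traceVec e G B V z l) y := by
  simp only [traceVec_eq, Pi.sub_apply, Pi.smul_apply, smul_eq_mul]
  refine DifferentiableAt.sub (DifferentiableAt.mul ?_ (differentiableAt_pd hV e l)) ?_
  · exact DifferentiableAt.fun_sum fun a _ =>
      (hG.matDiffAt_inv.mul (hG.matDiffAt.sub hB.matDiffAt)) a a
  · exact differentiableAt_mulVec ((hG.matDiffAt.sub hB.matDiffAt).mul hG.matDiffAt_inv)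
      (differentiableAt_pd hV e) l

/-- The covariant derivative of `traceVec` for the connection of `G`. -/
lemma pd_traceVec_sub (hG : IsMetricAt G y) (hB : IsMetricAt B y) (hV : ContDiffAt ℝ 2 V y)
    (e : Module.Basis ι ℝ E) (i : ι) {C D gi : Matrix ι ι ℝ} (hC : C = connDiff e G B i y)
    (hD : D = G y - B y) (hgi : gi = (G y)⁻¹) :
    (fun l => pd e i (fun z => traceVec e G B V z l) y) -
        (connMat e G i y).transpose *ᵥ traceVec e G B V y =
      (2 * C.trace) • pdVec e V y - C.transpose *ᵥ pdVec e V y - (G y * C * gi) *ᵥ pdVec e V y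
      + (gi * D).trace • hessMat e B V y i - (D * gi) *ᵥ hessMat e B V y i
      + (-(2 * (C * gi * D).trace) • pdVec e V y - (gi * D).trace • (C.transpose *ᵥ pdVec e V y)
        + (D * gi * C.transpose + C.transpose * D * gi + D * C * gi) *ᵥ pdVec e V y) := by
  set v := pdVec e V y with hv
  set A := connMat e G i y with hA
  set dv : ι → ℝ := fun l => pd e i (pd e l V) y with hdv
  have hAb : connMat e B i y = A - C := by rw [hC, connDiff]; abel
  have hDd : MatDiffAt (fun z => G z - B z) y := hG.matDiffAt.sub hB.matDiffAt
  have hgG : gi * G y = 1 := by rw [hgi, hG.inv_mul]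
  have hGg : G y * gi = 1 := by rw [hgi, hG.mul_inv]
  have hB' : B y = G y - D := by rw [hD]; abel
  -- The derivative of `G` is expressed with `A` and that of `B` with `A - C`. The `A` terms form
  -- the connection acting on `e`, and the `C` terms act on `B`; writing `B = G - D` there later
  -- separates linear from quadratic contributions.
  have hdD : pdMat e i (fun z => G z - B z) y =
      A.transpose * D + D * A + C.transpose * B y + B y * C := by
    rw [pdMat_sub e i hG.matDiffAt hB.matDiffAt, hG.pdMat_eq, hB.pdMat_eq, hAb, hD,
      Matrix.transpose_sub]
    noncomm_ring
  have hdg : pdMat e i (fun z => (G z)⁻¹) y = -(A * gi) - gi * A.transpose := by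
    rw [hG.pdMat_inv, hgi]
  have hH : hessMat e B V y i = dv - (A - C).transpose *ᵥ v := by
    rw [← hAb]
    ext l
    simp only [hessMat, Matrix.of_apply, hessian, hdv, Pi.sub_apply, Matrix.mulVec, dotProduct,
      Matrix.transpose_apply, connMat, hv, pdVec]
  -- A trace is a scalar, so the connection `A` must drop out; the part linear in `C` survives with
  -- coefficient 2.
  have hdt : pd e i (fun z => ((G z)⁻¹ * (G z - B z)).trace) y =
      2 * C.trace - 2 * (C * gi * D).trace := by
    rw [pd_trace e i (hG.matDiffAt_inv.mul hDd), pdMat_mul e i hG.matDiffAt_inv hDd, hdD, hdg,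
      ← hgi, ← hD]
    have t1 : (gi * (A.transpose * D)).trace = (gi * A.transpose * D).trace := by
      rw [Matrix.mul_assoc]
    have t2 : (gi * (D * A)).trace = (A * gi * D).trace := by
      rw [← Matrix.mul_assoc, Matrix.trace_mul_comm, Matrix.mul_assoc]
    have t3 : (gi * (C.transpose * B y)).trace = C.trace - (C * gi * D).trace := by
      rw [hB', Matrix.mul_sub, Matrix.mul_sub, Matrix.trace_sub, Matrix.trace_mul_comm, Matrix.mul_assoc,
        hGg, Matrix.mul_one, Matrix.trace_transpose, ← Matrix.trace_transpose (gi * _)]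
      have hDs : D.transpose = D := by
        rw [hD, Matrix.transpose_sub, hG.symm_self, hB.symm_self]
      have hgs : gi.transpose = gi := by rw [hgi, hG.inv_symm]
      rw [Matrix.transpose_mul, Matrix.transpose_mul, Matrix.transpose_transpose, hDs, hgs,
        Matrix.mul_assoc, Matrix.trace_mul_comm D]
    have t4 : (gi * (B y * C)).trace = C.trace - (C * gi * D).trace := by
      rw [hB', Matrix.sub_mul, Matrix.mul_sub, Matrix.trace_sub, ← Matrix.mul_assoc, hgG, Matrix.one_mul,
        ← Matrix.mul_assoc, Matrix.trace_mul_comm (gi * D), Matrix.mul_assoc C]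
    simp only [Matrix.mul_add, Matrix.sub_mul, Matrix.neg_mul, Matrix.trace_add, Matrix.trace_sub,
      Matrix.trace_neg, t1, t2, t3, t4]
    ring
  have hdy : (fun l => pd e i (fun z => traceVec e G B V z l) y) =
      (2 * C.trace - 2 * (C * gi * D).trace) • v + (gi * D).trace • dv -
        ((A.transpose * D + D * A + C.transpose * B y + B y * C) * gi +
          D * (-(A * gi) - gi * A.transpose)) *ᵥ v - (D * gi) *ᵥ dv := by
    ext l
    have d1 : DifferentiableAt ℝ (fun z => ((G z)⁻¹ * (G z - B z)).trace) y :=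
      DifferentiableAt.fun_sum fun a _ => (hG.matDiffAt_inv.mul hDd) a a
    have d2 := hDd.mul hG.matDiffAt_inv
    have d3 : ∀ a, DifferentiableAt ℝ (fun z => pdVec e V z a) y := differentiableAt_pd hV e
    simp only [traceVec_eq, Pi.sub_apply, Pi.smul_apply, smul_eq_mul]
    rw [pd_sub e i (d1.fun_mul (d3 l)) (differentiableAt_mulVec d2 d3 l), pd_mulVec e i d2 d3,
      pd_mul e i d1 (d3 l), hdt, pdMat_mul e i hDd hG.matDiffAt_inv, hdD, hdg, ← hD, ← hgi]
    simp only [Pi.add_apply, Pi.smul_apply, smul_eq_mul, hv, hdv]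
    simp only [pdVec]
    ring
  rw [hdy, hH, traceVec_eq, ← hD, ← hgi, ← hv, hB']
  have m1 : ((A.transpose * D + D * A + C.transpose * (G y - D) + (G y - D) * C) * gi +
          D * (-(A * gi) - gi * A.transpose)) =
      A.transpose * (D * gi) + C.transpose - C.transpose * D * gi + G y * C * gi - D * C * gi
        - D * gi * A.transpose := by
    have : C.transpose * (G y - D) * gi = C.transpose - C.transpose * D * gi := by
      rw [Matrix.mul_sub, Matrix.sub_mul, Matrix.mul_assoc, hGg, Matrix.mul_one]
    simp only [Matrix.add_mul, this]
    noncomm_ring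
  rw [m1, Matrix.transpose_sub]
  simp only [Matrix.add_mulVec, Matrix.sub_mulVec, Matrix.mulVec_sub, Matrix.mulVec_smul,
    ← Matrix.mulVec_mulVec]
  module

/-- The divergence of the second half of the mass vector. -/
lemma sum_pd_gradTraceVec (hG : IsMetricAt G y) (hB : IsMetricAt B y) (hV : ContDiffAt ℝ 2 V y)
    (e : Module.Basis ι ℝ E) :
    ∑ i, pd e i (fun z => Real.sqrt (G z).det * ((G z)⁻¹ *ᵥ traceVec e G B V z) i) y =
      Real.sqrt (G y).det * ∑ i, (G y)⁻¹ i ⬝ᵥ ((fun l => pd e i (fun z => traceVec e G B V z l) y) -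
        (connMat e G i y).transpose *ᵥ traceVec e G B V y) := by
  set Y := traceVec e G B V with hY
  set gi := (G y)⁻¹ with hgi
  set A := fun i => connMat e G i y with hA
  have hP : ∀ j k, DifferentiableAt ℝ (fun z => Real.sqrt (G z).det * (G z)⁻¹ j k) y := fun j k =>
    (hG.contDiffAt_sqrt_det.differentiableAt (by norm_num)).fun_mul (hG.matDiffAt_inv j k)
  have hYd : ∀ l, DifferentiableAt ℝ (fun z => Y z l) y := differentiableAt_traceVec hG hB hV e
  have h1 : ∀ i, pd e i (fun z => Real.sqrt (G z).det * ((G z)⁻¹ *ᵥ Y z) i) y =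
      Real.sqrt (G y).det * (∑ l, (∑ a, (A i a a * gi i l - A i i a * gi a l - gi i a * A i l a)) * Y y l
        + ∑ l, gi i l * pd e i (fun z => Y z l) y) := by
    intro i
    have : (fun z => Real.sqrt (G z).det * ((G z)⁻¹ *ᵥ Y z) i) =
        fun z => ∑ l, (Real.sqrt (G z).det * (G z)⁻¹ i l) * Y z l := by
      ext z
      simp only [Matrix.mulVec, dotProduct, Finset.mul_sum, mul_assoc]
    rw [this, pd_sum _ _ _ fun l _ => (hP i l).fun_mul (hYd l), ← Finset.sum_add_distrib,
      Finset.mul_sum]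
    refine Finset.sum_congr rfl fun l _ => ?_
    rw [pd_mul e i (hP i l) (hYd l), pd_sqrt_det_mul_inv hG, mul_add, mul_assoc, mul_assoc]
  simp only [h1]
  rw [← Finset.mul_sum]
  congr 1
  -- The term from differentiating `√det g` cancels one term from the inverse metric, again because
  -- the connection is torsion free. Only the covariant derivative of the covector remains.
  have h2 : ∑ i, ∑ l, ∑ a, A i a a * gi i l * Y y l = ∑ i, ∑ l, ∑ a, A i i a * gi a l * Y y l := by
    have s : ∀ f : ι → ι → ι → ℝ, ∑ i, ∑ j, ∑ k, f i j k = ∑ i, ∑ j, ∑ k, f k j i := by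
      intro f
      rw [sum3_rotate, Finset.sum_comm (f := fun i j => ∑ k, f k j i)]
    rw [s]
    refine Finset.sum_congr rfl fun i _ => Finset.sum_congr rfl fun j _ =>
      Finset.sum_congr rfl fun k _ => ?_
    rw [show A k i i = A i i k from connMat_comm hG e k i i]
  have h3 : ∀ i, ∑ l, gi i l * ((connMat e G i y).transpose *ᵥ Y y) l = ∑ l, ∑ a, gi i a * A i l a * Y y l := by
    intro i
    simp only [Matrix.mulVec, dotProduct, Finset.mul_sum, Matrix.transpose_apply]
    rw [Finset.sum_comm]
    exact Finset.sum_congr rfl fun a _ => Finset.sum_congr rfl fun b _ => by ring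
  simp only [dotProduct, Pi.sub_apply, mul_sub, Finset.sum_sub_distrib, Finset.sum_add_distrib,
    h3, Finset.sum_mul, sub_mul, h2]
  ring

/-- The quadratic remainder in the divergence of the mass vector. -/
def massRemainder (e : Module.Basis ι ℝ E) (G B : E → Matrix ι ι ℝ) (V : E → ℝ) (y : E) : ℝ :=
  let gi := (G y)⁻¹
  let D := G y - B y
  let C := fun i => connDiff e G B i y
  let v := pdVec e V y
  let M := (B y)⁻¹ * ((ricMat e B y).transpose + (Fintype.card ι : ℝ) • B y)
  V y * ((gi * D * (gi * D * M)).trace - (gi * D).trace * (gi * D * M).trace)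
  - V y * ∑ j, ∑ k, gi j k * ∑ i, ∑ l, (C j i l * C k l i - C l i i * C j l k)
  + ∑ i, gi i ⬝ᵥ (-(2 * (C i * gi * D).trace) • v - (gi * D).trace • ((C i).transpose *ᵥ v)
        + (D * gi * (C i).transpose + (C i).transpose * D * gi + D * C i * gi) *ᵥ v)

/-- The divergence of the mass vector of a static potential is the difference of the scalar
curvatures up to quadratic terms. -/
theorem sum_pd_massVector (hG : IsMetricAt G y) (hB : IsMetricAt B y) (hV : ContDiffAt ℝ 2 V y)
    (e : Module.Basis ι ℝ E) (hlap : laplacian e B V y = Fintype.card ι * V y)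
    (hhess : ∀ i j, hessian e B V i j y = V y * (ricci e B i j y + Fintype.card ι * B y i j)) :
    ∑ i, pd e i (massVector e G B V i) y = Real.sqrt (G y).det *
      (V y * (scalar e G y - scalar e B y) + massRemainder e G B V y) := by
  set gi := (G y)⁻¹ with hgi
  set D := G y - B y with hD
  set C := fun i => connDiff e G B i y with hC
  set v := pdVec e V y with hv
  set bi := (B y)⁻¹ with hbi
  set n : ℝ := (Fintype.card ι : ℝ) with hn
  set s := Real.sqrt (G y).det with hs
  set P := (ricMat e B y).transpose + n • B y with hP
  have hVd : DifferentiableAt ℝ V y := hV.differentiableAt (by norm_num)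
  have hsd := hG.contDiffAt_sqrt_det.differentiableAt (by norm_num : (2 : ℕ∞ω) ≠ 0)
  have hXd : ∀ i, DifferentiableAt ℝ (connVec e G B i) y := by
    intro i
    refine DifferentiableAt.fun_sum fun k _ => ?_
    have h1 := matDiffAt_connDiff hG hB e k
    exact ((h1.mul hG.matDiffAt_inv) i k).fun_sub
      ((hG.matDiffAt_inv i k).fun_mul (DifferentiableAt.fun_sum fun a _ => h1 a a))
  have hYd := differentiableAt_traceVec hG hB hV e
  have hX := sum_pd_connVec hG hB e
  have hZ := sum_pd_gradTraceVec hG hB hV e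
  -- Product rule for `V · (√det g X) + √det g g⁻¹ Y`. The first summand on the right is linear in
  -- `C` and has no derivative of `C`; it will be cancelled by `hlin`.
  have h1 : ∀ i, pd e i (massVector e G B V i) y = pd e i V y * (s * connVec e G B i y) +
      V y * pd e i (fun z => Real.sqrt (G z).det * connVec e G B i z) y +
      pd e i (fun z => Real.sqrt (G z).det * ((G z)⁻¹ *ᵥ traceVec e G B V z) i) y := by
    intro i
    have h2 : massVector e G B V i =ᶠ[𝓝 y] fun z => V z * (Real.sqrt (G z).det * connVec e G B i z)
        + Real.sqrt (G z).det * ((G z)⁻¹ *ᵥ traceVec e G B V z) i := by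
      filter_upwards [hG.eventually, hB.eventually] with z h3 h4
      rw [massVector_eq h3 h4]; ring
    have h3 : DifferentiableAt ℝ (fun z => ((G z)⁻¹ *ᵥ traceVec e G B V z) i) y :=
      differentiableAt_mulVec hG.matDiffAt_inv hYd i
    rw [pd_congr e i h2, pd_add e i (hVd.fun_mul (hsd.fun_mul (hXd i))) (hsd.fun_mul h3),
      pd_mul e i hVd (hsd.fun_mul (hXd i))]
  have hcov := fun i => pd_traceVec_sub hG hB hV e i (C := C i) rfl hD hgi
  -- The terms linear in `C` in the covariant derivative of `traceVec` contract to `-dV · X`. This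
  -- cancellation dictates the second half of the mass vector.
  have hlin : ∑ i, gi i ⬝ᵥ ((2 * (C i).trace) • v - (C i).transpose *ᵥ v - (G y * C i * gi) *ᵥ v) =
      -∑ i, v i * connVec e G B i y := by
    have g1 : ∀ i, gi i ⬝ᵥ ((C i).transpose *ᵥ v) = ∑ k, v k * (C i * gi) k i := by
      intro i
      simp only [dotProduct, Matrix.mulVec, Matrix.mul_apply, Matrix.transpose_apply,
        Finset.mul_sum]
      rw [Finset.sum_comm]
      refine Finset.sum_congr rfl fun a _ => Finset.sum_congr rfl fun b _ => ?_
      rw [show gi i b = gi b i from hG.inv_comm i b]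
      ring
    have g2 : ∑ i, gi i ⬝ᵥ ((G y * C i * gi) *ᵥ v) = ∑ i, (C i).trace * (gi i ⬝ᵥ v) := by
      have g4 : ∀ i, gi i ⬝ᵥ ((G y * C i * gi) *ᵥ v) = ∑ a, C a i i * (gi a ⬝ᵥ v) := by
        intro i
        have g5 : gi i ⬝ᵥ ((G y * C i * gi) *ᵥ v) = (gi *ᵥ ((G y * C i * gi) *ᵥ v)) i := rfl
        rw [g5, Matrix.mulVec_mulVec, Matrix.mul_assoc (G y), ← Matrix.mul_assoc gi, hG.inv_mul,
          Matrix.one_mul, ← Matrix.mulVec_mulVec]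
        exact Finset.sum_congr rfl fun a _ =>
          congrArg₂ _ (connDiff_comm hG hB e i a i) rfl
      simp only [g4]
      rw [Finset.sum_comm]
      simp only [← Finset.sum_mul]
      rfl
    have g3 : ∑ i, v i * connVec e G B i y = ∑ i, ∑ k, v k * (C i * gi) k i -
        ∑ i, (C i).trace * (gi i ⬝ᵥ v) := by
      simp only [connVec, Finset.mul_sum, mul_sub, Finset.sum_sub_distrib, dotProduct]
      congr 1
      · exact Finset.sum_comm
      · rw [Finset.sum_comm]
        refine Finset.sum_congr rfl fun a _ => Finset.sum_congr rfl fun b _ => ?_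
        rw [show gi a b = gi b a from hG.inv_comm a b]
        simp only [hC, hgi]
        ring
    rw [g3]
    simp only [dotProduct_sub, dotProduct_smul, Finset.sum_sub_distrib, g1, g2, smul_eq_mul]
    simp only [mul_assoc, ← Finset.mul_sum]
    ring
  -- The static Hessian equation with `P = Ricᵀ + n b`: second derivatives of `V` are traded for `V`
  -- times curvature.
  have hH : hessMat e B V y = V y • P.transpose := by
    ext i j
    simp [hessMat, hhess, hP, ricMat, hB.apply_comm i j, hn]
  have hVP : ∀ X : Matrix ι ι ℝ, V y * (X * P).trace = (X * (hessMat e B V y).transpose).trace := by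
    intro X
    rw [hH, Matrix.transpose_smul, Matrix.transpose_transpose, Matrix.mul_smul, Matrix.trace_smul,
      smul_eq_mul]
  have hquad : ∑ i, gi i ⬝ᵥ ((gi * D).trace • hessMat e B V y i - (D * gi) *ᵥ hessMat e B V y i) =
      V y * ((gi * D).trace * (gi * P).trace - (gi * D * gi * P).trace) := by
    have q1 : ∑ i, gi i ⬝ᵥ hessMat e B V y i = V y * (gi * P).trace := by
      rw [hVP]
      rfl
    have q2 : ∑ i, gi i ⬝ᵥ ((D * gi) *ᵥ hessMat e B V y i) = V y * (gi * D * gi * P).trace := by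
      rw [hVP, Matrix.mul_assoc gi, Matrix.mul_assoc gi]
      rfl
    simp only [dotProduct_sub, dotProduct_smul, Finset.sum_sub_distrib, smul_eq_mul,
      ← Finset.mul_sum, q1, q2]
    ring
  -- An exact resolvent identity: each exchange of `g⁻¹` for `b⁻¹` costs one factor of `e`, so
  -- applying it twice leaves an explicit quadratic remainder instead of an error term.
  have hgb : gi = bi - gi * D * bi := by
    rw [hD, Matrix.mul_sub, Matrix.sub_mul, hG.inv_mul, Matrix.one_mul, Matrix.mul_assoc, hB.mul_inv,
      Matrix.mul_one]
    abel
  have hscal : ∑ j, ∑ k, gi j k * (ricci e G j k y - ricci e B j k y) =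
      scalar e G y - scalar e B y + (gi * D * bi * (ricMat e B y).transpose).trace := by
    have q3 : scalar e B y - (gi * D * bi * (ricMat e B y).transpose).trace =
        (gi * (ricMat e B y).transpose).trace := by
      rw [scalar_eq_trace, ← Matrix.trace_sub, ← Matrix.sub_mul, ← hgb]
    have q4 : (gi * (ricMat e B y).transpose).trace = ∑ j, ∑ k, gi j k * ricci e B j k y := rfl
    simp only [mul_sub, Finset.sum_sub_distrib]
    rw [← q4, ← q3]
    simp only [scalar, ← hgi]
    ring
  -- The `b`-trace of the Hessian is the Laplacian, which the other static equation makes equal to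
  -- `n V`.
  have hbP : V y * (bi * P).trace = n * V y := by
    rw [← hlap, hVP]
    rfl
  have hgP : gi * P = bi * P - gi * D * (bi * P) := by
    conv_lhs => rw [hgb]
    rw [Matrix.sub_mul, Matrix.mul_assoc (gi * D)]
  have hgDb : (gi * D * (bi * P)).trace = (gi * D * bi * (ricMat e B y).transpose).trace +
      n * (gi * D).trace := by
    rw [hP, Matrix.mul_add, Matrix.mul_smul, hB.inv_mul, Matrix.mul_add, Matrix.mul_smul,
      Matrix.mul_one, Matrix.trace_add, Matrix.trace_smul, Matrix.mul_assoc (gi * D) bi, smul_eq_mul]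
  have hsplit : ∑ i, gi i ⬝ᵥ ((fun l => pd e i (fun z => traceVec e G B V z l) y) -
        (connMat e G i y).transpose *ᵥ traceVec e G B V y) =
      -∑ i, v i * connVec e G B i y +
        V y * ((gi * D).trace * (gi * P).trace - (gi * D * gi * P).trace) +
      ∑ i, gi i ⬝ᵥ (-(2 * (C i * gi * D).trace) • v - (gi * D).trace • ((C i).transpose *ᵥ v)
        + (D * gi * (C i).transpose + (C i).transpose * D * gi + D * C i * gi) *ᵥ v) := by
    rw [← hlin, ← hquad, ← Finset.sum_add_distrib, ← Finset.sum_add_distrib]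
    refine Finset.sum_congr rfl fun i _ => ?_
    rw [hcov, ← dotProduct_add, ← dotProduct_add]
    congr 2
    abel
  have hq5 : (gi * D * gi * P).trace = (gi * D * (bi * P)).trace -
      (gi * D * (gi * D * (bi * P))).trace := by
    rw [Matrix.mul_assoc (gi * D), hgP, Matrix.mul_sub, Matrix.trace_sub]
  have hq6 : (gi * P).trace = (bi * P).trace - (gi * D * (bi * P)).trace := by
    rw [hgP, Matrix.trace_sub]
  have hR : massRemainder e G B V y =
    V y * ((gi * D * (gi * D * (bi * P))).trace - (gi * D).trace * (gi * D * (bi * P)).trace)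
    - V y * ∑ j, ∑ k, gi j k * ∑ i, ∑ l, (C j i l * C k l i - C l i i * C j l k)
    + ∑ i, gi i ⬝ᵥ (-(2 * (C i * gi * D).trace) • v - (gi * D).trace • ((C i).transpose *ᵥ v)
        + (D * gi * (C i).transpose + (C i).transpose * D * gi + D * C i * gi) *ᵥ v) := rfl
  have hVX : ∑ i, pd e i V y * (s * connVec e G B i y) = s * ∑ i, v i * connVec e G B i y := by
    rw [Finset.mul_sum]
    exact Finset.sum_congr rfl fun i _ => mul_left_comm _ _ _
  simp only [h1, Finset.sum_add_distrib, ← Finset.mul_sum]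
  rw [hX, hZ, hsplit, hR, hVX, hscal, hq5, hq6]
  -- The surviving terms linear in `e` are `n V tr(g⁻¹e)` from the Laplacian equation and `V` times
  -- a trace with `Ric_b`; `hgDb` shows that they cancel.
  linear_combination s * (gi * D).trace * hbP - s * V y * hgDb

end MassDivergence

/-! ### Transformation laws of the metric, connection and curvature under a change of coordinates.
-/

section CoordinateChange

open Matrix

variable {E : Type*} [NormedAddCommGroup E] [NormedSpace ℝ E]
  {ι : Type*} [Fintype ι] [DecidableEq ι]

/-- The Jacobian matrix of `ψ`. -/
def jac (e : Module.Basis ι ℝ E) (ψ : E → E) (y : E) : Matrix ι ι ℝ :=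
  Matrix.of fun a i => pd e i (fun z => e.repr (ψ z) a) y

lemma contDiff_repr (e : Module.Basis ι ℝ E) (a : ι) {n : ℕ∞ω} :
    ContDiff ℝ n fun w => e.repr w a := by
  have : FiniteDimensional ℝ E := Module.Finite.of_basis e
  exact (LinearMap.toContinuousLinearMap (e.coord a)).contDiff

lemma jac_apply (e : Module.Basis ι ℝ E) {ψ : E → E} {y : E} (hψ : DifferentiableAt ℝ ψ y)
    (a i : ι) : jac e ψ y a i = e.repr (fderiv ℝ ψ y (e i)) a := by
  have : FiniteDimensional ℝ E := Module.Finite.of_basis e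
  have h := ((LinearMap.toContinuousLinearMap (e.coord a)).hasFDerivAt.comp y
    hψ.hasFDerivAt).fderiv
  simp only [jac, Matrix.of_apply, pd]
  exact congrArg (fun T => T (e i)) h

lemma pd_comp_jac (e : Module.Basis ι ℝ E) (i : ι) {f : E → ℝ} {ψ : E → E} {y : E}
    (hf : DifferentiableAt ℝ f (ψ y)) (hψ : DifferentiableAt ℝ ψ y) :
    pd e i (fun z => f (ψ z)) y = ∑ a, jac e ψ y a i * pd e a f (ψ y) := by
  rw [pd_comp e i hf hψ]
  simp only [jac_apply e hψ]

lemma contDiffAt_jac (e : Module.Basis ι ℝ E) {ψ : E → E} {y : E} (hψ : ContDiffAt ℝ 3 ψ y)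
    (a i : ι) : ContDiffAt ℝ 2 (fun z => jac e ψ z a i) y :=
  contDiffAt_pd e i ((contDiff_repr e a).contDiffAt.comp y hψ) (by norm_num)

lemma matDiffAt_jac (e : Module.Basis ι ℝ E) {ψ : E → E} {y : E} (hψ : ContDiffAt ℝ 3 ψ y) :
    MatDiffAt (jac e ψ) y :=
  fun a i => (contDiffAt_jac e hψ a i).differentiableAt (by norm_num)

lemma pdMat_jac_comm (e : Module.Basis ι ℝ E) {ψ : E → E} {y : E} (hψ : ContDiffAt ℝ 3 ψ y)
    (k a j : ι) : pdMat e k (jac e ψ) y a j = pdMat e j (jac e ψ) y a k :=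
  pd_comm e k j (((contDiff_repr e a).contDiffAt.comp y hψ).of_le (by norm_num))

/-- Chain rule for matrix fields. -/
lemma pdMat_comp (e : Module.Basis ι ℝ E) (k : ι) {A : E → Matrix ι ι ℝ} {ψ : E → E} {y : E}
    (hA : MatDiffAt A (ψ y)) (hψ : DifferentiableAt ℝ ψ y) :
    pdMat e k (fun z => A (ψ z)) y = ∑ b, jac e ψ y b k • pdMat e b A (ψ y) := by
  ext i j
  simp only [Matrix.sum_apply, Matrix.smul_apply, smul_eq_mul]
  exact pd_comp_jac e k (hA i j) hψ

lemma MatDiffAt.comp {A : E → Matrix ι ι ℝ} {ψ : E → E} {y : E}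
    (hA : MatDiffAt A (ψ y)) (hψ : DifferentiableAt ℝ ψ y) : MatDiffAt (fun z => A (ψ z)) y :=
  fun i j => (hA i j).comp y hψ

/-- `G'` is the expression near `y` of the metric `G` in the coordinates related to those of `G`
by `ψ`. -/
structure IsCoordChangeAt (e : Module.Basis ι ℝ E) (ψ : E → E) (G G' : E → Matrix ι ι ℝ) (y : E) :
    Prop where
  contDiff : ContDiffAt ℝ 3 ψ y
  metric : IsMetricAt G (ψ y)
  det_ne : (jac e ψ y).det ≠ 0
  eq : G' =ᶠ[𝓝 y] fun z => (jac e ψ z).transpose * G (ψ z) * jac e ψ z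

namespace IsCoordChangeAt

variable {e : Module.Basis ι ℝ E} {ψ : E → E} {G G' B B' : E → Matrix ι ι ℝ} {y : E}

lemma differentiableAt (h : IsCoordChangeAt e ψ G G' y) : DifferentiableAt ℝ ψ y :=
  h.contDiff.differentiableAt (by norm_num)

lemma eventually (h : IsCoordChangeAt e ψ G G' y) : ∀ᶠ z in 𝓝 y, IsCoordChangeAt e ψ G G' z := by
  have h1 : ∀ᶠ z in 𝓝 y, ContDiffAt ℝ 3 ψ z := h.contDiff.eventually (by simp)
  have h2 : ∀ᶠ z in 𝓝 y, IsMetricAt G (ψ z) :=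
    h.contDiff.continuousAt.eventually h.metric.eventually
  have h3 : ContinuousAt (fun z => (jac e ψ z).det) y := by
    simp only [Matrix.det_apply']
    exact (ContDiffAt.sum fun σ _ => contDiffAt_const.mul
      (contDiffAt_prod fun i _ => contDiffAt_jac e h.contDiff _ _)).continuousAt (n := 2)
  have h4 : ∀ᶠ z in 𝓝 y, (jac e ψ z).det ≠ 0 := h3.eventually_ne h.det_ne
  filter_upwards [h1, h2, h4, h.eq.eventually_nhds] with z a b c d using ⟨a, b, c, d⟩

lemma metric' (h : IsCoordChangeAt e ψ G G' y) : IsMetricAt G' y := by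
  refine ⟨fun i j => ?_, ?_, ?_⟩
  · have h1 : (fun z => G' z i j) =ᶠ[𝓝 y] fun z => ∑ b, (∑ a, jac e ψ z a i * G (ψ z) a b) *
        jac e ψ z b j := by
      filter_upwards [h.eq] with z hz
      rw [hz]
      simp only [Matrix.mul_apply, Matrix.transpose_apply]
    refine ContDiffAt.congr_of_eventuallyEq ?_ h1
    have hJ := contDiffAt_jac e h.contDiff
    exact ContDiffAt.sum fun b _ => (ContDiffAt.sum fun a _ => (hJ a i).mul
      ((h.metric.contDiff a b).comp y (h.contDiff.of_le (by norm_num)))).mul (hJ b j)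
  · have h2 : ∀ᶠ z in 𝓝 y, IsMetricAt G (ψ z) :=
      h.contDiff.continuousAt.eventually h.metric.eventually
    filter_upwards [h.eq, h2] with z hz hz'
    rw [hz, Matrix.IsSymm, Matrix.transpose_mul, Matrix.transpose_mul, Matrix.transpose_transpose,
      hz'.symm_self, Matrix.mul_assoc]
  · rw [h.eq.self_of_nhds, Matrix.det_mul, Matrix.det_mul, Matrix.det_transpose]
    have := h.metric.det_pos
    have := h.det_ne
    have : (jac e ψ y).det * (G (ψ y)).det * (jac e ψ y).det =
      (jac e ψ y).det ^ 2 * (G (ψ y)).det := by ring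
    rw [this]
    positivity

lemma eq_self (h : IsCoordChangeAt e ψ G G' y) :
    G' y = (jac e ψ y).transpose * G (ψ y) * jac e ψ y := h.eq.self_of_nhds

lemma inv_mul_jac (h : IsCoordChangeAt e ψ G G' y) : (jac e ψ y)⁻¹ * jac e ψ y = 1 :=
  Matrix.nonsing_inv_mul _ h.det_ne.isUnit

lemma jac_mul_inv (h : IsCoordChangeAt e ψ G G' y) : jac e ψ y * (jac e ψ y)⁻¹ = 1 :=
  Matrix.mul_nonsing_inv _ h.det_ne.isUnit

/-- The connection matrices of `G`, pulled back as a matrix-valued 1-form. -/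
def pullConn (e : Module.Basis ι ℝ E) (ψ : E → E) (G : E → Matrix ι ι ℝ) (k : ι) (z : E) :
    Matrix ι ι ℝ :=
  ∑ b, jac e ψ z b k • connMat e G b (ψ z)

/-- Transformation law of the Levi-Civita connection. -/
lemma jac_mul_connMat (h : IsCoordChangeAt e ψ G G' y) (k : ι) :
    jac e ψ y * connMat e G' k y = pullConn e ψ G k y * jac e ψ y + pdMat e k (jac e ψ) y := by
  set J := jac e ψ y with hJ
  -- Uniqueness of the Levi-Civita connection replaces a computation with Christoffel symbols: `J⁻¹
  -- X` is symmetric and compatible with `G'`, hence it is the connection of `G'`.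
  set X : ι → Matrix ι ι ℝ := fun k => pullConn e ψ G k y * J + pdMat e k (jac e ψ) y with hX
  have hXs : ∀ i j k, X j i k = X k i j := by
    intro i j k
    simp only [hX, Matrix.add_apply]
    rw [pdMat_jac_comm e h.contDiff j i k]
    congr 1
    simp only [pullConn, Matrix.mul_apply, Matrix.sum_apply, Matrix.smul_apply, Finset.sum_mul,
      smul_eq_mul]
    rw [Finset.sum_comm]
    refine Finset.sum_congr rfl fun a _ => Finset.sum_congr rfl fun b _ => ?_
    rw [connMat_comm h.metric e b a i]
    ring
  have hS := h.metric'.connMat_eq e (fun k => J⁻¹ * X k) (by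
      intro i j k
      simp only [Matrix.mul_apply]
      exact Finset.sum_congr rfl fun a _ => by rw [hXs]) (by
      intro k
      have hd := matDiffAt_jac e h.contDiff
      have hGd := h.metric.matDiffAt.comp h.differentiableAt
      have e1 : J * (J⁻¹ * X k) = X k := by rw [← Matrix.mul_assoc, h.jac_mul_inv, Matrix.one_mul]
      have e2 : (J⁻¹ * X k).transpose * J.transpose = (X k).transpose := by
        rw [← Matrix.transpose_mul, e1]
      have e3 : ∑ b, J b k • pdMat e b G (ψ y) = (pullConn e ψ G k y).transpose * G (ψ y) +
          G (ψ y) * pullConn e ψ G k y := by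
        simp only [pullConn, Matrix.transpose_sum, Matrix.transpose_smul, Finset.sum_mul,
          Finset.mul_sum, Matrix.smul_mul, Matrix.mul_smul, ← Finset.sum_add_distrib, ← smul_add,
          h.metric.pdMat_eq]
        rfl
      rw [pdMat_congr e k h.eq, pdMat_mul e k (hd.transpose.mul hGd) hd,
        pdMat_mul e k hd.transpose hGd, pdMat_transpose, pdMat_comp e k h.metric.matDiffAt
        h.differentiableAt, ← hJ, e3, h.eq_self, ← hJ, Matrix.mul_assoc _ J (J⁻¹ * X k), e1,
        ← Matrix.mul_assoc, ← Matrix.mul_assoc, e2]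
      simp only [hX, Matrix.transpose_add, Matrix.transpose_mul]
      noncomm_ring) k
  rw [hS, ← Matrix.mul_assoc, h.jac_mul_inv, Matrix.one_mul]

/-- Transformation law of the inverse metric. -/
lemma jac_mul_inv_mul (h : IsCoordChangeAt e ψ G G' y) :
    jac e ψ y * (G' y)⁻¹ * (jac e ψ y).transpose = (G (ψ y))⁻¹ := by
  set J := jac e ψ y with hJ
  have h1 : J.transpose * G (ψ y) * (J * (G' y)⁻¹) = 1 := by
    rw [← Matrix.mul_assoc, ← h.eq_self, h.metric'.mul_inv]
  have h2 : (J * (G' y)⁻¹) * (J.transpose * G (ψ y)) = 1 := mul_eq_one_comm.1 h1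
  rw [← Matrix.mul_assoc] at h2
  exact (Matrix.inv_eq_left_inv h2).symm

/-- The curvature matrices of the Levi-Civita connection. -/
def curvMat (e : Module.Basis ι ℝ E) (G : E → Matrix ι ι ℝ) (k j : ι) (y : E) : Matrix ι ι ℝ :=
  pdMat e k (connMat e G j) y - pdMat e j (connMat e G k) y + connMat e G k y * connMat e G j y
    - connMat e G j y * connMat e G k y

/-- The Ricci tensor is the trace of the curvature over one form index and the upper matrix index.
In matrix form its tensoriality becomes conjugation by the Jacobian. -/
lemma ricci_eq_curvMat (hG : IsMetricAt G y) (i j : ι) :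
    ricci e G i j y = ∑ k, curvMat e G k j y k i := by
  have h1 : ∀ k, pd e k (christoffel e G k i j) y = pdMat e k (connMat e G j) y k i := fun k =>
    pd_congr e k (hG.eventually.mono fun z hz => hz.christoffel_comm e k i j)
  simp only [ricci, curvMat, h1, hG.christoffel_comm e _ i j, Matrix.sub_apply, Matrix.add_apply,
    Finset.sum_sub_distrib, Finset.sum_add_distrib, Matrix.mul_apply]
  simp only [pdMat, connMat, Matrix.of_apply]
  ring

lemma matDiffAt_pullConn (h : IsCoordChangeAt e ψ G G' y) (k : ι) :
    MatDiffAt (pullConn e ψ G k) y := by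
  intro i j
  simp only [pullConn, Matrix.sum_apply, Matrix.smul_apply, smul_eq_mul]
  exact DifferentiableAt.fun_sum fun b _ => (matDiffAt_jac e h.contDiff b k).fun_mul
    ((h.metric.matDiffAt_connMat e b).comp h.differentiableAt i j)

lemma pdMat_pullConn (h : IsCoordChangeAt e ψ G G' y) (j k : ι) :
    pdMat e k (pullConn e ψ G j) y = ∑ b, (pdMat e k (jac e ψ) y b j • connMat e G b (ψ y) +
      jac e ψ y b j • ∑ c, jac e ψ y c k • pdMat e c (connMat e G b) (ψ y)) := by
  have h1 : ∀ b, MatDiffAt (fun z => connMat e G b (ψ z)) y := fun b =>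
    (h.metric.matDiffAt_connMat e b).comp h.differentiableAt
  ext p q
  have h2 : pdMat e k (pullConn e ψ G j) y p q =
      pd e k (fun z => ∑ b, jac e ψ z b j * connMat e G b (ψ z) p q) y := by
    simp only [pdMat, pullConn, Matrix.of_apply, Matrix.sum_apply, Matrix.smul_apply, smul_eq_mul]
  rw [h2, pd_sum _ _ _ fun b _ => (matDiffAt_jac e h.contDiff b j).fun_mul (h1 b p q)]
  simp only [← pdMat_comp e k (h.metric.matDiffAt_connMat e _) h.differentiableAt,
    Matrix.sum_apply, Matrix.add_apply, Matrix.smul_apply, smul_eq_mul]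
  exact Finset.sum_congr rfl fun b _ =>
    pd_mul e k (matDiffAt_jac e h.contDiff b j) (h1 b p q)

/-- Transformation law of the curvature. -/
lemma jac_mul_curvMat (h : IsCoordChangeAt e ψ G G' y) (k j : ι) :
    jac e ψ y * curvMat e G' k j y =
      (∑ b, ∑ c, (jac e ψ y c k * jac e ψ y b j) • curvMat e G c b (ψ y)) * jac e ψ y := by
  set J := jac e ψ y with hJ
  have hd := matDiffAt_jac e h.contDiff
  have hA' := fun k => h.metric'.matDiffAt_connMat e k
  have law := fun k => h.jac_mul_connMat k
  have hdJ : ∀ j, MatDiffAt (pdMat e j (jac e ψ)) y := fun j a i =>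
    differentiableAt_pd (contDiffAt_jac e h.contDiff a i) e j
  -- The transformation law of the connection holds near `y`, so it may be differentiated;
  -- antisymmetrising the result in `k` and `j` yields the curvature.
  have dlaw : ∀ k j, pdMat e k (jac e ψ) y * connMat e G' j y + J * pdMat e k (connMat e G' j) y =
      pdMat e k (pullConn e ψ G j) y * J + pullConn e ψ G j y * pdMat e k (jac e ψ) y +
        pdMat e k (pdMat e j (jac e ψ)) y := by
    intro k j
    have h1 : pdMat e k (fun z => jac e ψ z * connMat e G' j z) y =
        pdMat e k (fun z => pullConn e ψ G j z * jac e ψ z + pdMat e j (jac e ψ) z) y :=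
      pdMat_congr e k (h.eventually.mono fun z hz => hz.jac_mul_connMat j)
    have h2 : pdMat e k (fun z => pullConn e ψ G j z * jac e ψ z + pdMat e j (jac e ψ) z) y =
        pdMat e k (fun z => pullConn e ψ G j z * jac e ψ z) y +
          pdMat e k (pdMat e j (jac e ψ)) y := by
      ext p q
      exact pd_add e k (((h.matDiffAt_pullConn j).mul hd) p q) (hdJ j p q)
    rw [h2, pdMat_mul e k hd (hA' j), pdMat_mul e k (h.matDiffAt_pullConn j) hd] at h1
    exact h1
  -- Third derivatives of `ψ` appear symmetrically and drop out. This symmetry is what the `C³`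
  -- assumption on `ψ` provides.
  have hcomm : pdMat e k (pdMat e j (jac e ψ)) y = pdMat e j (pdMat e k (jac e ψ)) y := by
    ext p q
    exact pd_comm e k j (contDiffAt_jac e h.contDiff p q)
  have hF : ∑ b, ∑ c, (J c k * J b j) • curvMat e G c b (ψ y) =
      pdMat e k (pullConn e ψ G j) y - pdMat e j (pullConn e ψ G k) y +
        pullConn e ψ G k y * pullConn e ψ G j y - pullConn e ψ G j y * pullConn e ψ G k y := by
    have s1 : pdMat e k (pullConn e ψ G j) y = ∑ b, pdMat e k (jac e ψ) y b j • connMat e G b (ψ y) +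
        ∑ b, ∑ c, (J c k * J b j) • pdMat e c (connMat e G b) (ψ y) := by
      rw [h.pdMat_pullConn]
      simp only [Finset.sum_add_distrib, Finset.smul_sum, smul_smul, mul_comm, ← hJ]
    have s2 : pdMat e j (pullConn e ψ G k) y = ∑ b, pdMat e k (jac e ψ) y b j • connMat e G b (ψ y) +
        ∑ b, ∑ c, (J c k * J b j) • pdMat e b (connMat e G c) (ψ y) := by
      rw [h.pdMat_pullConn]
      simp only [Finset.sum_add_distrib, Finset.smul_sum, smul_smul, ← hJ,
        pdMat_jac_comm e h.contDiff j _ k]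
      congr 1
      exact Finset.sum_comm
    have s3 : ∀ k j, pullConn e ψ G k y * pullConn e ψ G j y =
        ∑ b, ∑ c, (J c k * J b j) • (connMat e G c (ψ y) * connMat e G b (ψ y)) := by
      intro k j
      simp only [pullConn, Finset.sum_mul, Finset.mul_sum, Matrix.smul_mul, Matrix.mul_smul,
        smul_smul, ← hJ]
      exact Finset.sum_congr rfl fun a _ => Finset.sum_congr rfl fun b _ => by rw [mul_comm]
    rw [s1, s2, s3, s3 j k, Finset.sum_comm (f := fun b c =>
      (J c j * J b k) • (connMat e G c (ψ y) * connMat e G b (ψ y)))]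
    simp only [curvMat, smul_sub, smul_add, Finset.sum_sub_distrib, Finset.sum_add_distrib]
    simp only [mul_comm (J _ j)]
    abel
  rw [hF]
  have l1 := dlaw k j
  have l2 := dlaw j k
  rw [hcomm] at l1
  have l3 : J * (connMat e G' k y * connMat e G' j y) =
      pullConn e ψ G k y * (pullConn e ψ G j y * J + pdMat e j (jac e ψ) y) +
        pdMat e k (jac e ψ) y * connMat e G' j y := by
    rw [← Matrix.mul_assoc, law, Matrix.add_mul, Matrix.mul_assoc _ _ (connMat e G' j y), law]
  have l4 : J * (connMat e G' j y * connMat e G' k y) =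
      pullConn e ψ G j y * (pullConn e ψ G k y * J + pdMat e k (jac e ψ) y) +
        pdMat e j (jac e ψ) y * connMat e G' k y := by
    rw [← Matrix.mul_assoc, law, Matrix.add_mul, Matrix.mul_assoc _ _ (connMat e G' k y), law]
  have l5 := eq_sub_of_add_eq' l1
  have l6 := eq_sub_of_add_eq' l2
  simp only [curvMat, Matrix.mul_sub, Matrix.mul_add, l3, l4, l5, l6]
  noncomm_ring

/-- Transformation law of the Ricci tensor. -/
lemma ricMat_eq (h : IsCoordChangeAt e ψ G G' y) :
    ricMat e G' y = (jac e ψ y).transpose * ricMat e G (ψ y) * jac e ψ y := by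
  set J := jac e ψ y with hJ
  have h1 : ∀ k j, curvMat e G' k j y =
      ∑ b, ∑ c, (J c k * J b j) • (J⁻¹ * curvMat e G c b (ψ y) * J) := by
    intro k j
    have h2 : curvMat e G' k j y = J⁻¹ * (J * curvMat e G' k j y) := by
      rw [← Matrix.mul_assoc, h.inv_mul_jac, Matrix.one_mul]
    rw [h2, h.jac_mul_curvMat]
    simp only [Finset.sum_mul, Finset.mul_sum, Matrix.smul_mul, Matrix.mul_smul, ← Matrix.mul_assoc,
      ← hJ]
  ext i j
  have h3 : ∀ b c, ∑ k, J c k * (J⁻¹ * curvMat e G c b (ψ y) * J) k i =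
      (curvMat e G c b (ψ y) * J) c i := by
    intro b c
    rw [← Matrix.mul_apply, Matrix.mul_assoc, ← Matrix.mul_assoc, h.jac_mul_inv, Matrix.one_mul]
  have h4 : ricMat e G' y i j = ∑ b, J b j * ∑ c, (curvMat e G c b (ψ y) * J) c i := by
    simp only [ricMat, Matrix.of_apply]
    rw [ricci_eq_curvMat h.metric']
    simp only [h1, Matrix.sum_apply, Matrix.smul_apply, smul_eq_mul, ← h3]
    rw [Finset.sum_comm]
    refine Finset.sum_congr rfl fun b _ => ?_
    rw [Finset.sum_comm, Finset.mul_sum]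
    refine Finset.sum_congr rfl fun c _ => ?_
    rw [Finset.mul_sum]
    exact Finset.sum_congr rfl fun k _ => by ring
  rw [h4]
  simp only [Matrix.mul_apply, Matrix.transpose_apply, ricMat, Matrix.of_apply,
    ricci_eq_curvMat h.metric, Finset.mul_sum, Finset.sum_mul]
  refine Finset.sum_congr rfl fun b _ => ?_
  rw [Finset.sum_comm]
  exact Finset.sum_congr rfl fun a _ => Finset.sum_congr rfl fun c _ => by ring

/-- A trace of a covariant 2-tensor is independent of the coordinates. -/
lemma trace_inv_mul (h : IsCoordChangeAt e ψ G G' y) (S : Matrix ι ι ℝ) :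
    ((G' y)⁻¹ * ((jac e ψ y).transpose * S * jac e ψ y)).trace = ((G (ψ y))⁻¹ * S).trace := by
  rw [← h.jac_mul_inv_mul, ← Matrix.mul_assoc, Matrix.trace_mul_comm, ← Matrix.mul_assoc,
    ← Matrix.mul_assoc]

lemma scalar_eq (h : IsCoordChangeAt e ψ G G' y) : scalar e G' y = scalar e G (ψ y) := by
  rw [scalar_eq_trace, scalar_eq_trace, h.ricMat_eq, ← h.trace_inv_mul]
  simp only [Matrix.transpose_mul, Matrix.transpose_transpose, Matrix.mul_assoc]

end IsCoordChangeAt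

end CoordinateChange

/-! ### Transformation laws of the Hessian, the gradient norm and the mass vector. -/

section CoordinateChangeFunctions

open Matrix

variable {E : Type*} [NormedAddCommGroup E] [NormedSpace ℝ E]
  {ι : Type*} [Fintype ι] [DecidableEq ι] {e : Module.Basis ι ℝ E} {ψ : E → E}
  {G G' B B' : E → Matrix ι ι ℝ} {V V' : E → ℝ} {y : E}

lemma pdVec_comp (hψ : DifferentiableAt ℝ ψ y) (hV' : V' =ᶠ[𝓝 y] fun z => V (ψ z))
    (hV : DifferentiableAt ℝ V (ψ y)) :
    pdVec e V' y = (jac e ψ y).transpose *ᵥ pdVec e V (ψ y) := by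
  ext i
  rw [pdVec, pd_congr e i hV', pd_comp_jac e i hV hψ]
  rfl

namespace IsCoordChangeAt

/-- Transformation law of the Hessian. -/
lemma hessMat_eq (h : IsCoordChangeAt e ψ B B' y) (hV' : V' =ᶠ[𝓝 y] fun z => V (ψ z))
    (hV : ContDiffAt ℝ 2 V (ψ y)) :
    hessMat e B' V' y = (jac e ψ y).transpose * hessMat e B V (ψ y) * jac e ψ y := by
  set J := jac e ψ y with hJ
  have hVd : DifferentiableAt ℝ V (ψ y) := hV.differentiableAt (by norm_num)
  have hrow : ∀ (B : E → Matrix ι ι ℝ) (V : E → ℝ) (y : E) (i : ι), hessMat e B V y i =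
      (fun l => pd e i (pd e l V) y) - (connMat e B i y).transpose *ᵥ pdVec e V y := by
    intro B V y i
    ext l
    simp only [hessMat, Matrix.of_apply, hessian, Pi.sub_apply, Matrix.mulVec, dotProduct,
      Matrix.transpose_apply, connMat, pdVec]
  have hnear : ∀ l, pd e l V' =ᶠ[𝓝 y] fun z => ((jac e ψ z).transpose *ᵥ pdVec e V (ψ z)) l := by
    intro l
    have h1 : ∀ᶠ z in 𝓝 y, ContDiffAt ℝ 2 V (ψ z) :=
      h.contDiff.continuousAt.eventually (hV.eventually (by simp))
    filter_upwards [hV'.eventually_nhds, h1, h.eventually] with z h2 h3 h4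
    exact congrFun (pdVec_comp h4.differentiableAt h2 (h3.differentiableAt (by norm_num))) l
  have hdv : ∀ i, (fun l => pd e i (pd e l V') y) =
      (pdMat e i (jac e ψ) y).transpose *ᵥ pdVec e V (ψ y) +
        J.transpose *ᵥ ∑ b, J b i • fun l => pd e b (pd e l V) (ψ y) := by
    intro i
    ext l
    have h2 : ∀ a, DifferentiableAt ℝ (fun z => pdVec e V (ψ z) a) y := fun a =>
      (differentiableAt_pd hV e a).comp y h.differentiableAt
    rw [pd_congr e i (hnear l), pd_mulVec e i (matDiffAt_jac e h.contDiff).transpose h2,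
      pdMat_transpose]
    rw [Pi.add_apply, Pi.add_apply]
    congr 1
    refine congrFun (congrArg _ (funext fun a => ?_)) l
    simp only [Finset.sum_apply, Pi.smul_apply, smul_eq_mul]
    exact pd_comp_jac e i (differentiableAt_pd hV e a) h.differentiableAt
  refine funext fun i => ?_
  -- The inhomogeneous part of the connection law produces the same second derivatives of `ψ` as
  -- differentiating `dV'` twice; they cancel in the Hessian.
  have h3 : (connMat e B' i y).transpose *ᵥ pdVec e V' y =
      J.transpose *ᵥ (∑ b, J b i • ((connMat e B b (ψ y)).transpose *ᵥ pdVec e V (ψ y))) +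
        (pdMat e i (jac e ψ) y).transpose *ᵥ pdVec e V (ψ y) := by
    rw [pdVec_comp h.differentiableAt hV' hVd, Matrix.mulVec_mulVec, ← Matrix.transpose_mul,
      h.jac_mul_connMat, Matrix.transpose_add, Matrix.transpose_mul, Matrix.add_mulVec,
      ← Matrix.mulVec_mulVec]
    congr 2
    simp only [pullConn, Matrix.transpose_sum, Matrix.transpose_smul, Matrix.sum_mulVec,
      Matrix.smul_mulVec, ← hJ]
  rw [hrow, hdv, h3]
  have h4 : (J.transpose * hessMat e B V (ψ y) * J) i =
      J.transpose *ᵥ ∑ b, J b i • hessMat e B V (ψ y) b := by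
    ext j
    simp only [Matrix.mul_apply, Matrix.mulVec, dotProduct, Finset.sum_apply, Pi.smul_apply,
      smul_eq_mul, Matrix.transpose_apply, mul_comm]
  rw [h4]
  simp only [hrow, smul_sub, Finset.sum_sub_distrib, Matrix.mulVec_sub]
  abel

lemma laplacian_eq (h : IsCoordChangeAt e ψ B B' y) (hV' : V' =ᶠ[𝓝 y] fun z => V (ψ z))
    (hV : ContDiffAt ℝ 2 V (ψ y)) : laplacian e B' V' y = laplacian e B V (ψ y) := by
  have h1 : ∀ (B : E → Matrix ι ι ℝ) (V : E → ℝ) (y : E), laplacian e B V y =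
      ((B y)⁻¹ * (hessMat e B V y).transpose).trace := fun _ _ _ => rfl
  rw [h1, h1, h.hessMat_eq hV' hV, ← h.trace_inv_mul]
  simp only [Matrix.transpose_mul, Matrix.transpose_transpose, Matrix.mul_assoc]

lemma gradNorm_eq (h : IsCoordChangeAt e ψ B B' y) (hV' : V' =ᶠ[𝓝 y] fun z => V (ψ z))
    (hV : DifferentiableAt ℝ V (ψ y)) : gradNorm e B' V' y = gradNorm e B V (ψ y) := by
  have h1 : ∀ (B : E → Matrix ι ι ℝ) (V : E → ℝ) (y : E), gradNorm e B V y =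
      Real.sqrt (pdVec e V y ⬝ᵥ ((B y)⁻¹ *ᵥ pdVec e V y)) := by
    intro B V y
    simp only [gradNorm, dotProduct, Matrix.mulVec, Finset.mul_sum, pdVec]
    congr 1
    exact Finset.sum_congr rfl fun i _ => Finset.sum_congr rfl fun j _ => by ring
  rw [h1, h1, pdVec_comp h.differentiableAt hV' hV, ← h.jac_mul_inv_mul, Matrix.mulVec_transpose,
    ← Matrix.dotProduct_mulVec, ← Matrix.mulVec_transpose, Matrix.mulVec_mulVec,
    Matrix.mulVec_mulVec, Matrix.mul_assoc]

lemma sqrt_det_eq (h : IsCoordChangeAt e ψ G G' y) :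
    Real.sqrt (G' y).det = |(jac e ψ y).det| * Real.sqrt (G (ψ y)).det := by
  rw [h.eq_self, Matrix.det_mul, Matrix.det_mul, Matrix.det_transpose,
    show (jac e ψ y).det * (G (ψ y)).det * (jac e ψ y).det =
      (jac e ψ y).det ^ 2 * (G (ψ y)).det by ring, Real.sqrt_mul (sq_nonneg _), Real.sqrt_sq_eq_abs]

/-- The mass vector is a vector density. -/
lemma jac_mulVec_massVector (h : IsCoordChangeAt e ψ G G' y) (hB : IsCoordChangeAt e ψ B B' y)
    (hV' : V' =ᶠ[𝓝 y] fun z => V (ψ z)) (hV : DifferentiableAt ℝ V (ψ y)) :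
    (jac e ψ y *ᵥ fun i => massVector e G' B' V' i y) =
      |(jac e ψ y).det| • fun i => massVector e G B V i (ψ y) := by
  set J := jac e ψ y with hJ
  set C : ι → Matrix ι ι ℝ := fun b => connDiff e G B b (ψ y) with hC
  set gi := (G (ψ y))⁻¹ with hgi
  set gi' := (G' y)⁻¹ with hgi'
  set D := G (ψ y) - B (ψ y) with hD
  have hgg : J * gi' * J.transpose = gi := h.jac_mul_inv_mul
  -- The inhomogeneous term depends on `ψ` alone, so it disappears from the difference of two
  -- connections: `connDiff` is a tensor, and with it `connVec` is a vector.
  have hC' : ∀ k, J * connDiff e G' B' k y = (∑ b, J b k • C b) * J := by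
    intro k
    simp only [connDiff, Matrix.mul_sub, hJ, h.jac_mul_connMat, hB.jac_mul_connMat, pullConn, hC,
      smul_sub, Finset.sum_sub_distrib, Matrix.sub_mul]
    abel
  have htr : ∀ k, (connDiff e G' B' k y).trace = ∑ b, J b k * (C b).trace := by
    intro k
    have h1 : connDiff e G' B' k y = J⁻¹ * ((∑ b, J b k • C b) * J) := by
      rw [← hC', ← Matrix.mul_assoc, hJ, h.inv_mul_jac, Matrix.one_mul]
    rw [h1, Matrix.trace_mul_comm, Matrix.mul_assoc, hJ, h.jac_mul_inv, Matrix.mul_one]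
    simp [Matrix.trace_sum]
  have hv : pdVec e V' y = J.transpose *ᵥ pdVec e V (ψ y) := pdVec_comp h.differentiableAt hV' hV
  have hD' : G' y - B' y = J.transpose * D * J := by
    rw [h.eq_self, hB.eq_self, hD, Matrix.mul_sub, Matrix.sub_mul]
  have htv : traceVec e G' B' V' y = J.transpose *ᵥ traceVec e G B V (ψ y) := by
    rw [traceVec, traceVec, hD', hv, h.trace_inv_mul, ← hD, ← hgi, ← hgi', Matrix.mulVec_sub,
      Matrix.mulVec_smul, ← hgg]
    simp only [Matrix.mulVec_mulVec, Matrix.mul_assoc]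
  have hconn : (J *ᵥ fun i => connVec e G' B' i y) = fun i => connVec e G B i (ψ y) := by
    ext a
    have h1 : ∀ k, (J * connDiff e G' B' k y * gi') a k = ∑ b, J b k * (C b * (J * gi')) a k := by
      intro k
      rw [hC', Matrix.mul_assoc, Finset.sum_mul, Matrix.sum_apply]
      simp
    have h2 : (J *ᵥ fun i => connVec e G' B' i y) a =
        ∑ k, ((J * connDiff e G' B' k y * gi') a k - (J * gi') a k * (connDiff e G' B' k y).trace) := by
      simp only [Matrix.mulVec, dotProduct, connVec, Finset.mul_sum, ← hgi']
      rw [Finset.sum_comm]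
      refine Finset.sum_congr rfl fun k _ => ?_
      simp only [mul_sub, Finset.sum_sub_distrib, Matrix.mul_assoc]
      rw [Matrix.mul_apply (M := J), Matrix.mul_apply (M := J) (N := gi'), Finset.sum_mul]
      congr 1
      exact Finset.sum_congr rfl fun i _ => (mul_assoc _ _ _).symm
    have h3 : ∀ (M : Matrix ι ι ℝ) b, ∑ k, J b k * M a k = (M * J.transpose) a b := by
      intro M b
      simp only [Matrix.mul_apply, Matrix.transpose_apply, mul_comm]
    rw [h2]
    simp only [h1, htr, Finset.mul_sum, Finset.sum_sub_distrib, connVec, ← hgi]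
    rw [Finset.sum_comm, Finset.sum_comm (f := fun i j => (J * gi') a i * (J j i * (C j).trace))]
    congr 1
    · refine Finset.sum_congr rfl fun b _ => ?_
      rw [h3, Matrix.mul_assoc, hgg]
    · refine Finset.sum_congr rfl fun b _ => ?_
      rw [← hgg, ← h3, Finset.sum_mul]
      exact Finset.sum_congr rfl fun k _ => by ring
  have hmass : (fun i => massVector e G' B' V' i y) = Real.sqrt (G' y).det •
      (V' y • (fun i => connVec e G' B' i y) + gi' *ᵥ traceVec e G' B' V' y) := by
    ext i
    rw [massVector_eq h.metric' hB.metric']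
    rfl
  have hmass' : (fun i => massVector e G B V i (ψ y)) = Real.sqrt (G (ψ y)).det •
      (V (ψ y) • (fun i => connVec e G B i (ψ y)) + gi *ᵥ traceVec e G B V (ψ y)) := by
    ext i
    rw [massVector_eq h.metric hB.metric]
    rfl
  rw [hmass, hmass', Matrix.mulVec_smul, Matrix.mulVec_add, Matrix.mulVec_smul, hconn, htv,
    Matrix.mulVec_mulVec, Matrix.mulVec_mulVec, hgg, h.sqrt_det_eq,
    hV'.self_of_nhds, smul_smul]

end IsCoordChangeAt

end CoordinateChangeFunctions

/-! ### Components of form fields in two preferred charts. -/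

section Charts

open Matrix

variable {E : Type*} [NormedAddCommGroup E] [NormedSpace ℝ E]
  {H : Type*} [TopologicalSpace H] {I : ModelWithCorners ℝ E H}
  {X : Type*} [TopologicalSpace X] [ChartedSpace H X]
  {ι : Type*} [Fintype ι] [DecidableEq ι]

/-- The form field `T` is bilinear at `x`. -/
def IsBilinAt (T : FormField I X) (x : X) : Prop :=
  ∃ β : TangentSpace I x →ₗ[ℝ] TangentSpace I x →ₗ[ℝ] ℝ, ∀ u v, T x u v = β u v

lemma IsBilinAt.sum_smul {T : FormField I X} {x : X} (hT : IsBilinAt T x)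
    {α β : Type*} (s : Finset α) (t : Finset β) (a : α → ℝ) (b : β → ℝ)
    (u : α → TangentSpace I x) (v : β → TangentSpace I x) :
    T x (∑ i ∈ s, a i • u i) (∑ j ∈ t, b j • v j) = ∑ i ∈ s, ∑ j ∈ t, a i * b j * T x (u i) (v j) := by
  obtain ⟨B, hB⟩ := hT
  simp only [hB, map_sum, map_smul, LinearMap.sum_apply, LinearMap.smul_apply, smul_eq_mul,
    Finset.mul_sum]
  rw [Finset.sum_comm]
  exact Finset.sum_congr rfl fun i _ => Finset.sum_congr rfl fun j _ => by ring

variable [IsManifold I ∞ X]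

/-- The transition map between two preferred charts. -/
def transition (I : ModelWithCorners ℝ E H) (p q : X) (y : E) : E :=
  extChartAt I q ((extChartAt I p).symm y)

/-- The domain of the transition map. -/
def transitionDomain (I : ModelWithCorners ℝ E H) (p q : X) : Set E :=
  (extChartAt I p).target ∩ (extChartAt I p).symm ⁻¹' (extChartAt I q).source

variable [I.Boundaryless]

omit [IsManifold I ∞ X] in
lemma isOpen_transitionDomain (p q : X) : IsOpen (transitionDomain I p q) :=
  (continuousOn_extChartAt_symm p).isOpen_inter_preimage (isOpen_extChartAt_target p)
    (isOpen_extChartAt_source q)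

lemma contDiffAt_transition {p q : X} {y : E} (hy : y ∈ transitionDomain I p q) :
    ContDiffAt ℝ ∞ (transition I p q) y := by
  have h : y ∈ ((extChartAt I p).symm ≫ extChartAt I q).source := by
    rw [PartialEquiv.trans_source, PartialEquiv.symm_source]
    exact hy
  have := contDiffWithinAt_ext_coord_change (n := ∞) q p h
  rw [I.range_eq_univ, contDiffWithinAt_univ] at this
  exact this

omit [IsManifold I ∞ X] [I.Boundaryless] in
lemma transition_mem {p q : X} {y : E} (hy : y ∈ transitionDomain I p q) :
    transition I p q y ∈ transitionDomain I q p := by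
  refine ⟨(extChartAt I q).map_source hy.2, ?_⟩
  simp only [transition, mem_preimage, (extChartAt I q).left_inv hy.2]
  exact (extChartAt I p).map_target hy.1

omit [IsManifold I ∞ X] [I.Boundaryless] in
lemma transition_transition {p q : X} {y : E} (hy : y ∈ transitionDomain I p q) :
    transition I q p (transition I p q y) = y := by
  simp only [transition, (extChartAt I q).left_inv hy.2, (extChartAt I p).right_inv hy.1]

omit [IsManifold I ∞ X] [I.Boundaryless] in
lemma symm_transition {p q : X} {y : E} (hy : y ∈ transitionDomain I p q) :
    (extChartAt I q).symm (transition I p q y) = (extChartAt I p).symm y :=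
  (extChartAt I q).left_inv hy.2

lemma mdifferentiableAt_extChartAt_symm {p : X} {y : E} (hy : y ∈ (extChartAt I p).target) :
    MDifferentiableAt 𝓘(ℝ, E) I (extChartAt I p).symm y :=
  ((contMDiffOn_extChartAt_symm (n := ∞) p).contMDiffAt
    ((isOpen_extChartAt_target p).mem_nhds hy)).mdifferentiableAt (by simp)

lemma mfderiv_symm_transition {p q : X} {y : E} (hy : y ∈ transitionDomain I p q) (v : E) :
    mfderiv 𝓘(ℝ, E) I (extChartAt I q).symm (transition I p q y)
      (fderiv ℝ (transition I p q) y v) = mfderiv 𝓘(ℝ, E) I (extChartAt I p).symm y v := by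
  have h1 : (extChartAt I q).symm ∘ transition I p q =ᶠ[𝓝 y] (extChartAt I p).symm := by
    filter_upwards [(isOpen_transitionDomain p q).mem_nhds hy] with z hz using symm_transition hz
  have h2 := h1.mfderiv_eq (I := 𝓘(ℝ, E)) (I' := I)
  rw [mfderiv_comp y (mdifferentiableAt_extChartAt_symm (transition_mem hy).1)
    ((contDiffAt_transition hy).differentiableAt (by simp)).mdifferentiableAt, mfderiv_eq_fderiv] at h2
  exact congrArg (fun T => T v) h2

/-- The coordinate vectors of one chart are combinations of those of the other with the Jacobian as
coefficients, and bilinearity of the form does the rest. -/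
lemma localForm_transition (e : Module.Basis ι ℝ E) {T : FormField I X} {p q : X} {y : E}
    (hy : y ∈ transitionDomain I p q) (hT : IsBilinAt T ((extChartAt I p).symm y)) :
    localForm I e T p y = (jac e (transition I p q) y).transpose *
      localForm I e T q (transition I p q y) * jac e (transition I p q) y := by
  set ψ := transition I p q with hψ
  have hψd : DifferentiableAt ℝ ψ y := (contDiffAt_transition hy).differentiableAt (by simp)
  have hJ : ∀ i, fderiv ℝ ψ y (e i) = ∑ a, jac e ψ y a i • e a := by
    intro i
    conv_lhs => rw [← e.sum_repr (fderiv ℝ ψ y (e i))]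
    simp only [jac_apply e hψd]
  rw [← symm_transition hy] at hT
  ext i j
  have h1 : ∀ i, mfderiv 𝓘(ℝ, E) I (extChartAt I p).symm y (e i) =
      ∑ a, jac e ψ y a i • mfderiv 𝓘(ℝ, E) I (extChartAt I q).symm (ψ y) (e a) := by
    intro i
    rw [← mfderiv_symm_transition hy, ← hψ, hJ]
    refine (map_sum (mfderiv 𝓘(ℝ, E) I (extChartAt I q).symm (ψ y)) _ _).trans ?_
    exact Finset.sum_congr rfl fun a _ => map_smul _ _ _
  have h2 : localForm I e T p y i j = T ((extChartAt I q).symm (ψ y))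
      (∑ a, jac e ψ y a i • mfderiv 𝓘(ℝ, E) I (extChartAt I q).symm (ψ y) (e a))
      (∑ a, jac e ψ y a j • mfderiv 𝓘(ℝ, E) I (extChartAt I q).symm (ψ y) (e a)) := by
    -- The two base points are equal only propositionally, so the form has to be transported along
    -- that equality.
    have h3 : ∀ (x x' : X) (hx : x' = x) (u v : E), T x u v = T x' u v := by
      rintro x _ rfl u v; rfl
    simp only [localForm, Matrix.of_apply]
    rw [← h1, ← h1]
    exact h3 _ _ (symm_transition hy) _ _
  rw [h2, hT.sum_smul]
  simp only [Matrix.mul_apply, Matrix.transpose_apply, localForm, Matrix.of_apply, Finset.sum_mul]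
  rw [Finset.sum_comm]
  exact Finset.sum_congr rfl fun a _ => Finset.sum_congr rfl fun b _ => by ring

/-- The reverse transition is a local inverse, so by the chain rule the two Jacobians multiply to
the identity. -/
lemma det_jac_transition_ne (e : Module.Basis ι ℝ E) {p q : X} {y : E}
    (hy : y ∈ transitionDomain I p q) : (jac e (transition I p q) y).det ≠ 0 := by
  have h1 : ∀ {p q : X} {y : E}, y ∈ transitionDomain I p q →
      DifferentiableAt ℝ (transition I p q) y := fun h =>
    (contDiffAt_transition h).differentiableAt (by simp)
  have h2 : jac e (transition I q p) (transition I p q y) * jac e (transition I p q) y = 1 := by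
    ext a i
    have h3 : pd e i (fun z => e.repr (transition I q p (transition I p q z)) a) y =
        (1 : Matrix ι ι ℝ) a i := by
      have h4 : (fun z => e.repr (transition I q p (transition I p q z)) a) =ᶠ[𝓝 y]
          fun z => e.repr z a := by
        filter_upwards [(isOpen_transitionDomain p q).mem_nhds hy] with z hz
        rw [transition_transition hz]
      rw [pd_congr e i h4]
      have h5 := jac_apply e (ψ := fun z => z) (y := y) differentiableAt_id a i
      simp only [jac, Matrix.of_apply] at h5
      rw [h5]
      simp [Matrix.one_apply, Finsupp.single_apply, eq_comm]
    rw [← h3, Matrix.mul_apply, pd_comp_jac e i (f := fun w => e.repr (transition I q p w) a)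
      (((contDiff_repr e a (n := 1)).differentiable (by norm_num)).differentiableAt.comp _
        (h1 (transition_mem hy))) (h1 hy)]
    exact Finset.sum_congr rfl fun b _ => mul_comm _ _
  intro h
  have h6 := congrArg Matrix.det h2
  rw [Matrix.det_mul, h, mul_zero, Matrix.det_one] at h6
  exact zero_ne_one h6

/-- The components of a metric in two preferred charts are related by the transition map. -/
lemma isCoordChangeAt_transition (e : Module.Basis ι ℝ E) {T : FormField I X} {p q : X} {y : E}
    (hy : y ∈ transitionDomain I p q)
    (hT : ∀ᶠ x in 𝓝 ((extChartAt I p).symm y), IsBilinAt T x)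
    (hm : IsMetricAt (localForm I e T q) (transition I p q y)) :
    IsCoordChangeAt e (transition I p q) (localForm I e T q) (localForm I e T p) y := by
  refine ⟨(contDiffAt_transition hy).of_le (WithTop.coe_le_coe.2 (le_top : (3 : ℕ∞) ≤ ⊤)), hm,
    det_jac_transition_ne e hy, ?_⟩
  have hc : ContinuousAt (extChartAt I p).symm y :=
    (continuousOn_extChartAt_symm p).continuousAt ((isOpen_extChartAt_target p).mem_nhds hy.1)
  filter_upwards [(isOpen_transitionDomain p q).mem_nhds hy, hc.eventually hT] with z hz hz'
  exact localForm_transition e hz hz'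

omit [IsManifold I ∞ X] in
lemma localFun_transition (V : X → ℝ) {p q : X} {y : E} (hy : y ∈ transitionDomain I p q) :
    localFun I V p =ᶠ[𝓝 y] fun z => localFun I V q (transition I p q z) := by
  filter_upwards [(isOpen_transitionDomain p q).mem_nhds hy] with z hz
  simp only [localFun, symm_transition hz]

end Charts

/-! ### Regularity of the components of a metric along a smooth map. -/

section SmoothMetric

variable {E : Type*} [NormedAddCommGroup E] [NormedSpace ℝ E]
  {H : Type*} [TopologicalSpace H] {J : ModelWithCorners ℝ E H}
  {M : Type*} [TopologicalSpace M] [ChartedSpace H M] [IsManifold J ∞ M]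

/-- The components of a `Cⁿ` metric along a smooth map are `Cⁿ`. -/
lemma contDiffOn_metric_comp {n : ℕ∞ω} (hn : n + 1 ≤ ∞)
    (g : Bundle.ContMDiffRiemannianMetric J n E (fun q : M => TangentSpace J q))
    {F : Type*} [NormedAddCommGroup F] [NormedSpace ℝ F] {O : Set F} (hO : IsOpen O) {Ψ : F → M}
    (hΨ : ContMDiffOn 𝓘(ℝ, F) J ∞ Ψ O) (u v : F) :
    ContDiffOn ℝ n (fun z => g.inner (Ψ z) (mfderiv 𝓘(ℝ, F) J Ψ z u)
      (mfderiv 𝓘(ℝ, F) J Ψ z v)) O := by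
  have h1J : IsManifold J 1 M := IsManifold.of_le (n := ∞) (by exact_mod_cast le_top)
  -- The vector field along `Ψ` is its tangent map evaluated on a constant field. This costs one
  -- derivative of `Ψ`, hence the requirement on `n + 1`.
  have hsec : ∀ u : F, ContMDiffOn 𝓘(ℝ, F) (J.prod 𝓘(ℝ, E)) n
      (fun z => (⟨Ψ z, mfderiv 𝓘(ℝ, F) J Ψ z u⟩ : TangentBundle J M)) O := by
    intro u
    have h1 := hΨ.contMDiffOn_tangentMapWithin (m := n) hn hO.uniqueMDiffOn
    have h2 : ContMDiffOn 𝓘(ℝ, F) (𝓘(ℝ, F).prod 𝓘(ℝ, F)) n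
        (fun z : F => (⟨z, u⟩ : TangentBundle 𝓘(ℝ, F) F)) O :=
      contMDiffOn_vectorSpace_iff_contDiffOn.2 contDiffOn_const
    refine (h1.comp h2 fun z hz => hz).congr fun z hz => ?_
    simp only [Function.comp, tangentMapWithin, mfderivWithin_of_isOpen hO hz]
  intro z hz
  have hb : ContMDiffWithinAt 𝓘(ℝ, F) J n Ψ O z := (hΨ z hz).of_le (le_self_add.trans hn)
  have h3 : ContMDiffWithinAt 𝓘(ℝ, F) (J.prod 𝓘(ℝ)) n
      (fun z ↦ Bundle.TotalSpace.mk' ℝ (E := Bundle.Trivial M ℝ) (Ψ z)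
        (g.inner (Ψ z) (mfderiv 𝓘(ℝ, F) J Ψ z u) (mfderiv 𝓘(ℝ, F) J Ψ z v))) O z := by
    apply ContMDiffWithinAt.clm_bundle_apply₂ (F₁ := E) (F₂ := E)
    · exact ContMDiffAt.comp_contMDiffWithinAt z g.contMDiff.contMDiffAt hb
    · exact hsec u z hz
    · exact hsec v z hz
  simp only [Bundle.contMDiffWithinAt_totalSpace] at h3
  exact h3.2.contDiffWithinAt

end SmoothMetric

/-! ### Chart components of a metric satisfy `IsMetricAt`. -/

section MetricCharts

open Matrix

variable {E : Type*} [NormedAddCommGroup E] [NormedSpace ℝ E]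
  {H : Type*} [TopologicalSpace H] {I : ModelWithCorners ℝ E H}
  {X : Type*} [TopologicalSpace X] [ChartedSpace H X] [IsManifold I ∞ X] [I.Boundaryless]
  {ι : Type*} [Fintype ι] [DecidableEq ι]

lemma mfderiv_extChartAt_mfderiv_symm {p : X} {y : E} (hy : y ∈ (extChartAt I p).target) (v : E) :
    mfderiv I 𝓘(ℝ, E) (extChartAt I p) ((extChartAt I p).symm y)
      (mfderiv 𝓘(ℝ, E) I (extChartAt I p).symm y v) = v := by
  have : IsManifold I 1 X := IsManifold.of_le (n := ∞) (WithTop.coe_le_coe.2 le_top)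
  have h := mfderiv_extChartAt_comp_mfderivWithin_extChartAt_symm (I := I) hy
  rw [I.range_eq_univ, mfderivWithin_univ] at h
  exact congrArg (fun T => T v) h

lemma mfderiv_symm_mfderiv_extChartAt {p : X} {y : E} (hy : y ∈ (extChartAt I p).target)
    (v : TangentSpace I ((extChartAt I p).symm y)) :
    mfderiv 𝓘(ℝ, E) I (extChartAt I p).symm y
      (mfderiv I 𝓘(ℝ, E) (extChartAt I p) ((extChartAt I p).symm y) v) = v := by
  have : IsManifold I 1 X := IsManifold.of_le (n := ∞) (WithTop.coe_le_coe.2 le_top)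
  have h := mfderivWithin_extChartAt_symm_comp_mfderiv_extChartAt (I := I) hy
  rw [I.range_eq_univ, mfderivWithin_univ] at h
  exact congrArg (fun T => T v) h

/-- The components of a metric in a chart form a metric matrix field. -/
lemma isMetricAt_localForm (e : Module.Basis ι ℝ E) {T : FormField I X} {p : X} {y : E}
    (hy : y ∈ (extChartAt I p).target)
    (hbil : IsBilinAt T ((extChartAt I p).symm y))
    (hsymm : ∀ᶠ x in 𝓝 ((extChartAt I p).symm y), ∀ u v, T x u v = T x v u)
    (hpos : ∀ v, v ≠ 0 → 0 < T ((extChartAt I p).symm y) v v)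
    (hcd : ∀ i j, ContDiffAt ℝ 2 (fun z => localForm I e T p z i j) y) :
    IsMetricAt (localForm I e T p) y := by
  have hc : ContinuousAt (extChartAt I p).symm y :=
    (continuousOn_extChartAt_symm p).continuousAt ((isOpen_extChartAt_target p).mem_nhds hy)
  have hs : ∀ᶠ z in 𝓝 y, (localForm I e T p z).IsSymm := by
    filter_upwards [hc.eventually hsymm] with z hz
    ext i j
    exact hz _ _
  refine ⟨hcd, hs, ?_⟩
  refine PosDef.det_pos (PosDef.of_dotProduct_mulVec_pos (by
    rw [Matrix.IsHermitian, conjTranspose_eq_transpose_of_trivial, hs.self_of_nhds]) fun u hu => ?_)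
  have h1 : star u ⬝ᵥ (localForm I e T p y *ᵥ u) = T ((extChartAt I p).symm y)
      (∑ i, u i • mfderiv 𝓘(ℝ, E) I (extChartAt I p).symm y (e i))
      (∑ i, u i • mfderiv 𝓘(ℝ, E) I (extChartAt I p).symm y (e i)) := by
    rw [hbil.sum_smul]
    simp only [star_trivial, dotProduct, mulVec, Finset.mul_sum, localForm, of_apply]
    exact Finset.sum_congr rfl fun i _ => Finset.sum_congr rfl fun j _ => by ring
  rw [h1]
  refine hpos _ fun h0 => hu ?_
  -- The differential of the inverse chart has the differential of the chart as a left inverse. It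
  -- is therefore injective, and a null vector of the matrix would have zero coefficients.
  have h2 : mfderiv 𝓘(ℝ, E) I (extChartAt I p).symm y (∑ i, u i • e i) = 0 := by
    refine (map_sum (mfderiv 𝓘(ℝ, E) I (extChartAt I p).symm y) _ _).trans ?_
    rw [← h0]
    exact Finset.sum_congr rfl fun a _ => map_smul _ _ _
  have h3 : (∑ i, u i • e i) = 0 :=
    (mfderiv_extChartAt_mfderiv_symm (I := I) hy (∑ i, u i • e i)).symm.trans
      ((congrArg (fun w => mfderiv I 𝓘(ℝ, E) (extChartAt I p) ((extChartAt I p).symm y) w) h2).trans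
        (map_zero _))
  funext i
  exact Fintype.linearIndependent_iff.1 e.linearIndependent u h3 i

/-- The components of a metric in a chart. -/
lemma contDiffOn_localForm {n : ℕ∞ω} (hn : n + 1 ≤ ∞)
    (g : Bundle.ContMDiffRiemannianMetric I n E (fun q : X => TangentSpace I q))
    (e : Module.Basis ι ℝ E) (p : X) (i j : ι) :
    ContDiffOn ℝ n (fun z => localForm I e (fun x u v => g.inner x u v) p z i j)
      (extChartAt I p).target :=
  contDiffOn_metric_comp hn g (isOpen_extChartAt_target p)
    (contMDiffOn_extChartAt_symm (n := ∞) p) (e i) (e j)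

end MetricCharts

/-! ### Charts of the product `ℝ × N`. -/

section EndCharts

open Matrix

variable {m : ℕ} {N : Type*} [TopologicalSpace N] [ChartedSpace (ModelN m) N]

lemma isBilinAt_inner {E : Type*} [NormedAddCommGroup E] [NormedSpace ℝ E]
    {H : Type*} [TopologicalSpace H] {J : ModelWithCorners ℝ E H}
    {M : Type*} [TopologicalSpace M] [ChartedSpace H M] [IsManifold J ∞ M] {n : ℕ∞ω}
    (g : Bundle.ContMDiffRiemannianMetric J n E (fun q : M => TangentSpace J q)) (x : M) :
    IsBilinAt (I := J) (fun x u v => g.inner x u v) x :=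
  ⟨LinearMap.mk₂ ℝ (fun u v => g.inner x u v) (by simp) (by simp) (by simp) (by simp),
    fun _ _ => rfl⟩

lemma isBilinAt_pullback {E : Type*} [NormedAddCommGroup E] [NormedSpace ℝ E]
    {H : Type*} [TopologicalSpace H] {J : ModelWithCorners ℝ E H}
    {M : Type*} [TopologicalSpace M] [ChartedSpace H M] {Φ : ℝ × N → M} {g : FormField J M}
    {p : ℝ × N} (hg : IsBilinAt g (Φ p)) : IsBilinAt (I := modelEnd m) (pullback (m := m) J Φ g) p := by
  obtain ⟨β, hβ⟩ := hg
  exact ⟨β.compl₁₂ (mfderiv (modelEnd m) J Φ p).toLinearMap (mfderiv (modelEnd m) J Φ p).toLinearMap,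
    fun u v => hβ _ _⟩

lemma isBilinAt_refMetric {h : FormField (𝓡 m) N} {k : ℝ} {p : ℝ × N} (hh : IsBilinAt h p.2) :
    IsBilinAt (refMetric h k) p := by
  obtain ⟨β, hβ⟩ := hh
  let f : TangentSpace (modelEnd m) p →ₗ[ℝ] ℝ := LinearMap.fst ℝ ℝ (ModelN m)
  let s : TangentSpace (modelEnd m) p →ₗ[ℝ] TangentSpace (𝓡 m) p.2 :=
    LinearMap.snd ℝ ℝ (ModelN m)
  refine ⟨(p.1 ^ 2 + k)⁻¹ • (LinearMap.mul ℝ ℝ).compl₁₂ f f + p.1 ^ 2 • β.compl₁₂ s s,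
    fun u v => ?_⟩
  have h1 : refMetric h k p u v = f u * f v / (p.1 ^ 2 + k) + p.1 ^ 2 * β (s u) (s v) := by
    rw [← hβ]; rfl
  rw [h1]
  simp only [LinearMap.add_apply, LinearMap.smul_apply, LinearMap.compl₁₂_apply,
    LinearMap.mul_apply', smul_eq_mul]
  ring

/-- The factor `ℝ` has one global chart, so the chart at `(R, a)` does not depend on `R`. This is
why the charts of the end can all be based at the dummy value `R = 0`, even though that point may
lie outside the end. -/
lemma extChartAt_end (R : ℝ) (a : N) : extChartAt (modelEnd m) (R, a) =
    (PartialEquiv.refl ℝ).prod (extChartAt (𝓡 m) a) := by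
  rw [extChartAt_prod]; simp only [extChartAt_model_space_eq_id]

lemma mem_extChartAt_end_target {R : ℝ} {a : N} {z : ℝ × ModelN m} :
    z ∈ (extChartAt (modelEnd m) (R, a)).target ↔ z.2 ∈ (extChartAt (𝓡 m) a).target := by
  rw [extChartAt_end]
  exact ⟨fun h => h.2, fun h => ⟨mem_univ _, h⟩⟩

lemma mem_extChartAt_end_source {R : ℝ} {a : N} {z : ℝ × N} :
    z ∈ (extChartAt (modelEnd m) (R, a)).source ↔ z.2 ∈ (extChartAt (𝓡 m) a).source := by
  rw [extChartAt_end]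
  exact ⟨fun h => h.2, fun h => ⟨mem_univ _, h⟩⟩

variable [IsManifold (𝓡 m) ∞ N]

lemma mfderiv_extChartAt_end_symm {R : ℝ} {a : N} {z : ℝ × ModelN m}
    (hz : z.2 ∈ (extChartAt (𝓡 m) a).target) (w : ℝ × ModelN m) :
    (mfderiv 𝓘(ℝ, ℝ × ModelN m) (modelEnd m) (extChartAt (modelEnd m) (R, a)).symm z w) =
      tangentEnd ((extChartAt (modelEnd m) (R, a)).symm z) w.1
        (mfderiv 𝓘(ℝ, ModelN m) (𝓡 m) (extChartAt (𝓡 m) a).symm z.2 w.2) := by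
  have h1 : MDifferentiableAt 𝓘(ℝ, ModelN m) (𝓡 m) (extChartAt (𝓡 m) a).symm z.2 :=
    mdifferentiableAt_extChartAt_symm hz
  have hf : MDifferentiableAt 𝓘(ℝ, ℝ × ModelN m) 𝓘(ℝ, ℝ) (Prod.fst : ℝ × ModelN m → ℝ) z :=
    differentiableAt_fst.mdifferentiableAt
  have hs : MDifferentiableAt 𝓘(ℝ, ℝ × ModelN m) 𝓘(ℝ, ModelN m) (Prod.snd : ℝ × ModelN m → _) z :=
    differentiableAt_snd.mdifferentiableAt
  have hg : MDifferentiableAt 𝓘(ℝ, ℝ × ModelN m) (𝓡 m)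
      (fun z : ℝ × ModelN m => (extChartAt (𝓡 m) a).symm z.2) z := h1.comp z hs
  have h2 := mfderiv_prodMk hf hg
  have h3 : mfderiv 𝓘(ℝ, ℝ × ModelN m) (𝓡 m) (fun z : ℝ × ModelN m => (extChartAt (𝓡 m) a).symm z.2) z =
      (mfderiv 𝓘(ℝ, ModelN m) (𝓡 m) (extChartAt (𝓡 m) a).symm z.2).comp
        (mfderiv 𝓘(ℝ, ℝ × ModelN m) 𝓘(ℝ, ModelN m) (Prod.snd : ℝ × ModelN m → _) z) :=
    mfderiv_comp z h1 hs
  rw [h3, mfderiv_eq_fderiv, mfderiv_eq_fderiv, fderiv_fst, fderiv_snd] at h2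
  exact congrArg (fun T => T w) h2

end EndCharts

/-! ### The reference metric and the pulled back metric as metrics on the end. -/

section EndMetric

open Matrix

variable {m : ℕ} {N : Type*} [TopologicalSpace N] [ChartedSpace (ModelN m) N]

/-- The components of a form field on `ℝ × N` in the product of `ℝ` with the chart of `N` at `a`. -/
def endMatrix (g : FormField (modelEnd m) (ℝ × N)) (a : N) (z : ℝ × ModelN m) :
    Matrix (Unit ⊕ Fin m) (Unit ⊕ Fin m) ℝ :=
  localForm (modelEnd m) (basisEnd m) g (0, a) z

/-- The expression of a function on `ℝ × N` in the product of `ℝ` with the chart of `N` at `a`. -/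
def endFun (V : ℝ × N → ℝ) (a : N) (z : ℝ × ModelN m) : ℝ := localFun (modelEnd m) V (0, a) z

variable (m) in
/-- The part of the end which is covered by the chart of `N` at `a`. -/
def endDomain (r₀ : ℝ) (a : N) : Set (ℝ × ModelN m) := Ioi r₀ ×ˢ (extChartAt (𝓡 m) a).target

lemma isOpen_endDomain (r₀ : ℝ) (a : N) : IsOpen (endDomain m r₀ a) :=
  isOpen_Ioi.prod (isOpen_extChartAt_target a)

/-- Continuity and algebraic properties of a `C²` Riemannian metric on `(r₀, ∞) × N`. -/
structure IsEndMetric (g : FormField (modelEnd m) (ℝ × N)) (r₀ : ℝ) : Prop where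
  bilin : ∀ p ∈ endSet N r₀, IsBilinAt g p
  symm : ∀ p ∈ endSet N r₀, ∀ u v, g p u v = g p v u
  pos : ∀ p ∈ endSet N r₀, ∀ v, v ≠ 0 → 0 < g p v v
  contDiffOn : ∀ a i j, ContDiffOn ℝ 2 (fun z => endMatrix g a z i j) (endDomain m r₀ a)

lemma isOpen_endSet (r₀ : ℝ) : IsOpen (endSet N r₀) := isOpen_Ioi.prod isOpen_univ

lemma basisEnd_inl : basisEnd m (Sum.inl ()) = ((1, 0) : ℝ × ModelN m) := by
  simp [basisEnd]

lemma basisEnd_inr (i : Fin m) : basisEnd m (Sum.inr i) = ((0, basisN m i) : ℝ × ModelN m) := by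
  simp [basisEnd]

variable [IsManifold (𝓡 m) ∞ N]

lemma IsEndMetric.isMetricAt {g : FormField (modelEnd m) (ℝ × N)} {r₀ : ℝ} (hg : IsEndMetric g r₀)
    {a : N} {z : ℝ × ModelN m} (hz : z ∈ endDomain m r₀ a) : IsMetricAt (endMatrix g a) z := by
  have hmem : (extChartAt (modelEnd m) ((0 : ℝ), a)).symm z ∈ endSet N r₀ := ⟨hz.1, mem_univ _⟩
  refine isMetricAt_localForm (basisEnd m) (mem_extChartAt_end_target.2 hz.2) (hg.bilin _ hmem) ?_
    (hg.pos _ hmem) fun i j => (hg.contDiffOn a i j).contDiffAt ((isOpen_endDomain r₀ a).mem_nhds hz)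
  filter_upwards [(isOpen_endSet r₀).mem_nhds hmem] with p hp using hg.symm p hp

/-- In a product chart the reference metric is block diagonal with separated variables; all bounds
on its derivatives are read off from this form. -/
lemma endMatrix_refMetric (h : FormField (𝓡 m) N) (k : ℝ) {a : N} {z : ℝ × ModelN m}
    (hz : z.2 ∈ (extChartAt (𝓡 m) a).target) (hh : IsBilinAt h ((extChartAt (𝓡 m) a).symm z.2)) :
    endMatrix (refMetric h k) a z = Matrix.fromBlocks (Matrix.of fun _ _ => 1 / (z.1 ^ 2 + k)) 0 0
      (z.1 ^ 2 • localForm (𝓡 m) (basisN m) h a z.2) := by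
  obtain ⟨β, hβ⟩ := hh
  let D : ModelN m →ₗ[ℝ] TangentSpace (𝓡 m) ((extChartAt (𝓡 m) a).symm z.2) :=
    (mfderiv 𝓘(ℝ, ModelN m) (𝓡 m) (extChartAt (𝓡 m) a).symm z.2).toLinearMap
  have hb : ∀ w w' : ℝ × ModelN m, refMetric h k ((extChartAt (modelEnd m) ((0 : ℝ), a)).symm z)
      (mfderiv 𝓘(ℝ, ℝ × ModelN m) (modelEnd m) (extChartAt (modelEnd m) ((0 : ℝ), a)).symm z w)
      (mfderiv 𝓘(ℝ, ℝ × ModelN m) (modelEnd m) (extChartAt (modelEnd m) ((0 : ℝ), a)).symm z w') =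
      w.1 * w'.1 / (z.1 ^ 2 + k) + z.1 ^ 2 * (β.compl₁₂ D D) w.2 w'.2 := by
    intro w w'
    rw [mfderiv_extChartAt_end_symm hz, mfderiv_extChartAt_end_symm hz, LinearMap.compl₁₂_apply,
      ← hβ]
    rfl
  ext i j
  rw [endMatrix, localForm, Matrix.of_apply, hb]
  rcases i with ⟨⟩ | i <;> rcases j with ⟨⟩ | j
  · rw [basisEnd_inl]
    simp
  · rw [basisEnd_inl, basisEnd_inr]
    simp
  · rw [basisEnd_inl, basisEnd_inr]
    simp
  · rw [basisEnd_inr, basisEnd_inr, LinearMap.compl₁₂_apply, ← hβ]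
    simp only [Matrix.fromBlocks_apply₂₂, mul_zero, zero_div, zero_add, Matrix.smul_apply,
      smul_eq_mul, localForm, Matrix.of_apply]
    rfl

lemma tangentEnd_eq_zero {p : ℝ × N} {v : TangentSpace (modelEnd m) p} (h1 : radialPart v = 0)
    (h2 : tangentialPart v = 0) : v = 0 := Prod.ext (α := ℝ) (β := ModelN m) h1 h2

lemma sq_add_pos {r₀ k r : ℝ} (hr₀ : 0 ≤ r₀) (hk : 0 ≤ r₀ ^ 2 + k) (hr : r₀ < r) : 0 < r ^ 2 + k := by
  nlinarith

lemma isEndMetric_refMetric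
    (h : Bundle.ContMDiffRiemannianMetric (𝓡 m) ∞ (ModelN m) (fun x : N => TangentSpace (𝓡 m) x))
    {k r₀ : ℝ} (hr₀ : 0 ≤ r₀) (hk : 0 ≤ r₀ ^ 2 + k) :
    IsEndMetric (refMetric (fun x u v => h.inner x u v) k) r₀ := by
  refine ⟨fun p hp => isBilinAt_refMetric (isBilinAt_inner h _), fun p hp u v => ?_,
    fun p hp v hv => ?_, fun a i j => ?_⟩
  · simp only [refMetric]
    rw [h.symm, mul_comm (radialPart u)]
  · have h0 : 0 < p.1 ^ 2 + k := sq_add_pos hr₀ hk hp.1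
    have hp1 : 0 < p.1 := hr₀.trans_lt hp.1
    have hA : 0 ≤ radialPart v * radialPart v / (p.1 ^ 2 + k) :=
      div_nonneg (mul_self_nonneg _) h0.le
    have hB : ∀ u : TangentSpace (𝓡 m) p.2, u ≠ 0 → 0 < h.inner p.2 u u := fun u hu => h.pos _ u hu
    simp only [refMetric]
    by_cases hu : tangentialPart v = 0
    · have hr : radialPart v ≠ 0 := fun hr => hv (tangentEnd_eq_zero hr hu)
      have : 0 < radialPart v * radialPart v / (p.1 ^ 2 + k) := by
        have := mul_self_pos.2 hr
        positivity
      have h2 : h.inner p.2 (tangentialPart v) (tangentialPart v) = 0 := by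
        rw [hu]; exact map_zero _
      rw [h2, mul_zero, add_zero]
      exact this
    · exact add_pos_of_nonneg_of_pos hA (mul_pos (by positivity) (hB _ hu))
  · have h1 : ContDiffOn ℝ 2 (fun z : ℝ × ModelN m => 1 / (z.1 ^ 2 + k)) (endDomain m r₀ a) := by
      refine contDiffOn_const.div ((contDiff_fst.pow 2).add contDiff_const).contDiffOn ?_
      intro z hz
      exact (sq_add_pos hr₀ hk hz.1).ne'
    have h2 : ∀ i j, ContDiffOn ℝ 2 (fun z : ℝ × ModelN m => z.1 ^ 2 *
        localForm (𝓡 m) (basisN m) (fun x u v => h.inner x u v) a z.2 i j) (endDomain m r₀ a) := by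
      intro i j
      refine (contDiff_fst.pow 2).contDiffOn.mul ?_
      refine ((contDiffOn_localForm (n := ∞) (by simp) h (basisN m) a i j).of_le ?_).comp
        contDiff_snd.contDiffOn fun z hz => hz.2
      exact WithTop.coe_le_coe.2 (le_top : (2 : ℕ∞) ≤ ⊤)
    have h3 : ∀ z ∈ endDomain m r₀ a, endMatrix (refMetric (fun x u v => h.inner x u v) k) a z i j =
      Matrix.fromBlocks (Matrix.of fun _ _ => 1 / (z.1 ^ 2 + k)) 0 0
      (z.1 ^ 2 • localForm (𝓡 m) (basisN m) (fun x u v => h.inner x u v) a z.2) i j := fun z hz => by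
      rw [endMatrix_refMetric _ _ hz.2 (isBilinAt_inner h _)]
    refine ContDiffOn.congr ?_ h3
    rcases i with ⟨⟩ | i <;> rcases j with ⟨⟩ | j
    · exact h1
    · exact contDiffOn_const
    · exact contDiffOn_const
    · exact h2 i j

/-- Bilinearity and symmetry are inherited from the metric on `M`, and smoothness of `Φ` preserves
`C²` components. Positivity is an input: in the application it comes from the uniform equivalence
with the reference metric. -/
lemma isEndMetric_pullback
    {E : Type*} [NormedAddCommGroup E] [NormedSpace ℝ E]
    {H : Type*} [TopologicalSpace H] {J : ModelWithCorners ℝ E H}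
    {M : Type*} [TopologicalSpace M] [ChartedSpace H M] [IsManifold J ∞ M]
    (g : Bundle.ContMDiffRiemannianMetric J 2 E (fun q : M => TangentSpace J q)) {r₀ : ℝ}
    (Φ : PartialDiffeomorph (modelEnd m) J (ℝ × N) M ∞) (hΦ : Φ.source = endSet N r₀)
    (hpos : ∀ p ∈ endSet N r₀, ∀ v : TangentSpace (modelEnd m) p, v ≠ 0 →
      0 < pullback (m := m) J Φ (fun q u v => g.inner q u v) p v v) :
    IsEndMetric (m := m) (pullback J Φ (fun q u v => g.inner q u v)) r₀ := by
  refine ⟨fun p hp => isBilinAt_pullback (isBilinAt_inner g _), fun p hp u v => g.symm _ _ _, hpos,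
    fun a i j => ?_⟩
  have hmem : MapsTo (extChartAt (modelEnd m) ((0 : ℝ), a)).symm (endDomain m r₀ a)
    (endSet N r₀) := fun z hz => ⟨hz.1, mem_univ _⟩
  have hsub : endDomain m r₀ a ⊆ (extChartAt (modelEnd m) ((0 : ℝ), a)).target := fun z hz =>
    mem_extChartAt_end_target.2 hz.2
  have hΦs : ContMDiffOn (modelEnd m) J ∞ Φ (endSet N r₀) := hΦ ▸ Φ.contMDiffOn
  have h1 : ContMDiffOn 𝓘(ℝ, ℝ × ModelN m) J ∞
      (fun z => Φ ((extChartAt (modelEnd m) ((0 : ℝ), a)).symm z)) (endDomain m r₀ a) :=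
    hΦs.comp ((contMDiffOn_extChartAt_symm (n := ∞) ((0 : ℝ), a)).mono hsub) hmem
  refine (contDiffOn_metric_comp (WithTop.coe_le_coe.2 (le_top : (2 : ℕ∞) + 1 ≤ ⊤)) g
    (isOpen_endDomain r₀ a) h1 (basisEnd m i) (basisEnd m j)).congr fun z hz => ?_
  have h2 : mfderiv 𝓘(ℝ, ℝ × ModelN m) J
      (fun z => Φ ((extChartAt (modelEnd m) ((0 : ℝ), a)).symm z)) z =
      (mfderiv (modelEnd m) J Φ ((extChartAt (modelEnd m) ((0 : ℝ), a)).symm z)).comp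
      (mfderiv 𝓘(ℝ, ℝ × ModelN m) (modelEnd m) (extChartAt (modelEnd m) ((0 : ℝ), a)).symm z) :=
    mfderiv_comp z ((hΦs.contMDiffAt ((isOpen_endSet r₀).mem_nhds (hmem hz))).mdifferentiableAt
      (by simp)) (mdifferentiableAt_extChartAt_symm (hsub hz))
  simp only [h2]
  rfl

end EndMetric

/-! ### Transitions between product charts, and chart independence of the flux density. -/

section EndTransition

open Matrix

variable {m : ℕ}

lemma basisEnd_repr_inl (w : ℝ × ModelN m) : (basisEnd m).repr w (Sum.inl ()) = w.1 := by
  simp [basisEnd]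

lemma basisEnd_repr_inr (w : ℝ × ModelN m) (i : Fin m) :
    (basisEnd m).repr w (Sum.inr i) = (basisN m).repr w.2 i := by
  simp [basisEnd]

/-- The components of the reference metric and of its orthonormal frame are products of a function
of `r` and a function on `N`, so these derivatives are the ones needed. -/
lemma pd_inl_mul {f : ℝ → ℝ} {η : ModelN m → ℝ} {z : ℝ × ModelN m}
    (hf : DifferentiableAt ℝ f z.1) (hη : DifferentiableAt ℝ η z.2) :
    pd (basisEnd m) (Sum.inl ()) (fun z => f z.1 * η z.2) z = deriv f z.1 * η z.2 := by
  have h1 : HasFDerivAt (fun z : ℝ × ModelN m => f z.1 * η z.2) _ z :=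
    (hf.hasFDerivAt.comp z hasFDerivAt_fst).mul (hη.hasFDerivAt.comp z hasFDerivAt_snd)
  rw [pd, h1.fderiv, basisEnd_inl]
  simp [mul_comm]

lemma pd_inr_mul {f : ℝ → ℝ} {η : ModelN m → ℝ} {z : ℝ × ModelN m} (i : Fin m)
    (hf : DifferentiableAt ℝ f z.1) (hη : DifferentiableAt ℝ η z.2) :
    pd (basisEnd m) (Sum.inr i) (fun z => f z.1 * η z.2) z = f z.1 * pd (basisN m) i η z.2 := by
  have h1 : HasFDerivAt (fun z : ℝ × ModelN m => f z.1 * η z.2) _ z :=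
    (hf.hasFDerivAt.comp z hasFDerivAt_fst).mul (hη.hasFDerivAt.comp z hasFDerivAt_snd)
  rw [pd, h1.fderiv, basisEnd_inr]
  simp [pd]

lemma jac_prod {ψ : ℝ × ModelN m → ℝ × ModelN m} {t : ModelN m → ModelN m}
    (hψ : ∀ z, ψ z = (z.1, t z.2)) {z : ℝ × ModelN m} (ht : DifferentiableAt ℝ t z.2) :
    jac (basisEnd m) ψ z = Matrix.fromBlocks 1 0 0 (jac (basisN m) t z.2) := by
  have hd : ∀ i, DifferentiableAt ℝ (fun y => (basisN m).repr (t y) i) z.2 := fun i =>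
    ((contDiff_repr (basisN m) i (n := 1)).differentiable (by norm_num)).differentiableAt.comp _ ht
  ext i j
  simp only [jac, Matrix.of_apply]
  rcases i with ⟨⟩ | i
  · have h1 : (fun z => (basisEnd m).repr (ψ z) (Sum.inl ())) =
        fun z : ℝ × ModelN m => z.1 * (fun _ => (1 : ℝ)) z.2 := by
      funext z; rw [basisEnd_repr_inl, hψ, mul_one]
    rw [h1]
    rcases j with ⟨⟩ | j
    · rw [pd_inl_mul (f := fun r => r) differentiableAt_id (differentiableAt_const _)]
      simp
    · rw [pd_inr_mul j (f := fun r => r) differentiableAt_id (differentiableAt_const _)]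
      simp [pd]
  · have h1 : (fun z => (basisEnd m).repr (ψ z) (Sum.inr i)) =
        fun z : ℝ × ModelN m => (fun _ => (1 : ℝ)) z.1 * (fun y => (basisN m).repr (t y) i) z.2 := by
      funext z; rw [basisEnd_repr_inr, hψ, one_mul]
    rw [h1]
    rcases j with ⟨⟩ | j
    · rw [pd_inl_mul (differentiableAt_const _) (hd i)]
      simp
    · rw [pd_inr_mul j (differentiableAt_const _) (hd i)]
      simp

variable {N : Type*} [TopologicalSpace N] [ChartedSpace (ModelN m) N] [IsManifold (𝓡 m) ∞ N]

lemma mem_transitionDomain_end {a b : N} {z : ℝ × ModelN m}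
    (hz : z.2 ∈ transitionDomain (𝓡 m) a b) :
    z ∈ transitionDomain (modelEnd m) ((0 : ℝ), a) ((0 : ℝ), b) :=
  ⟨mem_extChartAt_end_target.2 hz.1, mem_extChartAt_end_source.2 hz.2⟩

lemma transition_end (a b : N) (z : ℝ × ModelN m) :
    transition (modelEnd m) ((0 : ℝ), a) ((0 : ℝ), b) z = (z.1, transition (𝓡 m) a b z.2) := rfl

namespace IsEndMetric

variable {g b : FormField (modelEnd m) (ℝ × N)} {r₀ : ℝ} {V : ℝ × N → ℝ}

lemma isCoordChangeAt (hg : IsEndMetric g r₀) {p q : N} {z : ℝ × ModelN m} (hr : r₀ < z.1)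
    (hz : z.2 ∈ transitionDomain (𝓡 m) p q) :
    IsCoordChangeAt (basisEnd m) (transition (modelEnd m) ((0 : ℝ), p) ((0 : ℝ), q))
      (endMatrix g q) (endMatrix g p) z := by
  refine isCoordChangeAt_transition (basisEnd m) (mem_transitionDomain_end hz) ?_
    (hg.isMetricAt ⟨hr, (transition_mem hz).1⟩)
  have hmem : (extChartAt (modelEnd m) ((0 : ℝ), p)).symm z ∈ endSet N r₀ := ⟨hr, mem_univ _⟩
  filter_upwards [(isOpen_endSet r₀).mem_nhds hmem] with x hx using hg.bilin x hx

lemma mem_transitionDomain_self {p : N} {y : ModelN m} (hy : y ∈ (extChartAt (𝓡 m) p).target) :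
    y ∈ transitionDomain (𝓡 m) p ((extChartAt (𝓡 m) p).symm y) :=
  ⟨hy, mem_extChartAt_source _⟩

/-- The left side is evaluated in the chart preferred at the point itself, which varies from point
to point; coordinate invariance moves it to the fixed chart at `p`. The static equations and `|dV|`
are moved in the same way below. -/
lemma scalarCurvature_eq (hg : IsEndMetric g r₀) {p : N} {z : ℝ × ModelN m}
    (hz : z ∈ endDomain m r₀ p) :
    scalarCurvature (modelEnd m) (basisEnd m) g (z.1, (extChartAt (𝓡 m) p).symm z.2) =
      scalar (basisEnd m) (endMatrix g p) z :=
  (hg.isCoordChangeAt hz.1 (mem_transitionDomain_self hz.2)).scalar_eq.symm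

omit [IsManifold (𝓡 m) ∞ N] in
lemma mapsTo_endDomain (p : N) : MapsTo (extChartAt (modelEnd m) ((0 : ℝ), p)).symm
    (endDomain m r₀ p) (endSet N r₀) := fun _ hz => ⟨hz.1, mem_univ _⟩

omit [IsManifold (𝓡 m) ∞ N] in
lemma endDomain_subset (p : N) :
    endDomain m r₀ p ⊆ (extChartAt (modelEnd m) ((0 : ℝ), p)).target := fun _ hz =>
  mem_extChartAt_end_target.2 hz.2

lemma _root_.WarpedMass.contDiffOn_endFun
    (hV : ContMDiffOn (modelEnd m) 𝓘(ℝ, ℝ) 2 V (endSet N r₀)) (p : N) :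
    ContDiffOn ℝ 2 (endFun V p) (endDomain m r₀ p) :=
  contMDiffOn_iff_contDiffOn.1 (hV.comp (((contMDiffOn_extChartAt_symm (n := ∞) ((0 : ℝ), p)).mono
    (endDomain_subset p)).of_le (WithTop.coe_le_coe.2 (le_top : (2 : ℕ∞) ≤ ⊤)))
    (mapsTo_endDomain p))

lemma _root_.WarpedMass.contDiffAt_endFun
    (hV : ContMDiffOn (modelEnd m) 𝓘(ℝ, ℝ) 2 V (endSet N r₀)) {p : N} {z : ℝ × ModelN m}
    (hz : z ∈ endDomain m r₀ p) : ContDiffAt ℝ 2 (endFun V p) z :=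
  (contDiffOn_endFun hV p).contDiffAt ((isOpen_endDomain r₀ p).mem_nhds hz)

lemma endFun_transition {p q : N} {z : ℝ × ModelN m}
    (hz : z.2 ∈ transitionDomain (𝓡 m) p q) :
    endFun V p =ᶠ[𝓝 z] fun w => endFun V q (transition (modelEnd m) ((0 : ℝ), p) ((0 : ℝ), q) w) :=
  localFun_transition V (mem_transitionDomain_end hz)

lemma differentialNorm_eq (hb : IsEndMetric b r₀) {p : N} {z : ℝ × ModelN m}
    (hV : ContMDiffOn (modelEnd m) 𝓘(ℝ, ℝ) 2 V (endSet N r₀)) (hz : z ∈ endDomain m r₀ p) :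
    differentialNorm (modelEnd m) (basisEnd m) b V (z.1, (extChartAt (𝓡 m) p).symm z.2) =
      gradNorm (basisEnd m) (endMatrix b p) (endFun V p) z := by
  have hs := mem_transitionDomain_self hz.2
  have hV' := (contDiffAt_endFun hV (p := (extChartAt (𝓡 m) p).symm z.2)
    (z := transition (modelEnd m) ((0 : ℝ), p) ((0 : ℝ), (extChartAt (𝓡 m) p).symm z.2) z)
    ⟨hz.1, (transition_mem hs).1⟩).differentiableAt (by norm_num)
  exact ((hb.isCoordChangeAt hz.1 hs).gradNorm_eq (endFun_transition hs) hV').symm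

lemma laplacian_eq_of_static (hb : IsEndMetric b r₀)
    (hV : V ∈ staticPotentials (modelEnd m) (basisEnd m) b (endSet N r₀))
    {p : N} {z : ℝ × ModelN m} (hz : z ∈ endDomain m r₀ p) :
    laplacian (basisEnd m) (endMatrix b p) (endFun V p) z =
      Fintype.card (Unit ⊕ Fin m) * endFun V p z := by
  have hs := mem_transitionDomain_self hz.2
  have hV' := contDiffAt_endFun hV.1 (p := (extChartAt (𝓡 m) p).symm z.2)
    (z := transition (modelEnd m) ((0 : ℝ), p) ((0 : ℝ), (extChartAt (𝓡 m) p).symm z.2) z)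
    ⟨hz.1, (transition_mem hs).1⟩
  have h1 := (hb.isCoordChangeAt hz.1 hs).laplacian_eq (endFun_transition hs) hV'
  have h2 := (hV.2 (z.1, (extChartAt (𝓡 m) p).symm z.2) ⟨hz.1, mem_univ _⟩).1
  rw [h1]
  exact (eq_neg_of_add_eq_zero_left h2).trans (by rw [neg_mul, neg_neg]; rfl)

lemma hessian_eq_of_static (hb : IsEndMetric b r₀)
    (hV : V ∈ staticPotentials (modelEnd m) (basisEnd m) b (endSet N r₀))
    {p : N} {z : ℝ × ModelN m} (hz : z ∈ endDomain m r₀ p) (i j : Unit ⊕ Fin m) :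
    hessian (basisEnd m) (endMatrix b p) (endFun V p) i j z =
      endFun V p z * (ricci (basisEnd m) (endMatrix b p) i j z +
        Fintype.card (Unit ⊕ Fin m) * endMatrix b p z i j) := by
  have hs := mem_transitionDomain_self hz.2
  set x := (extChartAt (𝓡 m) p).symm z.2 with hx
  set ψ := transition (modelEnd m) ((0 : ℝ), p) ((0 : ℝ), x) with hψ
  have hV' := contDiffAt_endFun hV.1 (p := x) (z := ψ z) ⟨hz.1, (transition_mem hs).1⟩
  have hc := hb.isCoordChangeAt hz.1 hs
  have h1 := hc.hessMat_eq (endFun_transition hs) hV'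
  have h2 : hessMat (basisEnd m) (endMatrix b x) (endFun V x) (ψ z) =
      endFun V p z • (ricMat (basisEnd m) (endMatrix b x) (ψ z) +
        (Fintype.card (Unit ⊕ Fin m) : ℝ) • endMatrix b x (ψ z)) := by
    ext i j
    refine ((hV.2 (z.1, x) ⟨hz.1, mem_univ _⟩).2 i j).trans ?_
    simp only [Matrix.smul_apply, Matrix.add_apply, smul_eq_mul, neg_mul, sub_neg_eq_add]
    rfl
  have h3 : hessMat (basisEnd m) (endMatrix b p) (endFun V p) z = endFun V p z •
      (ricMat (basisEnd m) (endMatrix b p) z +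
        (Fintype.card (Unit ⊕ Fin m) : ℝ) • endMatrix b p z) := by
    rw [h1, h2, hc.ricMat_eq, hc.eq_self]
    simp only [Matrix.mul_smul, Matrix.smul_mul, Matrix.mul_add, Matrix.add_mul, Matrix.mul_assoc]
    rfl
  exact congrFun (congrFun h3 i) j

end IsEndMetric

/-- The components of the mass vector in the product of `ℝ` with the chart of `N` at `p`. -/
def endMass (g b : FormField (modelEnd m) (ℝ × N)) (V : ℝ × N → ℝ) (p : N) (i : Unit ⊕ Fin m)
    (z : ℝ × ModelN m) : ℝ :=
  massVector (basisEnd m) (endMatrix g p) (endMatrix b p) (endFun V p) i z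

/-- The components of a metric on `N`. -/
lemma isMetricAt_riemannian
    (h : Bundle.ContMDiffRiemannianMetric (𝓡 m) ∞ (ModelN m) (fun x : N => TangentSpace (𝓡 m) x))
    {p : N} {y : ModelN m} (hy : y ∈ (extChartAt (𝓡 m) p).target) :
    IsMetricAt (localForm (𝓡 m) (basisN m) (fun x u v => h.inner x u v) p) y :=
  isMetricAt_localForm (basisN m) hy (isBilinAt_inner h _)
    (Eventually.of_forall fun x u v => h.symm x u v) (fun v hv => h.pos _ v hv) fun i j =>
    ((contDiffOn_localForm (n := ∞) (by simp) h (basisN m) p i j).contDiffAt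
      ((isOpen_extChartAt_target p).mem_nhds hy)).of_le
      (WithTop.coe_le_coe.2 (le_top : (2 : ℕ∞) ≤ ⊤))

lemma isCoordChangeAt_riemannian
    (h : Bundle.ContMDiffRiemannianMetric (𝓡 m) ∞ (ModelN m) (fun x : N => TangentSpace (𝓡 m) x))
    {p q : N} {y : ModelN m} (hy : y ∈ transitionDomain (𝓡 m) p q) :
    IsCoordChangeAt (basisN m) (transition (𝓡 m) p q)
      (localForm (𝓡 m) (basisN m) (fun x u v => h.inner x u v) q)
      (localForm (𝓡 m) (basisN m) (fun x u v => h.inner x u v) p) y :=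
  isCoordChangeAt_transition (basisN m) hy (Eventually.of_forall fun _ => isBilinAt_inner h _)
    (isMetricAt_riemannian h (transition_mem hy).1)

section MassTransition

variable {g b : FormField (modelEnd m) (ℝ × N)} {r₀ : ℝ} {V : ℝ × N → ℝ}

lemma jac_transition_end {p q : N} {z : ℝ × ModelN m} (hz : z.2 ∈ transitionDomain (𝓡 m) p q) :
    jac (basisEnd m) (transition (modelEnd m) ((0 : ℝ), p) ((0 : ℝ), q)) z =
      Matrix.fromBlocks 1 0 0 (jac (basisN m) (transition (𝓡 m) p q) z.2) :=
  jac_prod (transition_end p q) ((contDiffAt_transition hz).differentiableAt (by simp))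

/-- The transition fixes `r`, so its Jacobian is block diagonal and the density law decouples: on a
slice the radial component is a scalar density and the tangential components form a vector density.
-/
lemma endMass_transition (hg : IsEndMetric g r₀) (hb : IsEndMetric b r₀)
    (hV : ContMDiffOn (modelEnd m) 𝓘(ℝ, ℝ) 2 V (endSet N r₀)) {p q : N} {R : ℝ} {y : ModelN m}
    (hR : r₀ < R) (hy : y ∈ transitionDomain (𝓡 m) p q) :
    endMass g b V p (Sum.inl ()) (R, y) = |(jac (basisN m) (transition (𝓡 m) p q) y).det| *
        endMass g b V q (Sum.inl ()) (R, transition (𝓡 m) p q y) ∧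
    ∀ A, ∑ B, jac (basisN m) (transition (𝓡 m) p q) y A B * endMass g b V p (Sum.inr B) (R, y) =
      |(jac (basisN m) (transition (𝓡 m) p q) y).det| *
        endMass g b V q (Sum.inr A) (R, transition (𝓡 m) p q y) := by
  have hV' := (contDiffAt_endFun hV (p := q) (z := (R, transition (𝓡 m) p q y))
    ⟨hR, (transition_mem hy).1⟩).differentiableAt (by norm_num)
  have h1 := (hg.isCoordChangeAt (z := (R, y)) hR hy).jac_mulVec_massVector
    (hb.isCoordChangeAt hR hy) (IsEndMetric.endFun_transition (V := V) (z := (R, y)) hy) hV'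
  rw [jac_transition_end (z := (R, y)) hy, Matrix.det_fromBlocks_zero₂₁, Matrix.det_one,
    one_mul] at h1
  refine ⟨?_, fun A => ?_⟩
  · have h2 := congrFun h1 (Sum.inl ())
    simp only [Matrix.mulVec, dotProduct, Fintype.sum_sum_type, Matrix.fromBlocks_apply₁₁,
      Matrix.fromBlocks_apply₁₂, Matrix.zero_apply, zero_mul, Finset.sum_const_zero, add_zero,
      Finset.univ_unique, Finset.sum_singleton, PUnit.default_eq_unit, Matrix.one_apply_eq,
      one_mul] at h2
    exact h2
  · have h2 := congrFun h1 (Sum.inr A)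
    simp only [Matrix.mulVec, dotProduct, Fintype.sum_sum_type, Matrix.fromBlocks_apply₂₁,
      Matrix.fromBlocks_apply₂₂, Matrix.zero_apply, zero_mul, Finset.sum_const_zero, zero_add] at h2
    exact h2

/-- The density of `Uⁱ ∂ᵢη` at `{r = R}`, for a function `η` on `N`, computed in the chart at `p`. -/
def tangentialDensity (h : FormField (𝓡 m) N) (g b : FormField (modelEnd m) (ℝ × N))
    (V : ℝ × N → ℝ) (R : ℝ) (η : N → ℝ) (p : N) (y : ModelN m) : ℝ :=
  (∑ A, pd (basisN m) A (localFun (𝓡 m) η p) y * endMass g b V p (Sum.inr A) (R, y)) /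
    Real.sqrt (localForm (𝓡 m) (basisN m) h p y).det

variable (h : Bundle.ContMDiffRiemannianMetric (𝓡 m) ∞ (ModelN m) (fun x : N => TangentSpace (𝓡 m) x))

/-- A covector paired with a vector density is a scalar density, and division by `√det h` cancels
the factor `|det J|`. -/
lemma tangentialDensity_transition (hg : IsEndMetric g r₀) (hb : IsEndMetric b r₀)
    (hV : ContMDiffOn (modelEnd m) 𝓘(ℝ, ℝ) 2 V (endSet N r₀)) {p q : N} {R : ℝ} {y : ModelN m}
    (hR : r₀ < R) (hy : y ∈ transitionDomain (𝓡 m) p q) {η : N → ℝ}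
    (hη : DifferentiableAt ℝ (localFun (𝓡 m) η q) (transition (𝓡 m) p q y)) :
    tangentialDensity (fun x u v => h.inner x u v) g b V R η p y =
      tangentialDensity (fun x u v => h.inner x u v) g b V R η q (transition (𝓡 m) p q y) := by
  have h1 := (endMass_transition hg hb hV hR hy).2
  have hc := isCoordChangeAt_riemannian h hy
  have h2 : ∀ B, pd (basisN m) B (localFun (𝓡 m) η p) y =
      ∑ A, jac (basisN m) (transition (𝓡 m) p q) y A B *
        pd (basisN m) A (localFun (𝓡 m) η q) (transition (𝓡 m) p q y) := fun B => by
    rw [pd_congr (basisN m) B (localFun_transition η hy),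
      pd_comp_jac (basisN m) B hη hc.differentiableAt]
  have h3 : |(jac (basisN m) (transition (𝓡 m) p q) y).det| ≠ 0 := abs_ne_zero.2 hc.det_ne
  rw [tangentialDensity, tangentialDensity, hc.sqrt_det_eq]
  have h4 : ∑ B, pd (basisN m) B (localFun (𝓡 m) η p) y * endMass g b V p (Sum.inr B) (R, y) =
      |(jac (basisN m) (transition (𝓡 m) p q) y).det| * ∑ A,
        pd (basisN m) A (localFun (𝓡 m) η q) (transition (𝓡 m) p q y) *
          endMass g b V q (Sum.inr A) (R, transition (𝓡 m) p q y) := by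
    simp only [h2, Finset.sum_mul, Finset.mul_sum]
    rw [Finset.sum_comm]
    refine Finset.sum_congr rfl fun A _ => ?_
    rw [mul_left_comm, ← h1, Finset.mul_sum]
    exact Finset.sum_congr rfl fun B _ => by ring
  rw [h4, mul_div_mul_left _ _ h3]

/-- The radial component and `√det h` scale by the same `|det J|`, so their quotient may be computed
in any chart. -/
lemma fluxDensity_eq (hg : IsEndMetric g r₀) (hb : IsEndMetric b r₀)
    (hV : ContMDiffOn (modelEnd m) 𝓘(ℝ, ℝ) 2 V (endSet N r₀)) {p : N} {R : ℝ} {y : ModelN m}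
    (hR : r₀ < R) (hy : y ∈ (extChartAt (𝓡 m) p).target) :
    fluxDensity (fun x u v => h.inner x u v) g b V R ((extChartAt (𝓡 m) p).symm y) =
      endMass g b V p (Sum.inl ()) (R, y) /
        Real.sqrt (localForm (𝓡 m) (basisN m) (fun x u v => h.inner x u v) p y).det := by
  have hs := IsEndMetric.mem_transitionDomain_self hy
  have hc := isCoordChangeAt_riemannian h hs
  rw [(endMass_transition hg hb hV hR hs).1, hc.sqrt_det_eq,
    mul_div_mul_left _ _ (abs_ne_zero.2 hc.det_ne)]
  rfl

end MassTransition

end EndTransition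

/-! ### Entrywise bounds on matrix fields with one weight per index. -/

section Weights

open Matrix

variable {Z : Type*} {ι : Type*} [Fintype ι] [DecidableEq ι] {l : Filter Z}

/-- The entries of the matrix field `M` satisfy `Mᵢⱼ = O(f αᵢ βⱼ)`. -/
def WeightedO (l : Filter Z) (f : Z → ℝ) (α β : ι → Z → ℝ) (M : Z → Matrix ι ι ℝ) : Prop :=
  ∀ i j, (fun z => M z i j) =O[l] fun z => f z * (α i z * β j z)

namespace WeightedO

variable {f g : Z → ℝ} {α β β' γ : ι → Z → ℝ} {M N : Z → Matrix ι ι ℝ}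

lemma congr_left (hM : WeightedO l f α β M) (hMN : ∀ᶠ z in l, M z = N z) : WeightedO l f α β N :=
  fun i j => (hM i j).congr' (hMN.mono fun _ hz => congrFun (congrFun hz i) j) EventuallyEq.rfl

lemma congr_weight (hM : WeightedO l f α β M) (hfg : ∀ z, f z = g z) : WeightedO l g α β M := by
  rwa [← funext hfg]

lemma add (hM : WeightedO l f α β M) (hN : WeightedO l f α β N) :
    WeightedO l f α β (fun z => M z + N z) := fun i j => (hM i j).add (hN i j)

lemma sub (hM : WeightedO l f α β M) (hN : WeightedO l f α β N) :
    WeightedO l f α β (fun z => M z - N z) := fun i j => (hM i j).sub (hN i j)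

lemma neg (hM : WeightedO l f α β M) : WeightedO l f α β (fun z => -M z) :=
  fun i j => (hM i j).neg_left

lemma smul {u : Z → ℝ} (hu : u =O[l] g) (hM : WeightedO l f α β M) :
    WeightedO l (fun z => g z * f z) α β (fun z => u z • M z) := fun i j =>
  (hu.mul (hM i j)).congr_right fun _ => (mul_assoc _ _ _).symm

lemma transpose (hM : WeightedO l f α β M) : WeightedO l f β α (fun z => (M z).transpose) :=
  fun i j => (hM j i).congr_right fun z => by ring

/-- The weights of the contracted index are mutually inverse and cancel. A contravariant index
carries `w` and a covariant one `w⁻¹`, so estimates of contractions become bookkeeping with the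
scalar factors. -/
lemma mul (hM : WeightedO l f α β M) (hN : WeightedO l g β' γ N)
    (hβ : ∀ j, ∀ᶠ z in l, β j z * β' j z = 1) :
    WeightedO l (fun z => f z * g z) α γ (fun z => M z * N z) := by
  intro i k
  simp only [Matrix.mul_apply]
  refine IsBigO.fun_sum fun j _ => ?_
  refine ((hM i j).mul (hN j k)).congr' EventuallyEq.rfl ?_
  filter_upwards [hβ j] with z hz
  linear_combination f z * g z * α i z * γ k z * hz

lemma trace (hM : WeightedO l f α β M) (hβ : ∀ j, ∀ᶠ z in l, α j z * β j z = 1) :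
    (fun z => (M z).trace) =O[l] f := by
  simp only [Matrix.trace, Matrix.diag]
  refine IsBigO.fun_sum fun j _ => (hM j j).congr' EventuallyEq.rfl ?_
  filter_upwards [hβ j] with z hz
  rw [hz, mul_one]

lemma mulVec (hM : WeightedO l f α β M) {v : Z → ι → ℝ}
    (hv : ∀ j, (fun z => v z j) =O[l] fun z => g z * β' j z)
    (hβ : ∀ j, ∀ᶠ z in l, β j z * β' j z = 1) (i : ι) :
    (fun z => (M z *ᵥ v z) i) =O[l] fun z => f z * g z * α i z := by
  simp only [Matrix.mulVec, dotProduct]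
  refine IsBigO.fun_sum fun j _ => ((hM i j).mul (hv j)).congr' EventuallyEq.rfl ?_
  filter_upwards [hβ j] with z hz
  linear_combination f z * g z * α i z * hz

end WeightedO

variable {w : ι → Z → ℝ}

lemma eventually_mul_inv (hw : ∀ i, ∀ᶠ z in l, w i z ≠ 0) (j : ι) :
    ∀ᶠ z in l, w j z * w⁻¹ j z = 1 := by
  filter_upwards [hw j] with z hz using mul_inv_cancel₀ hz

lemma eventually_inv_mul (hw : ∀ i, ∀ᶠ z in l, w i z ≠ 0) (j : ι) :
    ∀ᶠ z in l, w⁻¹ j z * w j z = 1 := by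
  filter_upwards [hw j] with z hz using inv_mul_cancel₀ hz

end Weights

/-! ### The weighted bound on the quadratic remainder. -/

section WeightedRemainder

open Matrix

variable {E : Type*} [NormedAddCommGroup E] [NormedSpace ℝ E]
  {ι : Type*} [Fintype ι] [DecidableEq ι] {l : Filter E} {w : ι → E → ℝ} {G B : E → Matrix ι ι ℝ}
  {V : E → ℝ} {ρ t : E → ℝ}

/-- Every term contains exactly two factors from `G - B` and `connDiff`, each of size `ρ`, together
with one factor `V` or `dV` of size `t`. The other tensors are bounded, and in a full contraction
all the weights cancel. -/
lemma massRemainder_isBigO (e : Module.Basis ι ℝ E) (hw : ∀ i, ∀ᶠ z in l, w i z ≠ 0)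
    (hgi : WeightedO l 1 w w fun z => (G z)⁻¹)
    (hD : WeightedO l ρ w⁻¹ w⁻¹ fun z => G z - B z)
    (hC : ∀ i, WeightedO l (fun z => ρ z * w⁻¹ i z) w w⁻¹ fun z => connDiff e G B i z)
    (hM : WeightedO l 1 w w⁻¹ fun z =>
      (B z)⁻¹ * ((ricMat e B z).transpose + (Fintype.card ι : ℝ) • B z))
    (hV : V =O[l] t) (hv : ∀ i, (fun z => pd e i V z) =O[l] fun z => t z * w⁻¹ i z) :
    massRemainder e G B V =O[l] fun z => t z * ρ z ^ 2 := by
  have h1 := eventually_mul_inv hw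
  have h2 := eventually_inv_mul hw
  have hgD := hgi.mul hD h1
  have hgDM := hgD.mul hM h2
  have hgDgDM := hgD.mul hgDM h2
  have q1 : (fun z => V z * (((G z)⁻¹ * (G z - B z) * ((G z)⁻¹ * (G z - B z) * ((B z)⁻¹ *
      ((ricMat e B z).transpose + (Fintype.card ι : ℝ) • B z)))).trace -
      ((G z)⁻¹ * (G z - B z)).trace * ((G z)⁻¹ * (G z - B z) * ((B z)⁻¹ *
      ((ricMat e B z).transpose + (Fintype.card ι : ℝ) • B z))).trace)) =O[l]
      fun z => t z * ρ z ^ 2 := by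
    have a1 := (hgDgDM.trace h1).congr_right (g₂ := fun z => ρ z ^ 2) fun z => by
      simp only [Pi.one_apply]; ring
    have a2 := ((hgD.trace h1).mul (hgDM.trace h1)).congr_right (g₂ := fun z => ρ z ^ 2) fun z => by
      simp only [Pi.one_apply]; ring
    exact hV.mul (a1.sub a2)
  have q2 : (fun z => V z * ∑ j, ∑ k, (G z)⁻¹ j k * ∑ i, ∑ a, (connDiff e G B j z i a *
      connDiff e G B k z a i - connDiff e G B a z i i * connDiff e G B j z a k)) =O[l]
      fun z => t z * ρ z ^ 2 := by
    refine hV.mul (IsBigO.fun_sum fun j _ => IsBigO.fun_sum fun k _ => ?_)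
    refine ((hgi j k).mul (IsBigO.fun_sum (g := fun z => ρ z ^ 2 * (w⁻¹ j z * w⁻¹ k z)) fun i _ =>
      IsBigO.fun_sum fun a _ => ?_)).congr' EventuallyEq.rfl ?_
    · refine (((hC j i a).mul (hC k a i)).congr' EventuallyEq.rfl ?_).sub
        (((hC a i i).mul (hC j a k)).congr' EventuallyEq.rfl ?_)
      · filter_upwards [h1 i, h1 a] with z hi ha
        linear_combination (ρ z ^ 2 * w⁻¹ j z * w⁻¹ k z * w⁻¹ a z * w a z) * hi +
          (ρ z ^ 2 * w⁻¹ j z * w⁻¹ k z) * ha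
      · filter_upwards [h1 i, h1 a] with z hi ha
        linear_combination (ρ z ^ 2 * w⁻¹ j z * w⁻¹ k z * w⁻¹ a z * w a z) * hi +
          (ρ z ^ 2 * w⁻¹ j z * w⁻¹ k z) * ha
    · filter_upwards [h1 j, h1 k] with z hj hk
      simp only [Pi.one_apply]
      linear_combination (ρ z ^ 2 * w⁻¹ k z * w k z) * hj + ρ z ^ 2 * hk
  refine (q1.sub q2).add (IsBigO.fun_sum fun i _ => ?_)
  have hCi := hC i
  have hx : ∀ j, (fun z => (-(2 * (connDiff e G B i z * (G z)⁻¹ * (G z - B z)).trace) • pdVec e V z -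
      ((G z)⁻¹ * (G z - B z)).trace • ((connDiff e G B i z).transpose *ᵥ pdVec e V z)
      + ((G z - B z) * (G z)⁻¹ * (connDiff e G B i z).transpose +
        (connDiff e G B i z).transpose * (G z - B z) * (G z)⁻¹ +
        (G z - B z) * connDiff e G B i z * (G z)⁻¹) *ᵥ pdVec e V z) j) =O[l]
      fun z => ρ z ^ 2 * t z * w⁻¹ i z * w⁻¹ j z := by
    intro j
    have a1 := ((hCi.mul hgi h2).mul hD h1).trace h1
    have a2 := hCi.transpose.mulVec hv h1 j
    have b1 := ((hD.mul hgi h2).mul hCi.transpose h1).congr_weight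
      (g := fun z => ρ z ^ 2 * w⁻¹ i z) fun z => by simp only [Pi.one_apply]; ring
    have b2 := ((hCi.transpose.mul hD h1).mul hgi h2).congr_weight
      (g := fun z => ρ z ^ 2 * w⁻¹ i z) fun z => by simp only [Pi.one_apply]; ring
    have b3 := ((hD.mul hCi h2).mul hgi h2).congr_weight
      (g := fun z => ρ z ^ 2 * w⁻¹ i z) fun z => by simp only [Pi.one_apply]; ring
    have a4 := ((b1.add b2).add b3).mulVec hv h1 j
    simp only [Pi.add_apply, Pi.sub_apply, Pi.smul_apply, smul_eq_mul]
    refine (((((a1.const_mul_left 2).neg_left).mul (hv j)).congr_right fun z => ?_).sub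
      (((hgD.trace h1).mul a2).congr_right fun z => ?_)).add (a4.congr_right fun z => ?_)
    all_goals (try simp only [Pi.one_apply]); ring
  simp only [dotProduct]
  refine IsBigO.fun_sum fun j _ => ((hgi i j).mul (hx j)).congr' EventuallyEq.rfl ?_
  filter_upwards [h1 i, h1 j] with z hi hj
  simp only [Pi.one_apply]
  linear_combination (ρ z ^ 2 * t z * w⁻¹ j z * w j z) * hi + ρ z ^ 2 * t z * hj

end WeightedRemainder

/-! ### Weighted bounds on inverse metrics, connections and curvature. -/

section WeightedMetric

open Matrix

variable {E : Type*} [NormedAddCommGroup E] [NormedSpace ℝ E]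
  {ι : Type*} [Fintype ι] [DecidableEq ι] {l : Filter E} {w : ι → E → ℝ} {G B : E → Matrix ι ι ℝ}
  {V : E → ℝ} {ρ t : E → ℝ}

/-- The inverse of a matrix which is bounded from below. -/
lemma abs_inv_apply_le {A : Matrix ι ι ℝ} (hA : A * A⁻¹ = 1) {u : ι → ℝ}
    (hu : ∀ i, 0 < u i) {c : ℝ} (hc : 0 < c)
    (h : ∀ v : ι → ℝ, c * ∑ i, (v i / u i) ^ 2 ≤ v ⬝ᵥ (A *ᵥ v)) (i j : ι) :
    |A⁻¹ i j| ≤ c⁻¹ * (u i * u j) := by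
  -- For the `j`-th column `v` of the inverse, `A v` is the `j`-th basis vector, so coercivity reads
  -- `c ∑ (vₐ/uₐ)² ≤ vⱼ`. The summand `a = j` bounds `vⱼ` by `c⁻¹ uⱼ²`; the summand `a = i` then
  -- bounds `vᵢ`.
  set v : ι → ℝ := fun a => A⁻¹ a j with hv
  have hAv : A *ᵥ v = Pi.single j 1 := by
    ext a
    have := congrFun (congrFun hA a) j
    rw [Matrix.mul_apply] at this
    simp only [Matrix.mulVec, dotProduct, hv, this, Matrix.one_apply, Pi.single_apply]
  have h1 := h v
  rw [hAv, dotProduct_single, mul_one] at h1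
  have h2 : ∀ a, c * (v a / u a) ^ 2 ≤ v j := fun a =>
    le_trans (mul_le_mul_of_nonneg_left
      (Finset.single_le_sum (f := fun i => (v i / u i) ^ 2) (fun i _ => sq_nonneg _)
        (Finset.mem_univ a)) hc.le) h1
  have h0 : 0 ≤ v j := le_trans (by positivity) (h2 j)
  have huj := hu j
  have h3 : v j ≤ c⁻¹ * u j ^ 2 := by
    have h4 := h2 j
    rw [div_pow] at h4
    have h5 : c * v j ^ 2 ≤ v j * u j ^ 2 := by
      have := mul_le_mul_of_nonneg_right h4 (sq_nonneg (u j))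
      rwa [mul_assoc, div_mul_cancel₀ _ (by positivity)] at this
    rcases h0.eq_or_lt with h6 | h6
    · rw [← h6]; positivity
    · have h7 : c * v j ≤ u j ^ 2 := by nlinarith
      rw [inv_mul_eq_div, le_div_iff₀ hc]; linarith
  have hui := hu i
  have h8 : c * v i ^ 2 ≤ c⁻¹ * u j ^ 2 * u i ^ 2 := by
    have h4 := (h2 i).trans h3
    rw [div_pow] at h4
    have := mul_le_mul_of_nonneg_right h4 (sq_nonneg (u i))
    rwa [mul_assoc, div_mul_cancel₀ _ (by positivity)] at this
  have h9 : v i ^ 2 ≤ (c⁻¹ * (u i * u j)) ^ 2 := by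
    have := mul_le_mul_of_nonneg_left h8 (inv_pos.2 hc).le
    rw [← mul_assoc, inv_mul_cancel₀ hc.ne', one_mul] at this
    refine this.trans (le_of_eq ?_)
    ring
  exact abs_le_of_sq_le_sq h9 (by positivity)

/-- The inverse of a metric which is bounded from below by `∑ᵢ (vⁱ / wᵢ)²`. -/
lemma weightedO_inv (hw : ∀ i, ∀ᶠ z in l, 0 < w i z) (hG : ∀ᶠ z in l, G z * (G z)⁻¹ = 1)
    {c : ℝ} (hc : 0 < c)
    (h : ∀ᶠ z in l, ∀ v : ι → ℝ, c * ∑ i, (v i / w i z) ^ 2 ≤ v ⬝ᵥ (G z *ᵥ v)) :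
    WeightedO l 1 w w fun z => (G z)⁻¹ := by
  intro i j
  refine IsBigO.of_bound c⁻¹ ?_
  filter_upwards [hG, h, eventually_all.2 hw] with z h1 h2 h3
  have h4 := h3 i
  have h5 := h3 j
  rw [Real.norm_eq_abs, Real.norm_eq_abs, Pi.one_apply, one_mul, abs_of_pos (mul_pos h4 h5)]
  exact abs_inv_apply_le h1 h3 hc h2 i j

lemma christoffel_isBigO (e : Module.Basis ι ℝ E) (hw : ∀ i, ∀ᶠ z in l, w i z ≠ 0)
    (hbi : WeightedO l 1 w w fun z => (B z)⁻¹)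
    (hdB : ∀ k, WeightedO l (w⁻¹ k) w⁻¹ w⁻¹ fun z => pdMat e k B z) (k i j : ι) :
    christoffel e B k i j =O[l] fun z => w k z * (w⁻¹ i z * w⁻¹ j z) := by
  have h1 := eventually_mul_inv hw
  refine IsBigO.const_mul_left (IsBigO.fun_sum fun a _ => ?_) _
  have d1 := hdB i a j
  have d2 := (hdB j a i).congr_right (g₂ := fun z => w⁻¹ i z * (w⁻¹ a z * w⁻¹ j z)) fun z => by ring
  have d3 := (hdB a i j).congr_right (g₂ := fun z => w⁻¹ i z * (w⁻¹ a z * w⁻¹ j z)) fun z => by ring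
  refine ((hbi k a).mul ((d1.add d2).sub d3)).congr' EventuallyEq.rfl ?_
  filter_upwards [h1 a] with z ha
  simp only [Pi.one_apply]
  linear_combination (w k z * w⁻¹ i z * w⁻¹ j z) * ha

lemma weightedO_connMat (e : Module.Basis ι ℝ E) (hw : ∀ i, ∀ᶠ z in l, w i z ≠ 0)
    (hbi : WeightedO l 1 w w fun z => (B z)⁻¹)
    (hdB : ∀ k, WeightedO l (w⁻¹ k) w⁻¹ w⁻¹ fun z => pdMat e k B z) (k : ι) :
    WeightedO l (w⁻¹ k) w w⁻¹ fun z => connMat e B k z := fun i j =>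
  (christoffel_isBigO e hw hbi hdB i k j).congr_right fun z => by ring

lemma pd_christoffel_isBigO (e : Module.Basis ι ℝ E) (hw : ∀ i, ∀ᶠ z in l, w i z ≠ 0)
    (hB : ∀ᶠ z in l, IsMetricAt B z)
    (hbi : WeightedO l 1 w w fun z => (B z)⁻¹)
    (hdB : ∀ k, WeightedO l (w⁻¹ k) w⁻¹ w⁻¹ fun z => pdMat e k B z)
    (hddB : ∀ p k i j, (fun z => pd e p (pd e k fun y => B y i j) z) =O[l]
      fun z => w⁻¹ p z * w⁻¹ k z * (w⁻¹ i z * w⁻¹ j z)) (p k i j : ι) :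
    (fun z => pd e p (christoffel e B k i j) z) =O[l]
      fun z => w⁻¹ p z * (w k z * (w⁻¹ i z * w⁻¹ j z)) := by
  have h1 := eventually_mul_inv hw
  have h2 := eventually_inv_mul hw
  have hA := weightedO_connMat e hw hbi hdB p
  have hdbi : WeightedO l (w⁻¹ p) w w fun z => pdMat e p (fun z => (B z)⁻¹) z := by
    have a1 := (hA.mul hbi h2).congr_weight (g := w⁻¹ p) fun z => by simp
    have a2 := (hbi.mul hA.transpose h1).congr_weight (g := w⁻¹ p) fun z => by simp
    exact (a1.neg.sub a2).congr_left (hB.mono fun z hz => (hz.pdMat_inv e p).symm)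
  have hterm : (fun z => (1 / 2) * ∑ a, (pd e p (fun y => (B y)⁻¹ k a) z *
      (pd e i (fun y => B y a j) z + pd e j (fun y => B y a i) z - pd e a (fun y => B y i j) z)
      + (B z)⁻¹ k a * (pd e p (pd e i fun y => B y a j) z + pd e p (pd e j fun y => B y a i) z
        - pd e p (pd e a fun y => B y i j) z))) =O[l]
      fun z => w⁻¹ p z * (w k z * (w⁻¹ i z * w⁻¹ j z)) := by
    refine IsBigO.const_mul_left (IsBigO.fun_sum fun a _ => ?_) _
    have d1 := hdB i a j
    have d2 := (hdB j a i).congr_right (g₂ := fun z => w⁻¹ i z * (w⁻¹ a z * w⁻¹ j z)) fun z => by ring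
    have d3 := (hdB a i j).congr_right (g₂ := fun z => w⁻¹ i z * (w⁻¹ a z * w⁻¹ j z)) fun z => by ring
    have f1 := (hddB p i a j).congr_right
      (g₂ := fun z => w⁻¹ p z * (w⁻¹ i z * (w⁻¹ a z * w⁻¹ j z))) fun z => by ring
    have f2 := (hddB p j a i).congr_right
      (g₂ := fun z => w⁻¹ p z * (w⁻¹ i z * (w⁻¹ a z * w⁻¹ j z))) fun z => by ring
    have f3 := (hddB p a i j).congr_right
      (g₂ := fun z => w⁻¹ p z * (w⁻¹ i z * (w⁻¹ a z * w⁻¹ j z))) fun z => by ring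
    refine (((hdbi k a).mul ((d1.add d2).sub d3)).congr' EventuallyEq.rfl ?_).add
      (((hbi k a).mul ((f1.add f2).sub f3)).congr' EventuallyEq.rfl ?_)
    · filter_upwards [h1 a] with z ha
      linear_combination (w⁻¹ p z * w k z * w⁻¹ i z * w⁻¹ j z) * ha
    · filter_upwards [h1 a] with z ha
      simp only [Pi.one_apply]
      linear_combination (w⁻¹ p z * w k z * w⁻¹ i z * w⁻¹ j z) * ha
  refine hterm.congr' ?_ EventuallyEq.rfl
  filter_upwards [hB] with z hz
  have hp : ∀ a b c, DifferentiableAt ℝ (pd e a fun y => B y b c) z := fun a b c =>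
    differentiableAt_pd (hz.contDiff b c) e a
  have hs : ∀ a, DifferentiableAt ℝ (fun y => pd e i (fun y => B y a j) y +
      pd e j (fun y => B y a i) y - pd e a (fun y => B y i j) y) z := fun a =>
    ((hp i a j).fun_add (hp j a i)).fun_sub (hp a i j)
  have hc : christoffel e B k i j = fun y => (1 / 2) * ∑ a, (B y)⁻¹ k a *
      (pd e i (fun y => B y a j) y + pd e j (fun y => B y a i) y - pd e a (fun y => B y i j) y) := rfl
  rw [hc, pd_const_mul e p _ (DifferentiableAt.fun_sum fun a _ => (hz.matDiffAt_inv k a).fun_mul (hs a)),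
    pd_sum _ _ _ fun a _ => (hz.matDiffAt_inv k a).fun_mul (hs a)]
  congr 1
  refine Finset.sum_congr rfl fun a _ => ?_
  rw [pd_mul e p (hz.matDiffAt_inv k a) (hs a), pd_sub e p ((hp i a j).fun_add (hp j a i)) (hp a i j),
    pd_add e p (hp i a j) (hp j a i)]

/-- With weighted bounds on the first two derivatives of the components, each term of the Ricci
tensor has the weights of a covariant 2-tensor; in frame terms the Ricci tensor of the reference
metric is bounded. -/
lemma weightedO_ricMat (e : Module.Basis ι ℝ E) (hw : ∀ i, ∀ᶠ z in l, w i z ≠ 0)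
    (hB : ∀ᶠ z in l, IsMetricAt B z)
    (hbi : WeightedO l 1 w w fun z => (B z)⁻¹)
    (hdB : ∀ k, WeightedO l (w⁻¹ k) w⁻¹ w⁻¹ fun z => pdMat e k B z)
    (hddB : ∀ p k i j, (fun z => pd e p (pd e k fun y => B y i j) z) =O[l]
      fun z => w⁻¹ p z * w⁻¹ k z * (w⁻¹ i z * w⁻¹ j z)) :
    WeightedO l 1 w⁻¹ w⁻¹ fun z => ricMat e B z := by
  have h1 := eventually_mul_inv hw
  have hΓ := christoffel_isBigO e hw hbi hdB
  have hdΓ := pd_christoffel_isBigO e hw hB hbi hdB hddB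
  intro i j
  refine (IsBigO.fun_sum fun k _ => ?_).add (IsBigO.fun_sum fun k _ => IsBigO.fun_sum fun a _ => ?_)
  · refine ((hdΓ k k i j).congr' EventuallyEq.rfl ?_).sub ((hdΓ j k k i).congr' EventuallyEq.rfl ?_)
    · filter_upwards [h1 k] with z hz
      simp only [Pi.one_apply]
      linear_combination (w⁻¹ i z * w⁻¹ j z) * hz
    · filter_upwards [h1 k] with z hz
      simp only [Pi.one_apply]
      linear_combination (w⁻¹ i z * w⁻¹ j z) * hz
  · refine (((hΓ k k a).mul (hΓ a i j)).congr' EventuallyEq.rfl ?_).sub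
      (((hΓ k j a).mul (hΓ a k i)).congr' EventuallyEq.rfl ?_)
    · filter_upwards [h1 k, h1 a] with z hk ha
      simp only [Pi.one_apply]
      linear_combination (w⁻¹ i z * w⁻¹ j z * w a z * w⁻¹ a z) * hk + (w⁻¹ i z * w⁻¹ j z) * ha
    · filter_upwards [h1 k, h1 a] with z hk ha
      simp only [Pi.one_apply]
      linear_combination (w⁻¹ i z * w⁻¹ j z * w a z * w⁻¹ a z) * hk + (w⁻¹ i z * w⁻¹ j z) * ha

/-- Koszul's formula for the difference tensor: the bracket is `D̊ₐ e`, which equals `D̊ₐ g` because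
`b` is parallel, and `C` is recovered from it just as Christoffel symbols are from `∂g`. -/
lemma mul_connDiff {y : E} (hG : IsMetricAt G y) (hB : IsMetricAt B y) (e : Module.Basis ι ℝ E) (k i j : ι) :
    2 * (G y * connDiff e G B k y) i j =
      (fun a => pdMat e a (fun z => G z - B z) y - (connMat e B a y).transpose * (G y - B y) -
        (G y - B y) * connMat e B a y) k i j +
      (fun a => pdMat e a (fun z => G z - B z) y - (connMat e B a y).transpose * (G y - B y) -
        (G y - B y) * connMat e B a y) j i k -
      (fun a => pdMat e a (fun z => G z - B z) y - (connMat e B a y).transpose * (G y - B y) -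
        (G y - B y) * connMat e B a y) i k j := by
  have h1 : ∀ a, pdMat e a (fun z => G z - B z) y - (connMat e B a y).transpose * (G y - B y) -
        (G y - B y) * connMat e B a y =
      (G y * connDiff e G B a y).transpose + G y * connDiff e G B a y := by
    intro a
    rw [pdMat_sub e a hG.matDiffAt hB.matDiffAt, hG.pdMat_eq, hB.pdMat_eq, connDiff,
      Matrix.transpose_mul, Matrix.transpose_sub, hG.symm_self]
    noncomm_ring
  have h2 : ∀ a b c, (G y * connDiff e G B a y) b c = (G y * connDiff e G B c y) b a := by
    intro a b c
    simp only [Matrix.mul_apply]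
    exact Finset.sum_congr rfl fun d _ => by rw [connDiff_comm hG hB]
  simp only [h1, Matrix.add_apply, Matrix.transpose_apply]
  rw [h2 j i k, h2 k j i, h2 j k i]
  ring

/-- By `mul_connDiff`, `C` is `g⁻¹` applied to a combination of covariant derivatives of `e`. These
are of size `ρ` because `∂e` is, and because the reference connection is bounded in the weights. -/
lemma weightedO_connDiff (e : Module.Basis ι ℝ E) (hw : ∀ i, ∀ᶠ z in l, w i z ≠ 0)
    (hG : ∀ᶠ z in l, IsMetricAt G z) (hB : ∀ᶠ z in l, IsMetricAt B z)
    (hgi : WeightedO l 1 w w fun z => (G z)⁻¹)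
    (hA : ∀ k, WeightedO l (w⁻¹ k) w w⁻¹ fun z => connMat e B k z)
    (hD : WeightedO l ρ w⁻¹ w⁻¹ fun z => G z - B z)
    (hdD : ∀ k, WeightedO l (fun z => ρ z * w⁻¹ k z) w⁻¹ w⁻¹
      fun z => pdMat e k (fun z => G z - B z) z) (k : ι) :
    WeightedO l (fun z => ρ z * w⁻¹ k z) w w⁻¹ fun z => connDiff e G B k z := by
  have h1 := eventually_mul_inv hw
  have h2 := eventually_inv_mul hw
  have hE : ∀ k, WeightedO l (fun z => ρ z * w⁻¹ k z) w⁻¹ w⁻¹ fun z =>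
      pdMat e k (fun z => G z - B z) z - (connMat e B k z).transpose * (G z - B z) -
        (G z - B z) * connMat e B k z := fun k =>
    ((hdD k).sub (((hA k).transpose.mul hD h1).congr_weight fun z => by ring)).sub
      (((hD.mul (hA k) h2).congr_weight fun z => by ring))
  have hS : WeightedO l (fun z => ρ z * w⁻¹ k z) w⁻¹ w⁻¹ fun z => G z * connDiff e G B k z := by
    intro i j
    have d1 := hE k i j
    have d2 := (hE j i k).congr_right (g₂ := fun z => ρ z * w⁻¹ k z * (w⁻¹ i z * w⁻¹ j z))
      fun z => by ring
    have d3 := (hE i k j).congr_right (g₂ := fun z => ρ z * w⁻¹ k z * (w⁻¹ i z * w⁻¹ j z))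
      fun z => by ring
    refine (((d1.add d2).sub d3).const_mul_left (1 / 2)).congr' ?_ EventuallyEq.rfl
    filter_upwards [hG, hB] with z hGz hBz
    linear_combination (-1 / 2) * mul_connDiff hGz hBz e k i j
  refine ((hgi.mul hS h1).congr_weight fun z => ?_).congr_left ?_
  · simp
  · filter_upwards [hG] with z hz
    rw [← Matrix.mul_assoc, hz.inv_mul, Matrix.one_mul]

end WeightedMetric

/-! ### From bounds in an orthonormal frame to weighted bounds on components. -/

section WeightedFrame

open Matrix

variable {E : Type*} [NormedAddCommGroup E] [NormedSpace ℝ E]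
  {ι : Type*} [Fintype ι] [DecidableEq ι] {l : Filter E} {w : ι → E → ℝ}
  {G B F : E → Matrix ι ι ℝ} {V : E → ℝ} {ρ t : E → ℝ}

/-- Orthonormality says that the coframe `Fᵀ B` is a left inverse of `F`; for square matrices it is
then a right inverse too, which permits passing back from frame to coordinate components. -/
lemma frame_mul_coframe {F B : Matrix ι ι ℝ} (h : F.transpose * B * F = 1) :
    F * (F.transpose * B) = 1 := mul_eq_one_comm.1 h

lemma coframe_transpose_mul {F B : Matrix ι ι ℝ} (h : F.transpose * B * F = 1)
    (G : Matrix ι ι ℝ) :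
    (F.transpose * B).transpose * (F.transpose * G * F) * (F.transpose * B) = G := by
  have h1 := frame_mul_coframe h
  have h2 : (F.transpose * B).transpose * F.transpose = 1 := by
    rw [← Matrix.transpose_mul, h1, Matrix.transpose_one]
  calc (F.transpose * B).transpose * (F.transpose * G * F) * (F.transpose * B)
      = ((F.transpose * B).transpose * F.transpose) * G * (F * (F.transpose * B)) := by
        simp only [Matrix.mul_assoc]
    _ = G := by rw [h1, h2, Matrix.one_mul, Matrix.mul_one]

/-- A metric with an orthonormal frame of size `w` is bounded from below by `∑ᵢ (vⁱ / wᵢ)²`. -/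
lemma exists_coercive (hw : ∀ i, ∀ᶠ z in l, 0 < w i z) (hBs : ∀ᶠ z in l, (B z).IsSymm)
    (hF : ∀ᶠ z in l, (F z).transpose * B z * F z = 1) (hFO : WeightedO l 1 w 1 F) :
    ∃ c > 0, ∀ᶠ z in l, ∀ v : ι → ℝ, c * ∑ i, (v i / w i z) ^ 2 ≤ v ⬝ᵥ (B z *ᵥ v) := by
  choose K hK using fun i j => (hFO i j).bound
  -- With `v = F x` and `B(v, v) = |x|²`, Cauchy–Schwarz bounds `∑ (vᵢ/wᵢ)²` by the sum of the
  -- squared frame bounds times `|x|²`. The added 1 keeps the constant positive.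
  set S : ℝ := 1 + ∑ i, ∑ j, |K i j| ^ 2 with hS
  have hS0 : 0 < S := by positivity
  refine ⟨S⁻¹, inv_pos.2 hS0, ?_⟩
  filter_upwards [eventually_all.2 hw, hBs, hF,
    eventually_all.2 fun i => eventually_all.2 fun j => hK i j] with z hwz hBz hFz hKz v
  set x : ι → ℝ := ((F z).transpose * B z) *ᵥ v with hx
  have hv : v = F z *ᵥ x := by
    rw [hx, Matrix.mulVec_mulVec, frame_mul_coframe hFz, Matrix.one_mulVec]
  have hq : v ⬝ᵥ (B z *ᵥ v) = x ⬝ᵥ x := by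
    nth_rewrite 1 [hv]
    rw [← Matrix.vecMul_transpose, ← Matrix.dotProduct_mulVec, Matrix.mulVec_mulVec, ← hx]
  have h1 : ∀ i, (v i / w i z) ^ 2 ≤ (∑ j, |K i j| ^ 2) * (x ⬝ᵥ x) := by
    intro i
    have h2 : v i / w i z = ∑ j, (F z i j / w i z) * x j := by
      rw [hv]
      simp only [Matrix.mulVec, dotProduct, Finset.sum_div]
      exact Finset.sum_congr rfl fun j _ => by ring
    rw [h2]
    refine (Finset.sum_mul_sq_le_sq_mul_sq _ _ _).trans ?_
    have h4 : x ⬝ᵥ x = ∑ j, x j ^ 2 := by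
      simp only [dotProduct, sq]
    rw [h4]
    refine mul_le_mul_of_nonneg_right ?_ (Finset.sum_nonneg fun _ _ => sq_nonneg _)
    refine Finset.sum_le_sum fun j _ => ?_
    rw [← sq_abs]
    refine pow_le_pow_left₀ (abs_nonneg _) ?_ 2
    rw [abs_div, div_le_iff₀ (abs_pos.2 (hwz i).ne')]
    have := hKz i j
    rw [Real.norm_eq_abs, Real.norm_eq_abs] at this
    refine this.trans ?_
    simp only [Pi.one_apply, one_mul, mul_one]
    exact mul_le_mul_of_nonneg_right (le_abs_self _) (abs_nonneg _)
  have hxx : 0 ≤ x ⬝ᵥ x := by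
    simp only [dotProduct]; exact Finset.sum_nonneg fun _ _ => mul_self_nonneg _
  rw [hq, inv_mul_le_iff₀ hS0]
  calc ∑ i, (v i / w i z) ^ 2 ≤ ∑ i, (∑ j, |K i j| ^ 2) * (x ⬝ᵥ x) :=
        Finset.sum_le_sum fun i _ => h1 i
    _ = (∑ i, ∑ j, |K i j| ^ 2) * (x ⬝ᵥ x) := (Finset.sum_mul _ _ _).symm
    _ ≤ S * (x ⬝ᵥ x) := mul_le_mul_of_nonneg_right (by rw [hS]; linarith) hxx

/-- Since `B⁻¹ = F Fᵀ`, the norm of `dV` is the Euclidean norm of its frame components `Fᵀ dV`, and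
the coframe converts these into coordinate derivatives. -/
lemma pd_isBigO_of_gradNorm (e : Module.Basis ι ℝ E) (hB : ∀ᶠ z in l, IsMetricAt B z)
    (hF : ∀ᶠ z in l, (F z).transpose * B z * F z = 1)
    (hL : WeightedO l 1 1 w⁻¹ fun z => (F z).transpose * B z)
    (hV : gradNorm e B V =O[l] t) (i : ι) :
    (fun z => pd e i V z) =O[l] fun z => t z * w⁻¹ i z := by
  have h1 : ∀ a, (fun z => ((F z).transpose *ᵥ pdVec e V z) a) =O[l]
      fun z => t z * (1 : ι → E → ℝ) a z := by
    intro a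
    simp only [Pi.one_apply, mul_one]
    refine IsBigO.trans (IsBigO.of_bound 1 ?_) hV
    filter_upwards [hF, hB] with z hz hBz
    have hbi : (B z)⁻¹ = F z * (F z).transpose := by
      refine Matrix.inv_eq_left_inv ?_
      rw [Matrix.mul_assoc]
      exact frame_mul_coframe hz
    set x := (F z).transpose *ᵥ pdVec e V z with hx
    have hg : gradNorm e B V z = Real.sqrt (∑ a, x a ^ 2) := by
      have : ∑ i, ∑ j, (B z)⁻¹ i j * pd e i V z * pd e j V z =
          pdVec e V z ⬝ᵥ ((B z)⁻¹ *ᵥ pdVec e V z) := by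
        simp only [dotProduct, Matrix.mulVec, Finset.mul_sum, pdVec]
        exact Finset.sum_congr rfl fun i _ => Finset.sum_congr rfl fun j _ => by ring
      rw [gradNorm, this, hbi, ← Matrix.mulVec_mulVec, Matrix.dotProduct_mulVec,
        ← Matrix.mulVec_transpose, ← hx]
      simp only [dotProduct, sq]
    rw [hg, one_mul, Real.norm_eq_abs, Real.norm_eq_abs, abs_of_nonneg (Real.sqrt_nonneg _)]
    refine Real.le_sqrt_of_sq_le ?_
    rw [sq_abs]
    exact Finset.single_le_sum (f := fun a => x a ^ 2) (fun _ _ => sq_nonneg _) (Finset.mem_univ a)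
  have h2 := hL.transpose.mulVec (g := t) (β' := 1) h1 (fun j => Eventually.of_forall fun z => by simp) i
  refine (h2.congr_right fun z => by simp).congr' ?_ EventuallyEq.rfl
  filter_upwards [hF] with z hz
  rw [Matrix.mulVec_mulVec, ← Matrix.transpose_mul, frame_mul_coframe hz, Matrix.transpose_one,
    Matrix.one_mulVec]
  rfl

/-- The quadratic remainder in the divergence of the mass vector, estimated in an orthonormal
frame. -/
theorem massRemainder_isBigO_of_frame (e : Module.Basis ι ℝ E) (hw : ∀ i, ∀ᶠ z in l, 0 < w i z)
    (hG : ∀ᶠ z in l, IsMetricAt G z) (hB : ∀ᶠ z in l, IsMetricAt B z)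
    (hF : ∀ᶠ z in l, ∀ᶠ y in 𝓝 z, (F y).transpose * B y * F y = 1)
    (hFd : ∀ᶠ z in l, MatDiffAt F z) (hFO : WeightedO l 1 w 1 F)
    (hdF : ∀ k, WeightedO l (w⁻¹ k) w 1 fun z => pdMat e k F z)
    (hBO : WeightedO l 1 w⁻¹ w⁻¹ B)
    (hdB : ∀ k, WeightedO l (w⁻¹ k) w⁻¹ w⁻¹ fun z => pdMat e k B z)
    (hddB : ∀ p k i j, (fun z => pd e p (pd e k fun y => B y i j) z) =O[l]
      fun z => w⁻¹ p z * w⁻¹ k z * (w⁻¹ i z * w⁻¹ j z))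
    {c : ℝ} (hc : 0 < c) (hGB : ∀ᶠ z in l, ∀ u : ι → ℝ, c * (u ⬝ᵥ (B z *ᵥ u)) ≤ u ⬝ᵥ (G z *ᵥ u))
    (hP : ∀ a b, (fun z => ((F z).transpose * G z * F z) a b - (1 : Matrix ι ι ℝ) a b) =O[l] ρ)
    (hdP : ∀ a b d, (fun z => ∑ i, F z i d *
      pd e i (fun y => ((F y).transpose * G y * F y) a b) z) =O[l] ρ)
    (hV : V =O[l] t) (hdV : gradNorm e B V =O[l] t) :
    massRemainder e G B V =O[l] fun z => t z * ρ z ^ 2 := by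
  have hw' : ∀ i, ∀ᶠ z in l, w i z ≠ 0 := fun i => (hw i).mono fun z hz => hz.ne'
  have h1 := eventually_mul_inv hw'
  have h2 := eventually_inv_mul hw'
  have h11 : ∀ j, ∀ᶠ z in l, (1 : ι → E → ℝ) j z * (1 : ι → E → ℝ) j z = 1 := fun j =>
    Eventually.of_forall fun z => by simp
  have hFs : ∀ᶠ z in l, (F z).transpose * B z * F z = 1 := hF.mono fun z hz => hz.self_of_nhds
  have hL : WeightedO l 1 1 w⁻¹ fun z => (F z).transpose * B z :=
    (hFO.transpose.mul hBO h1).congr_weight fun z => by simp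
  have hdL : ∀ k, WeightedO l (w⁻¹ k) 1 w⁻¹ fun z =>
      pdMat e k (fun z => (F z).transpose * B z) z := by
    intro k
    have a1 := ((hdF k).transpose.mul hBO h1).congr_weight (g := w⁻¹ k) fun z => by simp
    have a2 := (hFO.transpose.mul (hdB k) h1).congr_weight (g := w⁻¹ k) fun z => by simp
    refine (a1.add a2).congr_left ?_
    filter_upwards [hFd, hB] with z hz hBz
    rw [pdMat_mul e k hz.transpose hBz.matDiffAt, pdMat_transpose]
  obtain ⟨c', hc', hcoB⟩ := exists_coercive hw (hB.mono fun z hz => hz.symm_self) hFs hFO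
  have hbi : WeightedO l 1 w w fun z => (B z)⁻¹ :=
    weightedO_inv hw (hB.mono fun z hz => hz.mul_inv) hc' hcoB
  -- The frame makes `B` coercive with the weights, and the lower half of the equivalence of the
  -- metrics passes this on to `G`. Pointwise smallness of `G - B` is not available, so the inverse
  -- cannot be expanded in a series.
  have hgi : WeightedO l 1 w w fun z => (G z)⁻¹ := by
    refine weightedO_inv hw (hG.mono fun z hz => hz.mul_inv) (mul_pos hc hc') ?_
    filter_upwards [hcoB, hGB] with z hz hz' v
    rw [mul_assoc]
    exact (mul_le_mul_of_nonneg_left (hz v) hc.le).trans (hz' v)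
  have hPW : WeightedO l ρ 1 1 fun z => (F z).transpose * G z * F z - 1 := fun a b =>
    (hP a b).congr_right fun z => by simp
  have hdPW : ∀ k, WeightedO l (fun z => ρ z * w⁻¹ k z) 1 1
      fun z => pdMat e k (fun z => (F z).transpose * G z * F z - 1) z := by
    intro k a b
    -- A coordinate derivative is a combination of frame derivatives with coframe coefficients, `∂ₖ
    -- = ∑ Lᵈₖ f_d`; the coframe bound supplies the weight `w⁻¹ₖ`.
    have h3 : (fun z => ∑ d, ((F z).transpose * B z) d k * ∑ i, F z i d *
        pd e i (fun y => ((F y).transpose * G y * F y) a b) z) =O[l]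
        fun z => ρ z * w⁻¹ k z * ((1 : ι → E → ℝ) a z * (1 : ι → E → ℝ) b z) :=
      IsBigO.fun_sum fun d _ => ((hL d k).mul (hdP a b d)).congr_right fun z => by
        simp only [Pi.one_apply]; ring
    refine h3.congr' ?_ EventuallyEq.rfl
    filter_upwards [hFs, hFd, hG] with z hz hFz hGz
    have h4 : pdMat e k (fun z => (F z).transpose * G z * F z - 1) z a b =
        pd e k (fun y => ((F y).transpose * G y * F y) a b) z := by
      have h5 := ((hFz.transpose.mul hGz.matDiffAt).mul hFz) a b
      simp only [pdMat, Matrix.of_apply, Matrix.sub_apply]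
      rw [pd_sub e k h5 (differentiableAt_const _), pd_const, sub_zero]
    rw [h4]
    simp only [Finset.mul_sum]
    rw [Finset.sum_comm]
    have h6 : ∀ i, ∑ d, ((F z).transpose * B z) d k * (F z i d *
        pd e i (fun y => ((F y).transpose * G y * F y) a b) z) =
        (1 : Matrix ι ι ℝ) i k * pd e i (fun y => ((F y).transpose * G y * F y) a b) z := by
      intro i
      rw [← frame_mul_coframe hz, Matrix.mul_apply, Finset.sum_mul]
      exact Finset.sum_congr rfl fun d _ => by ring
    simp only [h6, Matrix.one_apply, ite_mul, one_mul, zero_mul, Finset.sum_ite_eq', Finset.mem_univ,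
      if_true]
  -- With the coframe `L = Fᵀ B`, the tensor `e` equals `Lᵀ (g_ij - δ_ij) L`. Bounds on `e` and, by
  -- the product rule, on `∂e` follow from those on the frame components.
  have hDe : ∀ z, IsMetricAt B z → (F z).transpose * B z * F z = 1 →
      ((F z).transpose * B z).transpose * ((F z).transpose * G z * F z - 1) *
        ((F z).transpose * B z) = G z - B z := by
    intro z hBz hz
    rw [Matrix.mul_sub, Matrix.sub_mul, coframe_transpose_mul hz]
    congr 1
    rw [← hz, coframe_transpose_mul hz]
  have hD : WeightedO l ρ w⁻¹ w⁻¹ fun z => G z - B z := by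
    refine (((hL.transpose.mul hPW h11).mul hL h11).congr_weight fun z => by simp).congr_left ?_
    filter_upwards [hB, hFs] with z hBz hz using hDe z hBz hz
  have hdD : ∀ k, WeightedO l (fun z => ρ z * w⁻¹ k z) w⁻¹ w⁻¹
      fun z => pdMat e k (fun z => G z - B z) z := by
    intro k
    have a1 := (((hdL k).transpose.mul hPW h11).mul hL h11).congr_weight
      (g := fun z => ρ z * w⁻¹ k z) fun z => by simp only [Pi.one_apply]; ring
    have a2 := ((hL.transpose.mul (hdPW k) h11).mul hL h11).congr_weight
      (g := fun z => ρ z * w⁻¹ k z) fun z => by simp only [Pi.one_apply]; ring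
    have a3 := ((hL.transpose.mul hPW h11).mul (hdL k) h11).congr_weight
      (g := fun z => ρ z * w⁻¹ k z) fun z => by simp only [Pi.one_apply]; ring
    refine ((a1.add a2).add a3).congr_left ?_
    filter_upwards [hB, hG, hF, hFd] with z hBz hGz hz hFz
    have d1 : MatDiffAt (fun z => (F z).transpose * B z) z := hFz.transpose.mul hBz.matDiffAt
    have d2 : MatDiffAt (fun z => (F z).transpose * G z * F z - 1) z :=
      ((hFz.transpose.mul hGz.matDiffAt).mul hFz).sub (fun i j => differentiableAt_const _)
    have h3 : (fun z => G z - B z) =ᶠ[𝓝 z] fun z => ((F z).transpose * B z).transpose *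
        ((F z).transpose * G z * F z - 1) * ((F z).transpose * B z) := by
      filter_upwards [hBz.eventually, hz] with y hBy hy using (hDe y hBy hy).symm
    rw [pdMat_congr e k h3, pdMat_mul e k (d1.transpose.mul d2) d1,
      pdMat_mul e k d1.transpose d2, pdMat_transpose, Matrix.add_mul]
  have hC := weightedO_connDiff e hw' hG hB hgi (weightedO_connMat e hw' hbi hdB) hD hdD
  have hR := weightedO_ricMat e hw' hB hbi hdB hddB
  have hcard : (fun _ : E => (Fintype.card ι : ℝ)) =O[l] (1 : E → ℝ) :=
    isBigO_const_const _ one_ne_zero _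
  have hM : WeightedO l 1 w w⁻¹ fun z =>
      (B z)⁻¹ * ((ricMat e B z).transpose + (Fintype.card ι : ℝ) • B z) :=
    (hbi.mul (hR.transpose.add ((hBO.smul hcard).congr_weight fun z => by simp)) h1).congr_weight
      fun z => by simp
  exact massRemainder_isBigO e hw' hgi hD hC hM hV (pd_isBigO_of_gradNorm e hB hFs hL hdV)

end WeightedFrame

/-! ### Growth of separated functions of `r` and of points of `N`. -/

section ProductSymbols

open Matrix

variable {m : ℕ}

/-- The size of the components of a unit vector in the direction of the coordinate axes. -/
def endWeight : Unit ⊕ Fin m → ℝ × ModelN m → ℝ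
  | Sum.inl _, z => z.1
  | Sum.inr _, z => z.1⁻¹

variable {r₀ R₀ : ℝ} {K T : Set (ModelN m)} {f σ : ℝ → ℝ} {η : ModelN m → ℝ}

lemma isBigO_fst {f σ : ℝ → ℝ} (h : f =O[𝓟 (Ici R₀)] σ) :
    (fun z : ℝ × ModelN m => f z.1) =O[𝓟 (Ici R₀ ×ˢ K)] fun z => σ z.1 :=
  h.comp_tendsto (tendsto_principal_principal.2 fun _ hz => hz.1)

lemma isBigO_snd (hK : IsCompact K) (hη : ContinuousOn η K) :
    (fun z : ℝ × ModelN m => η z.2) =O[𝓟 (Ici R₀ ×ˢ K)] fun _ => (1 : ℝ) := by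
  obtain ⟨C, hC⟩ := hK.exists_bound_of_continuousOn hη
  exact IsBigO.of_bound C (eventually_principal.2 fun z hz => by simpa using hC _ hz.2)

/-- A tangential derivative leaves the power of `r` unchanged, while the weights allow the loss of a
factor `r`; the slack is absorbed here. -/
lemma isBigO_one_fst (hR : 1 ≤ R₀) :
    (fun _ : ℝ × ModelN m => (1 : ℝ)) =O[𝓟 (Ici R₀ ×ˢ K)] fun z => z.1 :=
  IsBigO.of_bound 1 (eventually_principal.2 fun z hz => by
    have : 1 ≤ z.1 := hR.trans hz.1
    rw [norm_one, one_mul, Real.norm_eq_abs, abs_of_nonneg (by linarith)]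
    exact this)

/-- A product of a function of `r` and a function on `N`, and its first derivatives. -/
lemma isBigO_prod (hK : IsCompact K) (hη : ContinuousOn η K) (hf : f =O[𝓟 (Ici R₀)] σ) :
    (fun z : ℝ × ModelN m => f z.1 * η z.2) =O[𝓟 (Ici R₀ ×ˢ K)] fun z => σ z.1 :=
  ((isBigO_fst hf).mul (isBigO_snd hK hη)).congr_right fun _ => mul_one _

/-- A radial derivative gains `r⁻¹`, which is the inverse radial weight. A tangential derivative
gains nothing, which is better than the permitted factor `r`; compactness of `K` bounds the factor
on `N`. -/
lemma pd_isBigO_prod (hr : r₀ < R₀) (hR : 1 ≤ R₀) (hT : IsOpen T) (hK : IsCompact K) (hKT : K ⊆ T)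
    (hη : ContDiffOn ℝ 1 η T) (hfd : ∀ r, r₀ < r → DifferentiableAt ℝ f r)
    (hf : f =O[𝓟 (Ici R₀)] σ) (hf' : deriv f =O[𝓟 (Ici R₀)] fun r => σ r * r⁻¹)
    (k : Unit ⊕ Fin m) :
    (fun z => pd (basisEnd m) k (fun z => f z.1 * η z.2) z) =O[𝓟 (Ici R₀ ×ˢ K)]
      fun z => σ z.1 * endWeight⁻¹ k z := by
  have hηd : ∀ y ∈ T, DifferentiableAt ℝ η y := fun y hy =>
    (hη.differentiableOn (by norm_num)).differentiableAt (hT.mem_nhds hy)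
  have hS : ∀ z ∈ Ici R₀ ×ˢ K, r₀ < z.1 ∧ z.2 ∈ T := fun z hz => ⟨hr.trans_le hz.1, hKT hz.2⟩
  rcases k with ⟨⟩ | A
  · refine (isBigO_prod hK ((hη.continuousOn).mono hKT) hf').congr' ?_ EventuallyEq.rfl
    exact eventually_principal.2 fun z hz =>
      (pd_inl_mul (hfd _ (hS z hz).1) (hηd _ (hS z hz).2)).symm
  · have hc : ContinuousOn (fun y => pd (basisN m) A η y) K := fun y hy =>
      ((contDiffAt_pd (k := 0) (basisN m) A (hη.contDiffAt (hT.mem_nhds (hKT hy)))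
        (by norm_num)).continuousAt).continuousWithinAt
    refine (((isBigO_prod hK hc hf).mul (isBigO_one_fst hR)).congr' ?_ ?_)
    · exact eventually_principal.2 fun z hz =>
        (mul_one _).trans (pd_inr_mul A (hfd _ (hS z hz).1) (hηd _ (hS z hz).2)).symm
    · exact Eventually.of_forall fun z => by simp [endWeight]

lemma pd_pd_isBigO_prod (hr : r₀ < R₀) (hR : 1 ≤ R₀) (hT : IsOpen T) (hK : IsCompact K)
    (hKT : K ⊆ T) (hη : ContDiffOn ℝ 2 η T) (hfd : ∀ r, r₀ < r → DifferentiableAt ℝ f r)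
    (hfd' : ∀ r, r₀ < r → DifferentiableAt ℝ (deriv f) r)
    (hf : f =O[𝓟 (Ici R₀)] σ) (hf' : deriv f =O[𝓟 (Ici R₀)] fun r => σ r * r⁻¹)
    (hf'' : deriv (deriv f) =O[𝓟 (Ici R₀)] fun r => σ r * r⁻¹ * r⁻¹) (p k : Unit ⊕ Fin m) :
    (fun z => pd (basisEnd m) p (pd (basisEnd m) k (fun z => f z.1 * η z.2)) z)
      =O[𝓟 (Ici R₀ ×ˢ K)] fun z => σ z.1 * endWeight⁻¹ k z * endWeight⁻¹ p z := by
  have hηd : ∀ y ∈ T, DifferentiableAt ℝ η y := fun y hy =>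
    (hη.differentiableOn (by norm_num)).differentiableAt (hT.mem_nhds hy)
  have hO : IsOpen (Ioi r₀ ×ˢ T) := isOpen_Ioi.prod hT
  have hS : Ici R₀ ×ˢ K ⊆ Ioi r₀ ×ˢ T := fun z hz => ⟨hr.trans_le hz.1, hKT hz.2⟩
  rcases k with ⟨⟩ | A
  · refine (pd_isBigO_prod hr hR hT hK hKT (hη.of_le (by norm_num)) hfd' hf' hf'' p).congr' ?_
      (Eventually.of_forall fun z => by simp [endWeight])
    refine eventually_principal.2 fun z hz => pd_congr _ _ ?_
    filter_upwards [hO.mem_nhds (hS hz)] with y hy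
    exact (pd_inl_mul (hfd _ hy.1) (hηd _ hy.2)).symm
  · have hpd : ContDiffOn ℝ 1 (pd (basisN m) A η) T := fun y hy =>
      (contDiffAt_pd (basisN m) A (hη.contDiffAt (hT.mem_nhds hy)) (by norm_num)).contDiffWithinAt
    refine ((((pd_isBigO_prod hr hR hT hK hKT hpd hfd hf hf' p)).mul
      (isBigO_one_fst hR)).congr' ?_ (Eventually.of_forall fun z => ?_))
    · refine eventually_principal.2 fun z hz => (mul_one _).trans (pd_congr _ _ ?_)
      filter_upwards [hO.mem_nhds (hS hz)] with y hy
      exact (pd_inr_mul A (hfd _ hy.1) (hηd _ hy.2)).symm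
    · simp [endWeight]; ring

/-- A function of `r` which is `O(σ)` together with its derivatives, each derivative improving the
decay by a power of `r`. -/
structure IsRadialSymbol (r₀ R₀ : ℝ) (f σ : ℝ → ℝ) : Prop where
  differentiableAt : ∀ r, r₀ < r → DifferentiableAt ℝ f r
  differentiableAt_deriv : ∀ r, r₀ < r → DifferentiableAt ℝ (deriv f) r
  isBigO : f =O[𝓟 (Ici R₀)] σ
  isBigO_deriv : deriv f =O[𝓟 (Ici R₀)] fun r => σ r * r⁻¹
  isBigO_deriv_deriv : deriv (deriv f) =O[𝓟 (Ici R₀)] fun r => σ r * r⁻¹ * r⁻¹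

lemma isRadialSymbol_zero (σ : ℝ → ℝ) : IsRadialSymbol r₀ R₀ (fun _ => 0) σ := by
  have h : deriv (fun _ : ℝ => (0 : ℝ)) = fun _ => 0 := by funext r; simp
  refine ⟨fun r _ => differentiableAt_const _, fun r _ => ?_, isBigO_zero _ _, ?_, ?_⟩
  · rw [h]; exact differentiableAt_const _
  · rw [h]; exact isBigO_zero _ _
  · rw [h, h]; exact isBigO_zero _ _

lemma isRadialSymbol_sq (hR : 1 ≤ R₀) : IsRadialSymbol r₀ R₀ (fun r => r ^ 2) (fun r => r ^ 2) := by
  have h : deriv (fun r : ℝ => r ^ 2) = fun r => 2 * r := by funext r; simp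
  have h2 : deriv (fun r : ℝ => 2 * r) = fun _ => 2 := by funext r; simp
  have hne : ∀ r ∈ Ici R₀, r ≠ 0 := fun r hr => by
    have : R₀ ≤ r := hr
    linarith
  refine ⟨fun r _ => by fun_prop, fun r _ => by rw [h]; fun_prop, isBigO_refl _ _, ?_, ?_⟩
  · rw [h]
    refine ((isBigO_refl (fun r : ℝ => r) _).const_mul_left 2).congr' EventuallyEq.rfl ?_
    exact eventually_principal.2 fun r hr => by
      have := hne r hr
      field_simp
  · rw [h, h2]
    refine (isBigO_const_const (2 : ℝ) (one_ne_zero (α := ℝ)) _).congr' EventuallyEq.rfl ?_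
    exact eventually_principal.2 fun r hr => by
      have := hne r hr
      field_simp

/-- For `r ≥ 2` and `k ≥ -1` one has `r² + k ≥ r² - 1 ≥ r²/2`, whence the threshold 2 for `R₀` and
the constant 2. -/
lemma inv_sq_add_isBigO {k : ℝ} (hk : -1 ≤ k) (hR : 2 ≤ R₀) :
    (fun r : ℝ => (r ^ 2 + k)⁻¹) =O[𝓟 (Ici R₀)] fun r => r⁻¹ * r⁻¹ := by
  refine IsBigO.of_bound 2 (eventually_principal.2 fun r hr => ?_)
  have hr2 : 2 ≤ r := hR.trans hr
  have h0 : 0 < r ^ 2 + k := by nlinarith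
  rw [Real.norm_eq_abs, Real.norm_eq_abs, abs_of_pos (by positivity), abs_of_pos (by positivity),
    inv_le_iff_one_le_mul₀ h0]
  have : (2 * (r⁻¹ * r⁻¹)) * (r ^ 2 + k) = 2 + 2 * k * (r⁻¹ * r⁻¹) := by field_simp
  rw [this]
  have h1 : r⁻¹ ≤ 2⁻¹ := inv_anti₀ (by norm_num) hr2
  have h2 : 0 < r⁻¹ := by positivity
  nlinarith

lemma isRadialSymbol_inv_sq_add {k : ℝ} (hr₀ : 0 ≤ r₀) (hr₀k : 0 ≤ r₀ ^ 2 + k) (hk : -1 ≤ k)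
    (hr : r₀ < R₀) (hR : 2 ≤ R₀) :
    IsRadialSymbol r₀ R₀ (fun r => (r ^ 2 + k)⁻¹) (fun r => r⁻¹ * r⁻¹) := by
  have hpos : ∀ r, r₀ < r → 0 < r ^ 2 + k := fun r hr => sq_add_pos hr₀ hr₀k hr
  have hO := inv_sq_add_isBigO hk hR
  have h1 : ∀ r, r₀ < r → HasDerivAt (fun r : ℝ => (r ^ 2 + k)⁻¹)
      (-2 * (r * ((r ^ 2 + k)⁻¹ * (r ^ 2 + k)⁻¹))) r := fun r hr => by
    have h := (((hasDerivAt_id r).pow 2).add_const k).inv (hpos r hr).ne'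
    refine h.congr_deriv ?_
    have := (hpos r hr).ne'
    simp
    field_simp
  have h1' : ∀ r, r₀ < r → deriv (fun r : ℝ => (r ^ 2 + k)⁻¹) =ᶠ[𝓝 r]
      fun r => -2 * (r * ((r ^ 2 + k)⁻¹ * (r ^ 2 + k)⁻¹)) := fun r hr => by
    filter_upwards [isOpen_Ioi.mem_nhds hr] with s hs using (h1 s hs).deriv
  have h2 : ∀ r, r₀ < r → HasDerivAt (deriv (fun r : ℝ => (r ^ 2 + k)⁻¹))
      (-2 * ((r ^ 2 + k)⁻¹ * (r ^ 2 + k)⁻¹) + 8 * (r * r * ((r ^ 2 + k)⁻¹ * (r ^ 2 + k)⁻¹ *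
        (r ^ 2 + k)⁻¹))) r := fun r hr => by
    have h := (((hasDerivAt_id r).mul ((h1 r hr).mul (h1 r hr))).const_mul (-2)).congr_of_eventuallyEq
      (h1' r hr)
    refine h.congr_deriv ?_
    simp only [id, Pi.mul_apply]
    ring
  have hne : ∀ r ∈ Ici R₀, r ≠ 0 := fun r hr => by
    have : R₀ ≤ r := hr
    linarith
  refine ⟨fun r hr => (h1 r hr).differentiableAt, fun r hr => (h2 r hr).differentiableAt, hO, ?_, ?_⟩
  · refine (((isBigO_refl (fun r : ℝ => r) _).mul (hO.mul hO)).const_mul_left (-2)).congr' ?_ ?_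
    · exact eventually_principal.2 fun r hr' => ((h1 r (hr.trans_le hr')).deriv).symm
    · exact eventually_principal.2 fun r hr' => by
        have := hne r hr'
        field_simp
  · refine ((((hO.mul hO)).const_mul_left (-2)).add ((((isBigO_refl (fun r : ℝ => r * r) _).mul
      ((hO.mul hO).mul hO)).const_mul_left 8).congr' EventuallyEq.rfl ?_)).congr' ?_ ?_
    · exact eventually_principal.2 fun r hr' => by
        have := hne r hr'
        change r * r * _ = r⁻¹ * r⁻¹ * (r⁻¹ * r⁻¹)
        field_simp
    · exact eventually_principal.2 fun r hr' => ((h2 r (hr.trans_le hr')).deriv).symm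
    · exact Eventually.of_forall fun r => by ring

lemma sqrt_sq_add_isBigO {k : ℝ} (hk : k ≤ 1) (hR : 2 ≤ R₀) :
    (fun r : ℝ => Real.sqrt (r ^ 2 + k)) =O[𝓟 (Ici R₀)] fun r => r := by
  refine IsBigO.of_bound 2 (eventually_principal.2 fun r hr => ?_)
  have hr2 : 2 ≤ r := hR.trans hr
  rw [Real.norm_eq_abs, Real.norm_eq_abs, abs_of_nonneg (Real.sqrt_nonneg _),
    abs_of_nonneg (by linarith)]
  exact Real.sqrt_le_iff.2 ⟨by linarith, by nlinarith⟩

lemma deriv_sqrt_sq_add {k r : ℝ} (h : 0 < r ^ 2 + k) :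
    HasDerivAt (fun r : ℝ => Real.sqrt (r ^ 2 + k)) (r / Real.sqrt (r ^ 2 + k)) r := by
  have h1 := (((hasDerivAt_id r).pow 2).add_const k).sqrt h.ne'
  refine h1.congr_deriv ?_
  simp
  field_simp

lemma deriv_sqrt_sq_add_isBigO {k : ℝ} (hk : -1 ≤ k) (hR : 2 ≤ R₀) :
    deriv (fun r : ℝ => Real.sqrt (r ^ 2 + k)) =O[𝓟 (Ici R₀)] fun r => r * r⁻¹ := by
  refine IsBigO.of_bound 2 (eventually_principal.2 fun r hr => ?_)
  have hr2 : 2 ≤ r := hR.trans hr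
  have h0 : 0 < r ^ 2 + k := by nlinarith
  have h1 := Real.sqrt_pos.2 h0
  rw [(deriv_sqrt_sq_add h0).deriv, mul_inv_cancel₀ (by linarith), norm_one, mul_one,
    Real.norm_eq_abs, abs_of_pos (by positivity), div_le_iff₀ h1]
  have : r / 2 ≤ Real.sqrt (r ^ 2 + k) := Real.le_sqrt_of_sq_le (by nlinarith)
  linarith

lemma deriv_inv_isBigO (R₀ : ℝ) :
    deriv (fun r : ℝ => r⁻¹) =O[𝓟 (Ici R₀)] fun r => r⁻¹ * r⁻¹ := by
  rw [deriv_inv']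
  refine ((isBigO_refl (fun r : ℝ => r⁻¹ * r⁻¹) _).neg_left).congr_left fun r => ?_
  rw [← mul_inv, sq]

end ProductSymbols

/-! ### The orthonormal frame of the reference metric in a product chart. -/

section EndFrames

open Matrix

variable {m : ℕ} {N : Type*} [TopologicalSpace N] [ChartedSpace (ModelN m) N]

/-- The components of a frame on `N` in the chart at `p`. -/
def frameComp (ε : Fin m → ∀ x : N, TangentSpace (𝓡 m) x) (p : N) (y : ModelN m) :
    Matrix (Fin m) (Fin m) ℝ :=
  Matrix.of fun A i => (basisN m).repr (mfderiv (𝓡 m) 𝓘(ℝ, ModelN m) (extChartAt (𝓡 m) p)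
    ((extChartAt (𝓡 m) p).symm y) (ε i ((extChartAt (𝓡 m) p).symm y))) A

/-- The components of the frame `√(r² + k) ∂_r`, `r⁻¹ εᵢ`. -/
def endFrameMatrix (k : ℝ) (ε : Fin m → ∀ x : N, TangentSpace (𝓡 m) x) (p : N)
    (z : ℝ × ModelN m) : Matrix (Unit ⊕ Fin m) (Unit ⊕ Fin m) ℝ :=
  Matrix.fromBlocks (Matrix.of fun _ _ => Real.sqrt (z.1 ^ 2 + k)) 0 0 (z.1⁻¹ • frameComp ε p z.2)

variable [IsManifold (𝓡 m) ∞ N]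

/-- Smoothness of the frame is smoothness of a section of the tangent bundle; composing with the
tangent map of the chart and with the inverse chart turns it into smoothness of the components. -/
lemma contDiffOn_frameComp {W : Set N} {h : FormField (𝓡 m) N}
    {ε : Fin m → ∀ x : N, TangentSpace (𝓡 m) x} (hε : IsOrthonormalFrameOn h W ε) (p : N)
    (A i : Fin m) : ContDiffOn ℝ ∞ (fun y => frameComp ε p y A i)
      ((extChartAt (𝓡 m) p).target ∩ (extChartAt (𝓡 m) p).symm ⁻¹' W) := by
  have h1 : ContMDiffOn (𝓡 m).tangent 𝓘(ℝ, ModelN m).tangent ∞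
      (tangentMapWithin (𝓡 m) 𝓘(ℝ, ModelN m) (extChartAt (𝓡 m) p) (extChartAt (𝓡 m) p).source)
      (Bundle.TotalSpace.proj ⁻¹' (extChartAt (𝓡 m) p).source) := by
    refine ContMDiffOn.contMDiffOn_tangentMapWithin (n := ∞) ?_ (by simp)
      (isOpen_extChartAt_source p).uniqueMDiffOn
    rw [extChartAt_source]
    exact contMDiffOn_extChartAt
  have h2 : ContMDiffOn 𝓘(ℝ, ModelN m) (𝓡 m).tangent ∞
      (fun y => (⟨(extChartAt (𝓡 m) p).symm y, ε i ((extChartAt (𝓡 m) p).symm y)⟩ :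
        TangentBundle (𝓡 m) N))
      ((extChartAt (𝓡 m) p).target ∩ (extChartAt (𝓡 m) p).symm ⁻¹' W) :=
    (hε.1 i).comp ((contMDiffOn_extChartAt_symm p).mono inter_subset_left) fun y hy => hy.2
  have h3 := h1.comp h2 fun y hy => (extChartAt (𝓡 m) p).map_target hy.1
  have h4 : ContMDiffOn 𝓘(ℝ, ModelN m) 𝓘(ℝ, ModelN m).tangent ∞
      (fun y => (⟨y, mfderiv (𝓡 m) 𝓘(ℝ, ModelN m) (extChartAt (𝓡 m) p)
        ((extChartAt (𝓡 m) p).symm y) (ε i ((extChartAt (𝓡 m) p).symm y))⟩ :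
        TangentBundle 𝓘(ℝ, ModelN m) (ModelN m)))
      ((extChartAt (𝓡 m) p).target ∩ (extChartAt (𝓡 m) p).symm ⁻¹' W) := by
    refine h3.congr fun y hy => ?_
    have hs := (extChartAt (𝓡 m) p).map_target hy.1
    have hr := (extChartAt (𝓡 m) p).right_inv hy.1
    simp only [Function.comp, tangentMapWithin,
      mfderivWithin_of_isOpen (isOpen_extChartAt_source p) hs]
    -- The base point produced by the composition is the chart applied to its inverse, which equals
    -- the point of the model space only propositionally.
    have key : ∀ (a b : ModelN m) (hab : a = b) (v : ModelN m),
        (⟨a, v⟩ : TangentBundle 𝓘(ℝ, ModelN m) (ModelN m)) = ⟨b, v⟩ := by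
      rintro a _ rfl v; rfl
    exact (key _ _ hr _).symm
  have h5 := contMDiffOn_vectorSpace_iff_contDiffOn.1 h4
  exact (contDiff_repr (basisN m) A).comp_contDiffOn h5

lemma endFrameMatrix_mulVec_basis (k : ℝ) (ε : Fin m → ∀ x : N, TangentSpace (𝓡 m) x) (p : N)
    {z : ℝ × ModelN m} (hz : z.2 ∈ (extChartAt (𝓡 m) p).target) (c : Unit ⊕ Fin m) :
    frame k ε c ((extChartAt (modelEnd m) ((0 : ℝ), p)).symm z) =
      mfderiv 𝓘(ℝ, ℝ × ModelN m) (modelEnd m) (extChartAt (modelEnd m) ((0 : ℝ), p)).symm z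
        (∑ i, endFrameMatrix k ε p z i c • basisEnd m i : ℝ × ModelN m) := by
  refine Eq.trans ?_ (mfderiv_extChartAt_end_symm hz _).symm
  have hsum : ∀ u : Unit ⊕ Fin m → ℝ, ∑ i, u i • basisEnd m i =
      ((u (Sum.inl ()), ∑ A, u (Sum.inr A) • basisN m A) : ℝ × ModelN m) := by
    intro u
    simp only [Fintype.sum_sum_type, Finset.univ_unique, Finset.sum_singleton,
      PUnit.default_eq_unit, basisEnd_inl, basisEnd_inr, Prod.smul_mk, smul_eq_mul, mul_one,
      smul_zero]
    refine Prod.ext ?_ ?_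
    · simp [Prod.fst_sum]
    · simp [Prod.snd_sum]
  rw [hsum]
  rcases c with ⟨⟩ | i
  · simp only [endFrameMatrix, Matrix.fromBlocks_apply₁₁, Matrix.of_apply,
      Matrix.fromBlocks_apply₂₁, Matrix.zero_apply, zero_smul, Finset.sum_const_zero]
    have h0 := map_zero (mfderiv 𝓘(ℝ, ModelN m) (𝓡 m) (extChartAt (𝓡 m) p).symm z.2)
    exact congrArg (tangentEnd _ _) h0.symm
  · simp only [endFrameMatrix, Matrix.fromBlocks_apply₁₂, Matrix.zero_apply,
      Matrix.fromBlocks_apply₂₂, Matrix.smul_apply, smul_eq_mul, mul_smul, ← Finset.smul_sum]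
    have h1 : ∑ A, frameComp ε p z.2 A i • basisN m A = mfderiv (𝓡 m) 𝓘(ℝ, ModelN m)
        (extChartAt (𝓡 m) p) ((extChartAt (𝓡 m) p).symm z.2)
        (ε i ((extChartAt (𝓡 m) p).symm z.2)) := (basisN m).sum_repr _
    have h2 := (map_smul (mfderiv 𝓘(ℝ, ModelN m) (𝓡 m) (extChartAt (𝓡 m) p).symm z.2) z.1⁻¹
      (∑ A, frameComp ε p z.2 A i • basisN m A))
    have h3 := mfderiv_symm_mfderiv_extChartAt (I := 𝓡 m) hz (ε i ((extChartAt (𝓡 m) p).symm z.2))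
    refine (congrArg (tangentEnd _ _) (h2.trans (congrArg (fun v => z.1⁻¹ • v) ?_))).symm
    exact (congrArg (mfderiv 𝓘(ℝ, ModelN m) (𝓡 m) (extChartAt (𝓡 m) p).symm z.2) h1).trans h3

lemma form_frame_eq {g : FormField (modelEnd m) (ℝ × N)} (k : ℝ)
    (ε : Fin m → ∀ x : N, TangentSpace (𝓡 m) x) {p : N} {z : ℝ × ModelN m}
    (hz : z.2 ∈ (extChartAt (𝓡 m) p).target)
    (hg : IsBilinAt g ((extChartAt (modelEnd m) ((0 : ℝ), p)).symm z)) (a b : Unit ⊕ Fin m) :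
    g ((extChartAt (modelEnd m) ((0 : ℝ), p)).symm z)
        (frame k ε a ((extChartAt (modelEnd m) ((0 : ℝ), p)).symm z))
        (frame k ε b ((extChartAt (modelEnd m) ((0 : ℝ), p)).symm z)) =
      ((endFrameMatrix k ε p z).transpose * endMatrix g p z * endFrameMatrix k ε p z) a b := by
  have h1 : ∀ c, frame k ε c ((extChartAt (modelEnd m) ((0 : ℝ), p)).symm z) =
      ∑ i, endFrameMatrix k ε p z i c • mfderiv 𝓘(ℝ, ℝ × ModelN m) (modelEnd m)
        (extChartAt (modelEnd m) ((0 : ℝ), p)).symm z (basisEnd m i) := by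
    intro c
    rw [endFrameMatrix_mulVec_basis k ε p hz]
    refine (map_sum (mfderiv 𝓘(ℝ, ℝ × ModelN m) (modelEnd m)
      (extChartAt (modelEnd m) ((0 : ℝ), p)).symm z) _ _).trans ?_
    exact Finset.sum_congr rfl fun i _ => map_smul _ _ _
  rw [h1, h1, hg.sum_smul]
  simp only [Matrix.mul_apply, Matrix.transpose_apply, Finset.sum_mul]
  rw [Finset.sum_comm]
  refine Finset.sum_congr rfl fun i _ => Finset.sum_congr rfl fun j _ => ?_
  simp only [endMatrix, localForm, Matrix.of_apply]
  ring

/-- Differentiability of `γ` on the manifold is not given separately. It is recovered by composing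
the coordinate expression with the chart, so that the chain rule applies to the manifold derivative.
-/
lemma dirDeriv_frame_eq (k : ℝ) (ε : Fin m → ∀ x : N, TangentSpace (𝓡 m) x) {p : N}
    {z : ℝ × ModelN m} (hz : z.2 ∈ (extChartAt (𝓡 m) p).target) {γ : ℝ × N → ℝ}
    {q : ℝ × ModelN m → ℝ}
    (hγ : (fun w => γ ((extChartAt (modelEnd m) ((0 : ℝ), p)).symm w)) =ᶠ[𝓝 z] q)
    (hq : DifferentiableAt ℝ q z) (c : Unit ⊕ Fin m) :
    dirDeriv γ ((extChartAt (modelEnd m) ((0 : ℝ), p)).symm z)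
        (frame k ε c ((extChartAt (modelEnd m) ((0 : ℝ), p)).symm z)) =
      ∑ i, endFrameMatrix k ε p z i c * pd (basisEnd m) i q z := by
  have hz' : z ∈ (extChartAt (modelEnd m) ((0 : ℝ), p)).target := mem_extChartAt_end_target.2 hz
  set φ := extChartAt (modelEnd m) ((0 : ℝ), p) with hφ
  have hd : DifferentiableAt ℝ (fun w => γ (φ.symm w)) z := hq.congr_of_eventuallyEq hγ
  have hs : φ.symm z ∈ φ.source := φ.map_target hz'
  have hmd : MDifferentiableAt (modelEnd m) 𝓘(ℝ, ℝ) γ (φ.symm z) := by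
    have h1 : MDifferentiableAt (modelEnd m) 𝓘(ℝ, ℝ × ModelN m) φ (φ.symm z) :=
      (contMDiffOn_extChartAt (n := ∞)).contMDiffAt (s := (chartAt _ ((0 : ℝ), p)).source)
        (by rw [← extChartAt_source (modelEnd m)]; exact (isOpen_extChartAt_source _).mem_nhds hs)
        |>.mdifferentiableAt (by simp)
    have h2 : MDifferentiableAt 𝓘(ℝ, ℝ × ModelN m) 𝓘(ℝ, ℝ) (fun w => γ (φ.symm w))
        (φ (φ.symm z)) := by
      rw [φ.right_inv hz']
      exact hd.mdifferentiableAt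
    refine (h2.comp _ h1).congr_of_eventuallyEq ?_
    filter_upwards [(isOpen_extChartAt_source _).mem_nhds hs] with x hx
    simp only [Function.comp, hφ]
    rw [(extChartAt (modelEnd m) ((0 : ℝ), p)).left_inv hx]
  have h3 : mfderiv 𝓘(ℝ, ℝ × ModelN m) 𝓘(ℝ, ℝ) (fun w => γ (φ.symm w)) z =
      (mfderiv (modelEnd m) 𝓘(ℝ, ℝ) γ (φ.symm z)).comp
        (mfderiv 𝓘(ℝ, ℝ × ModelN m) (modelEnd m) φ.symm z) :=
    mfderiv_comp z hmd (mdifferentiableAt_extChartAt_symm hz')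
  rw [mfderiv_eq_fderiv, hγ.fderiv_eq] at h3
  rw [endFrameMatrix_mulVec_basis k ε p hz, dirDeriv]
  refine (congrArg (fun T => T (∑ i, endFrameMatrix k ε p z i c • basisEnd m i : ℝ × ModelN m)) h3).symm.trans ?_
  refine (map_sum (fderiv ℝ q z) _ _).trans ?_
  exact Finset.sum_congr rfl fun i _ => map_smul _ _ _

lemma orthonormal_endFrameMatrix
    (h : Bundle.ContMDiffRiemannianMetric (𝓡 m) ∞ (ModelN m) (fun x : N => TangentSpace (𝓡 m) x))
    {k r₀ : ℝ} (hr₀ : 0 ≤ r₀) (hk : 0 ≤ r₀ ^ 2 + k) {W : Set N}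
    {ε : Fin m → ∀ x : N, TangentSpace (𝓡 m) x}
    (hε : IsOrthonormalFrameOn (fun x u v => h.inner x u v) W ε) {p : N} {z : ℝ × ModelN m}
    (hz : z ∈ endDomain m r₀ p) (hW : (extChartAt (𝓡 m) p).symm z.2 ∈ W) :
    (endFrameMatrix k ε p z).transpose * endMatrix (refMetric (fun x u v => h.inner x u v) k) p z *
      endFrameMatrix k ε p z = 1 := by
  have hpos : 0 < z.1 ^ 2 + k := sq_add_pos hr₀ hk hz.1
  have hz1 : z.1 ≠ 0 := (hr₀.trans_lt hz.1).ne'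
  ext a b
  rw [← form_frame_eq k ε hz.2 (isBilinAt_refMetric (isBilinAt_inner h _))]
  set x := (extChartAt (𝓡 m) p).symm z.2 with hx
  have hsymm : (extChartAt (modelEnd m) ((0 : ℝ), p)).symm z = (z.1, x) := rfl
  rw [hsymm]
  have href : ∀ (s s' : ℝ) (u u' : TangentSpace (𝓡 m) x),
      refMetric (fun x u v => h.inner x u v) k (z.1, x) (tangentEnd (z.1, x) s u)
        (tangentEnd (z.1, x) s' u') = s * s' / (z.1 ^ 2 + k) + z.1 ^ 2 * h.inner x u u' :=
    fun _ _ _ _ => rfl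
  have hi : ∀ i j, h.inner x (ε i x) (ε j x) = if i = j then 1 else 0 := fun i j => hε.2 x hW i j
  rcases a with ⟨⟩ | i <;> rcases b with ⟨⟩ | j
  · refine (href _ _ _ _).trans ?_
    have h0 : h.inner x (0 : TangentSpace (𝓡 m) x) (0 : TangentSpace (𝓡 m) x) = 0 := map_zero _
    rw [Real.mul_self_sqrt hpos.le, div_self hpos.ne', Matrix.one_apply_eq]
    refine (congrArg (fun t => 1 + z.1 ^ 2 * t) h0).trans ?_
    ring
  · refine (href _ _ _ _).trans ?_
    have h0 : h.inner x (0 : TangentSpace (𝓡 m) x) (z.1⁻¹ • ε j x) = 0 := by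
      rw [map_zero]; rfl
    refine (congrArg (fun t => _ + z.1 ^ 2 * t) h0).trans ?_
    rw [Matrix.one_apply_ne (by simp)]
    ring
  · refine (href _ _ _ _).trans ?_
    have h0 : h.inner x (z.1⁻¹ • ε i x) (0 : TangentSpace (𝓡 m) x) = 0 := map_zero _
    refine (congrArg (fun t => _ + z.1 ^ 2 * t) h0).trans ?_
    rw [Matrix.one_apply_ne (by simp)]
    ring
  · refine (href _ _ _ _).trans ?_
    have h0 : h.inner x (z.1⁻¹ • ε i x) (z.1⁻¹ • ε j x) = z.1⁻¹ * (z.1⁻¹ * if i = j then 1 else 0) := by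
      rw [← hi, map_smul, map_smul]; rfl
    refine (congrArg (fun t => _ + z.1 ^ 2 * t) h0).trans ?_
    rw [Matrix.one_apply]
    simp only [Sum.inr.injEq]
    split_ifs
    · field_simp
      ring
    · ring

end EndFrames

/-! ### The pointwise bound on the divergence by the assumed integrands. -/

section DivergenceEstimate

open Matrix

variable {m : ℕ} {N : Type*} [TopologicalSpace N] [ChartedSpace (ModelN m) N]
  [IsManifold (𝓡 m) ∞ N] {k r₀ R₀ : ℝ}

/-- The components of the reference metric are products of functions of `r` and functions on `N`. -/
lemma exists_radialSymbol_refMetric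
    (h : Bundle.ContMDiffRiemannianMetric (𝓡 m) ∞ (ModelN m) (fun x : N => TangentSpace (𝓡 m) x))
    (hr₀ : 0 ≤ r₀) (hr₀k : 0 ≤ r₀ ^ 2 + k) (hk : -1 ≤ k) (hr : r₀ < R₀) (hR : 2 ≤ R₀) (p : N)
    (i j : Unit ⊕ Fin m) : ∃ (f σ : ℝ → ℝ) (η : ModelN m → ℝ), IsRadialSymbol r₀ R₀ f σ ∧
      (∀ z, σ z.1 = endWeight⁻¹ i z * endWeight⁻¹ j z) ∧
      ContDiffOn ℝ 2 η (extChartAt (𝓡 m) p).target ∧ ∀ z ∈ endDomain m r₀ p,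
        f z.1 * η z.2 = endMatrix (refMetric (fun x u v => h.inner x u v) k) p z i j := by
  have he : ∀ z ∈ endDomain m r₀ p, endMatrix (refMetric (fun x u v => h.inner x u v) k) p z i j =
      Matrix.fromBlocks (Matrix.of fun _ _ => 1 / (z.1 ^ 2 + k)) 0 0
      (z.1 ^ 2 • localForm (𝓡 m) (basisN m) (fun x u v => h.inner x u v) p z.2) i j := fun z hz => by
    rw [endMatrix_refMetric _ _ hz.2 (isBilinAt_inner h _)]
  rcases i with ⟨⟩ | i <;> rcases j with ⟨⟩ | j
  · refine ⟨_, _, fun _ => 1, isRadialSymbol_inv_sq_add hr₀ hr₀k hk hr hR, fun z => rfl,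
      contDiffOn_const, fun z hz => ?_⟩
    rw [he z hz]
    simp
  -- The mixed components vanish, so only the required weight matters; the double inverse is the
  -- inverse of the tangential weight `r⁻¹`, left unsimplified so that the weights agree by
  -- definition.
  · refine ⟨_, fun r => r⁻¹ * r⁻¹⁻¹, fun _ => 1, isRadialSymbol_zero _, fun z => rfl,
      contDiffOn_const, fun z hz => ?_⟩
    rw [he z hz]
    simp
  · refine ⟨_, fun r => r⁻¹⁻¹ * r⁻¹, fun _ => 1, isRadialSymbol_zero _, fun z => rfl,
      contDiffOn_const, fun z hz => ?_⟩
    rw [he z hz]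
    simp
  · refine ⟨_, _, fun y => localForm (𝓡 m) (basisN m) (fun x u v => h.inner x u v) p y i j,
      isRadialSymbol_sq (by linarith), fun z => ?_,
      (contDiffOn_localForm (n := ∞) (by simp) h (basisN m) p i j).of_le
        (WithTop.coe_le_coe.2 (le_top : (2 : ℕ∞) ≤ ⊤)), fun z hz => ?_⟩
    · simp [endWeight, sq]
    · rw [he z hz]
      simp

variable {W : Set N}

lemma contDiffOn_frameComp_one {W : Set N} {h : FormField (𝓡 m) N}
    {ε : Fin m → ∀ x : N, TangentSpace (𝓡 m) x} (hε : IsOrthonormalFrameOn h W ε) (p : N)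
    (A i : Fin m) : ContDiffOn ℝ 1 (fun y => frameComp ε p y A i)
      ((extChartAt (𝓡 m) p).target ∩ (extChartAt (𝓡 m) p).symm ⁻¹' W) :=
  (contDiffOn_frameComp hε p A i).of_le (WithTop.coe_le_coe.2 (le_top : (1 : ℕ∞) ≤ ⊤))

/-- The components of the orthonormal frame are products of functions of `r` and functions
on `N`. -/
lemma exists_radial_frame {h : FormField (𝓡 m) N} (hr₀ : 0 ≤ r₀) (hr₀k : 0 ≤ r₀ ^ 2 + k)
    (hk : -1 ≤ k) (hk' : k ≤ 1) (hR : 2 ≤ R₀)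
    {ε : Fin m → ∀ x : N, TangentSpace (𝓡 m) x} (hε : IsOrthonormalFrameOn h W ε) (p : N)
    (i j : Unit ⊕ Fin m) : ∃ (f σ : ℝ → ℝ) (η : ModelN m → ℝ),
      (∀ r, r₀ < r → DifferentiableAt ℝ f r) ∧ f =O[𝓟 (Ici R₀)] σ ∧
      (deriv f =O[𝓟 (Ici R₀)] fun r => σ r * r⁻¹) ∧ (∀ z, σ z.1 = endWeight i z) ∧
      ContDiffOn ℝ 1 η ((extChartAt (𝓡 m) p).target ∩ (extChartAt (𝓡 m) p).symm ⁻¹' W) ∧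
      ∀ z, f z.1 * η z.2 = endFrameMatrix k ε p z i j := by
  have h0 := fun σ => isRadialSymbol_zero (r₀ := r₀) (R₀ := R₀) σ
  rcases i with ⟨⟩ | i <;> rcases j with ⟨⟩ | j
  · exact ⟨_, fun r => r, fun _ => 1,
      fun r hr => (deriv_sqrt_sq_add (sq_add_pos hr₀ hr₀k hr)).differentiableAt,
      sqrt_sq_add_isBigO hk' hR, deriv_sqrt_sq_add_isBigO hk hR, fun z => rfl, contDiffOn_const,
      fun z => by simp [endFrameMatrix]⟩
  · exact ⟨_, fun r => r, fun _ => 1, (h0 0).differentiableAt, (h0 _).isBigO, (h0 _).isBigO_deriv,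
      fun z => rfl, contDiffOn_const, fun z => by simp [endFrameMatrix]⟩
  · exact ⟨_, fun r => r⁻¹, fun _ => 1, (h0 0).differentiableAt, (h0 _).isBigO,
      (h0 _).isBigO_deriv, fun z => rfl, contDiffOn_const, fun z => by simp [endFrameMatrix]⟩
  · exact ⟨_, fun r => r⁻¹, fun y => frameComp ε p y i j,
      fun r hr => differentiableAt_inv (hr₀.trans_lt hr).ne', isBigO_refl _ _, deriv_inv_isBigO R₀,
      fun z => rfl, contDiffOn_frameComp_one hε p i j, fun z => by simp [endFrameMatrix]⟩

lemma frameEnergy_nonneg (g : FormField (modelEnd m) (ℝ × N))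
    (f : Unit ⊕ Fin m → ∀ p : ℝ × N, TangentSpace (modelEnd m) p) (p : ℝ × N) :
    0 ≤ frameEnergy g f p := by
  unfold frameEnergy; positivity

/-- The terms of the frame energy in a chart. -/
lemma isBigO_sqrt_frameEnergy {g : FormField (modelEnd m) (ℝ × N)} (hg : IsEndMetric g r₀)
    {ε : Fin m → ∀ x : N, TangentSpace (𝓡 m) x} {p : N} {S : Set (ℝ × ModelN m)}
    (hS : ∀ z ∈ S, z ∈ endDomain m r₀ p)
    (hF : ∀ z ∈ S, MatDiffAt (endFrameMatrix k ε p) z) :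
    (∀ a b, (fun z => ((endFrameMatrix k ε p z).transpose * endMatrix g p z *
      endFrameMatrix k ε p z) a b - (1 : Matrix (Unit ⊕ Fin m) (Unit ⊕ Fin m) ℝ) a b) =O[𝓟 S]
      fun z => Real.sqrt (frameEnergy g (frame k ε) (z.1, (extChartAt (𝓡 m) p).symm z.2))) ∧
    ∀ a b c, (fun z => ∑ i, endFrameMatrix k ε p z i c * pd (basisEnd m) i
      (fun y => ((endFrameMatrix k ε p y).transpose * endMatrix g p y *
        endFrameMatrix k ε p y) a b) z) =O[𝓟 S]
      fun z => Real.sqrt (frameEnergy g (frame k ε) (z.1, (extChartAt (𝓡 m) p).symm z.2)) := by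
  have hbil : ∀ z ∈ endDomain m r₀ p,
      IsBilinAt g ((extChartAt (modelEnd m) ((0 : ℝ), p)).symm z) := fun z hz =>
    hg.bilin _ ⟨hz.1, mem_univ _⟩
  refine ⟨fun a b => IsBigO.of_bound 1 (eventually_principal.2 fun z hz => ?_),
    fun a b c => IsBigO.of_bound 1 (eventually_principal.2 fun z hz => ?_)⟩
  · rw [one_mul, Real.norm_eq_abs, Real.norm_eq_abs, abs_of_nonneg (Real.sqrt_nonneg _)]
    refine Real.le_sqrt_of_sq_le ?_
    rw [← form_frame_eq k ε (hS z hz).2 (hbil z (hS z hz)), Matrix.one_apply]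
    refine le_trans ?_ (le_add_of_nonneg_right (by positivity))
    exact (Finset.single_le_sum (f := fun b => |g ((extChartAt (modelEnd m) ((0 : ℝ), p)).symm z)
      (frame k ε a ((extChartAt (modelEnd m) ((0 : ℝ), p)).symm z))
      (frame k ε b ((extChartAt (modelEnd m) ((0 : ℝ), p)).symm z)) - if a = b then 1 else 0| ^ 2)
      (fun _ _ => by positivity) (Finset.mem_univ b)).trans
      (Finset.single_le_sum (f := fun a => ∑ b, |g ((extChartAt (modelEnd m) ((0 : ℝ), p)).symm z)
      (frame k ε a ((extChartAt (modelEnd m) ((0 : ℝ), p)).symm z))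
      (frame k ε b ((extChartAt (modelEnd m) ((0 : ℝ), p)).symm z)) - if a = b then 1 else 0| ^ 2)
      (fun _ _ => by positivity) (Finset.mem_univ a))
  · rw [one_mul, Real.norm_eq_abs, Real.norm_eq_abs, abs_of_nonneg (Real.sqrt_nonneg _)]
    refine Real.le_sqrt_of_sq_le ?_
    have hγ : (fun w => (fun q => g q (frame k ε a q) (frame k ε b q))
        ((extChartAt (modelEnd m) ((0 : ℝ), p)).symm w)) =ᶠ[𝓝 z]
        fun y => ((endFrameMatrix k ε p y).transpose * endMatrix g p y *
        endFrameMatrix k ε p y) a b := by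
      filter_upwards [(isOpen_endDomain r₀ p).mem_nhds (hS z hz)] with w hw
      exact form_frame_eq k ε hw.2 (hbil w hw) a b
    have hd : DifferentiableAt ℝ (fun y => ((endFrameMatrix k ε p y).transpose * endMatrix g p y *
        endFrameMatrix k ε p y) a b) z :=
      (((hF z hz).transpose.mul (hg.isMetricAt (hS z hz)).matDiffAt).mul (hF z hz)) a b
    rw [← dirDeriv_frame_eq (γ := fun q => g q (frame k ε a q) (frame k ε b q)) k ε (hS z hz).2 hγ hd]
    refine le_trans ?_ (le_add_of_nonneg_left (by positivity))
    set D := fun a b c => |dirDeriv (fun q => g q (frame k ε a q) (frame k ε b q))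
      ((extChartAt (modelEnd m) ((0 : ℝ), p)).symm z)
      (frame k ε c ((extChartAt (modelEnd m) ((0 : ℝ), p)).symm z))| ^ 2 with hD
    have hD0 : ∀ a b c, 0 ≤ D a b c := fun a b c => by positivity
    exact ((Finset.single_le_sum (f := D a b) (fun _ _ => hD0 _ _ _) (Finset.mem_univ c)).trans
      (Finset.single_le_sum (f := fun b => ∑ c, D a b c)
        (fun _ _ => Finset.sum_nonneg fun _ _ => hD0 _ _ _) (Finset.mem_univ b))).trans
      (Finset.single_le_sum (f := fun a => ∑ b, ∑ c, D a b c)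
        (fun _ _ => Finset.sum_nonneg fun _ _ => Finset.sum_nonneg fun _ _ => hD0 _ _ _)
        (Finset.mem_univ a))

/-- In a chart the divergence of the mass vector is integrable, up to the assumed decay. -/
theorem exists_abs_divergence_le
    (h : Bundle.ContMDiffRiemannianMetric (𝓡 m) ∞ (ModelN m) (fun x : N => TangentSpace (𝓡 m) x))
    (hr₀ : 0 ≤ r₀) (hr₀k : 0 ≤ r₀ ^ 2 + k) (hk : -1 ≤ k) (hk' : k ≤ 1) (hr : r₀ < R₀) (hR : 2 ≤ R₀)
    {g : FormField (modelEnd m) (ℝ × N)} (hg : IsEndMetric g r₀)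
    (hequiv : UniformlyEquivalent r₀ g (refMetric (fun x u v => h.inner x u v) k))
    {V : ℝ × N → ℝ} (hV : V ∈ staticPotentials (modelEnd m) (basisEnd m)
      (refMetric (fun x u v => h.inner x u v) k) (endSet N r₀))
    (hVO : V =O[𝓟 (Ici R₀ ×ˢ univ)] fun p => p.1)
    (hdVO : differentialNorm (modelEnd m) (basisEnd m) (refMetric (fun x u v => h.inner x u v) k) V
      =O[𝓟 (Ici R₀ ×ˢ univ)] fun p => p.1) (hW : IsOpen W)
    {ε : Fin m → ∀ x : N, TangentSpace (𝓡 m) x}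
    (hε : IsOrthonormalFrameOn (fun x u v => h.inner x u v) W ε) {p : N} {K : Set (ModelN m)}
    (hK : IsCompact K)
    (hKW : K ⊆ (extChartAt (𝓡 m) p).target ∩ (extChartAt (𝓡 m) p).symm ⁻¹' W) :
    ∃ C : ℝ, 0 ≤ C ∧ ∀ z ∈ Ici R₀ ×ˢ K,
      |∑ i, pd (basisEnd m) i
        (endMass g (refMetric (fun x u v => h.inner x u v) k) V p i) z| ≤
      C * (Real.sqrt (endMatrix g p z).det *
        (|scalarCurvature (modelEnd m) (basisEnd m) g (z.1, (extChartAt (𝓡 m) p).symm z.2) -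
          scalarCurvature (modelEnd m) (basisEnd m) (refMetric (fun x u v => h.inner x u v) k)
            (z.1, (extChartAt (𝓡 m) p).symm z.2)| * z.1 +
          frameEnergy g (frame k ε) (z.1, (extChartAt (𝓡 m) p).symm z.2) * z.1)) := by
  set b := refMetric (fun x u v => h.inner x u v) k with hb_def
  have hb : IsEndMetric b r₀ := isEndMetric_refMetric h hr₀ hr₀k
  have hR1 : 1 ≤ R₀ := by linarith
  set T := (extChartAt (𝓡 m) p).target ∩ (extChartAt (𝓡 m) p).symm ⁻¹' W with hT_def
  have hT : IsOpen T := (continuousOn_extChartAt_symm p).isOpen_inter_preimage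
    (isOpen_extChartAt_target p) hW
  have hT' : IsOpen (extChartAt (𝓡 m) p).target := isOpen_extChartAt_target p
  have hKT' : K ⊆ (extChartAt (𝓡 m) p).target := hKW.trans inter_subset_left
  set S : Set (ℝ × ModelN m) := Ici R₀ ×ˢ K with hS_def
  have hSO : ∀ z ∈ S, z ∈ endDomain m r₀ p := fun z hz => ⟨hr.trans_le hz.1, hKT' hz.2⟩
  have hnhds : ∀ z ∈ S, endDomain m r₀ p ∈ 𝓝 z := fun z hz =>
    (isOpen_endDomain r₀ p).mem_nhds (hSO z hz)
  have hz1 : ∀ z ∈ S, 2 ≤ z.1 := fun z hz => hR.trans hz.1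
  set B := endMatrix b p with hB_def
  set F := endFrameMatrix k ε p with hF_def
  have hw : ∀ i, ∀ᶠ z in 𝓟 S, 0 < endWeight i z := by
    intro i
    refine eventually_principal.2 fun z hz => ?_
    have := hz1 z hz
    rcases i with ⟨⟩ | i
    · simp only [endWeight]; linarith
    · simp only [endWeight]; positivity
  have hprod : ∀ {f : ℝ → ℝ} {η : ModelN m → ℝ} {T : Set (ModelN m)} {n : ℕ∞ω}, n ≠ 0 →
      (∀ r, r₀ < r → DifferentiableAt ℝ f r) → IsOpen T → K ⊆ T → ContDiffOn ℝ n η T → ∀ z ∈ S,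
      DifferentiableAt ℝ (fun z : ℝ × ModelN m => f z.1 * η z.2) z := by
    intro f η T n hn hf hT hKT hη z hz
    exact ((hf _ (hSO z hz).1).comp z differentiableAt_fst).mul
      (((hη.differentiableOn hn).differentiableAt (hT.mem_nhds (hKT hz.2))).comp z
        differentiableAt_snd)
  choose fB σB ηB hsB hσB hηB hBe using exists_radialSymbol_refMetric h hr₀ hr₀k hk hr hR p
  have hBn : ∀ i j, ∀ z ∈ S, (fun y => fB i j y.1 * ηB i j y.2) =ᶠ[𝓝 z] fun y => B y i j := by
    intro i j z hz
    filter_upwards [hnhds z hz] with y hy using hBe i j y hy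
  have hBO : WeightedO (𝓟 S) 1 endWeight⁻¹ endWeight⁻¹ B := by
    intro i j
    refine (isBigO_prod hK ((hηB i j).continuousOn.mono hKT') (hsB i j).isBigO).congr' ?_ ?_
    · exact eventually_principal.2 fun z hz => hBe i j z (hSO z hz)
    · exact Eventually.of_forall fun z => by simp [hσB]
  have hdB : ∀ k', WeightedO (𝓟 S) (endWeight⁻¹ k') endWeight⁻¹ endWeight⁻¹
      fun z => pdMat (basisEnd m) k' B z := by
    intro k' i j
    refine (pd_isBigO_prod hr hR1 hT' hK hKT' ((hηB i j).of_le (by norm_num))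
      (hsB i j).differentiableAt (hsB i j).isBigO (hsB i j).isBigO_deriv k').congr' ?_ ?_
    · exact eventually_principal.2 fun z hz => pd_congr _ _ (hBn i j z hz)
    · exact Eventually.of_forall fun z => by simp only [hσB]; ring
  have hddB : ∀ q k' i j, (fun z => pd (basisEnd m) q (pd (basisEnd m) k' fun y => B y i j) z)
      =O[𝓟 S] fun z => endWeight⁻¹ q z * endWeight⁻¹ k' z * (endWeight⁻¹ i z * endWeight⁻¹ j z) := by
    intro q k' i j
    refine (pd_pd_isBigO_prod hr hR1 hT' hK hKT' (hηB i j) (hsB i j).differentiableAt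
      (hsB i j).differentiableAt_deriv (hsB i j).isBigO (hsB i j).isBigO_deriv
      (hsB i j).isBigO_deriv_deriv q k').congr' ?_ ?_
    · exact eventually_principal.2 fun z hz => pd_congr _ _ (pd_eventuallyEq _ _ (hBn i j z hz))
    · exact Eventually.of_forall fun z => by simp only [hσB]; ring
  choose fF σF ηF hFd hFO' hFO'' hσF hηF hFe using exists_radial_frame (R₀ := R₀) hr₀ hr₀k hk hk' hR hε p
  have hFfun : ∀ i j, (fun z => F z i j) = fun z => fF i j z.1 * ηF i j z.2 := fun i j =>
    funext fun z => (hFe i j z).symm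
  have hFdiff : ∀ z ∈ S, MatDiffAt F z := by
    intro z hz i j
    rw [hFfun]
    exact hprod one_ne_zero (hFd i j) hT hKW (hηF i j) z hz
  have hFO : WeightedO (𝓟 S) 1 endWeight 1 F := by
    intro i j
    rw [hFfun]
    refine (isBigO_prod hK ((hηF i j).continuousOn.mono hKW) (hFO' i j)).congr' EventuallyEq.rfl ?_
    exact Eventually.of_forall fun z => by simp [hσF]
  have hdF : ∀ k', WeightedO (𝓟 S) (endWeight⁻¹ k') endWeight 1
      fun z => pdMat (basisEnd m) k' F z := by
    intro k' i j
    simp only [pdMat, Matrix.of_apply]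
    rw [hFfun]
    refine (pd_isBigO_prod hr hR1 hT hK hKW (hηF i j) (hFd i j) (hFO' i j) (hFO'' i j) k').congr'
      EventuallyEq.rfl ?_
    exact Eventually.of_forall fun z => by
      simp only [hσF, Pi.one_apply, mul_one]; ring
  obtain ⟨C, hC, hCg⟩ := hequiv
  -- The square root of the energy dominates every `g_ij - δ_ij` and every frame derivative of
  -- `g_ij`. The remainder is quadratic, so its square, the energy itself, is what appears in the
  -- end.
  set ρ : ℝ × ModelN m → ℝ := fun z =>
    Real.sqrt (frameEnergy g (frame k ε) (z.1, (extChartAt (𝓡 m) p).symm z.2)) with hρ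
  -- The lower half of the uniform equivalence, rewritten for components; it controls the inverse of
  -- the matrix of `g`.
  have hGB : ∀ᶠ z in 𝓟 S, ∀ u : Unit ⊕ Fin m → ℝ,
      C⁻¹ * (u ⬝ᵥ (B z *ᵥ u)) ≤ u ⬝ᵥ (endMatrix g p z *ᵥ u) := by
    refine eventually_principal.2 fun z hz u => ?_
    have hmem : (extChartAt (modelEnd m) ((0 : ℝ), p)).symm z ∈ endSet N r₀ :=
      ⟨(hSO z hz).1, mem_univ _⟩
    have hq : ∀ {T : FormField (modelEnd m) (ℝ × N)}, IsEndMetric T r₀ →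
        u ⬝ᵥ (endMatrix T p z *ᵥ u) = T ((extChartAt (modelEnd m) ((0 : ℝ), p)).symm z)
          (∑ i, u i • mfderiv 𝓘(ℝ, ℝ × ModelN m) (modelEnd m)
            (extChartAt (modelEnd m) ((0 : ℝ), p)).symm z (basisEnd m i))
          (∑ i, u i • mfderiv 𝓘(ℝ, ℝ × ModelN m) (modelEnd m)
            (extChartAt (modelEnd m) ((0 : ℝ), p)).symm z (basisEnd m i)) := by
      intro T hT
      rw [(hT.bilin _ hmem).sum_smul]
      simp only [dotProduct, mulVec, Finset.mul_sum, endMatrix, localForm, of_apply]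
      exact Finset.sum_congr rfl fun i _ => Finset.sum_congr rfl fun j _ => by ring
    rw [hq hg, hq hb]
    exact (hCg _ hmem _).1
  have hpt : Tendsto (fun z : ℝ × ModelN m => (z.1, (extChartAt (𝓡 m) p).symm z.2)) (𝓟 S)
      (𝓟 (Ici R₀ ×ˢ univ)) :=
    tendsto_principal_principal.2 fun z hz => ⟨hz.1, mem_univ _⟩
  obtain ⟨hP, hdP⟩ := isBigO_sqrt_frameEnergy (k := k) (ε := ε) hg hSO hFdiff
  have hrem : massRemainder (basisEnd m) (endMatrix g p) B (endFun V p) =O[𝓟 S]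
      fun z => z.1 * ρ z ^ 2 := by
    refine massRemainder_isBigO_of_frame (F := F) (basisEnd m) hw
      (eventually_principal.2 fun z hz => hg.isMetricAt (hSO z hz))
      (eventually_principal.2 fun z hz => hb.isMetricAt (hSO z hz))
      (eventually_principal.2 fun z hz => ?_) (eventually_principal.2 hFdiff) hFO hdF hBO hdB hddB
      (inv_pos.2 hC) hGB hP hdP (hVO.comp_tendsto hpt) ?_
    · have hO : IsOpen {z : ℝ × ModelN m | r₀ < z.1 ∧ z.2 ∈ T} := isOpen_Ioi.prod hT
      filter_upwards [hO.mem_nhds ⟨(hSO z hz).1, hKW hz.2⟩] with y hy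
      exact orthonormal_endFrameMatrix h hr₀ hr₀k hε ⟨hy.1, hy.2.1⟩ hy.2.2
    · refine (hdVO.comp_tendsto hpt).congr' (eventually_principal.2 fun z hz => ?_) EventuallyEq.rfl
      exact hb.differentialNorm_eq hV.1 (hSO z hz)
  obtain ⟨C₁, hC₁⟩ := hrem.bound
  obtain ⟨C₂, hC₂⟩ := (hVO.comp_tendsto hpt).bound
  rw [eventually_principal] at hC₁ hC₂
  refine ⟨|C₁| + |C₂|, by positivity, fun z hz => ?_⟩
  have hzO := hSO z hz
  have hz2 := hz1 z hz
  -- The exact identity leaves two terms: `V = O(r)` handles the curvature difference, and `hrem`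
  -- handles the quadratic remainder.
  have hdiv := sum_pd_massVector (hg.isMetricAt hzO) (hb.isMetricAt hzO) (contDiffAt_endFun hV.1 hzO)
    (basisEnd m) (hb.laplacian_eq_of_static hV hzO) (hb.hessian_eq_of_static hV hzO)
  rw [hg.scalarCurvature_eq hzO, hb.scalarCurvature_eq hzO]
  refine (congrArg abs hdiv).trans_le ?_
  rw [abs_mul, abs_of_nonneg (Real.sqrt_nonneg _), mul_left_comm]
  refine mul_le_mul_of_nonneg_left ?_ (Real.sqrt_nonneg _)
  have e1 := hC₁ z hz
  have e2 := hC₂ z hz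
  have hρ2 : ρ z ^ 2 = frameEnergy g (frame k ε) (z.1, (extChartAt (𝓡 m) p).symm z.2) :=
    Real.sq_sqrt (frameEnergy_nonneg _ _ _)
  rw [Real.norm_eq_abs, Real.norm_eq_abs, hρ2, abs_mul, abs_of_nonneg (frameEnergy_nonneg _ _ _),
    abs_of_nonneg (by linarith : (0 : ℝ) ≤ z.1)] at e1
  simp only [Function.comp, Real.norm_eq_abs] at e2
  rw [abs_of_nonneg (by linarith : (0 : ℝ) ≤ z.1)] at e2
  set f := frameEnergy g (frame k ε) (z.1, (extChartAt (𝓡 m) p).symm z.2) with hf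
  have hf0 : 0 ≤ f := frameEnergy_nonneg _ _ _
  set s := |scalar (basisEnd m) (endMatrix g p) z - scalar (basisEnd m) (endMatrix b p) z| with hs
  have hs0 : 0 ≤ s := abs_nonneg _
  have hz0 : 0 ≤ z.1 := by linarith
  have e3 : |endFun V p z| ≤ |C₂| * z.1 :=
    e2.trans (mul_le_mul_of_nonneg_right (le_abs_self _) hz0)
  have e4 : |massRemainder (basisEnd m) (endMatrix g p) B (endFun V p) z| ≤ |C₁| * (z.1 * f) :=
    e1.trans (mul_le_mul_of_nonneg_right (le_abs_self _) (by positivity))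
  calc _ ≤ |endFun V p z * (scalar (basisEnd m) (endMatrix g p) z -
          scalar (basisEnd m) (endMatrix b p) z)| +
        |massRemainder (basisEnd m) (endMatrix g p) B (endFun V p) z| := abs_add_le _ _
    _ ≤ |C₂| * z.1 * s + |C₁| * (z.1 * f) := by
        rw [abs_mul]
        exact add_le_add (mul_le_mul_of_nonneg_right e3 hs0) e4
    _ ≤ (|C₁| + |C₂|) * (s * z.1 + f * z.1) := by
        have h1 : 0 ≤ |C₁| * (s * z.1) := by positivity
        have h2 : 0 ≤ |C₂| * (f * z.1) := by positivity
        nlinarith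

end DivergenceEstimate

/-! ### The Riemannian measure and its restriction to charts. -/

section ChartVolume

open Matrix

variable {E : Type*} [NormedAddCommGroup E] [NormedSpace ℝ E] [FiniteDimensional ℝ E]
  [MeasurableSpace E] [BorelSpace E]
  {H : Type*} [TopologicalSpace H] {I : ModelWithCorners ℝ E H} [I.Boundaryless]
  {X : Type*} [TopologicalSpace X] [ChartedSpace H X] [MeasurableSpace X] [BorelSpace X]
  {ι : Type*} [Fintype ι] [DecidableEq ι]

lemma aemeasurable_extChartAt_symm (p : X) (μ : Measure E) :
    AEMeasurable (extChartAt I p).symm (μ.restrict (extChartAt I p).target) :=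
  (continuousOn_extChartAt_symm p).aemeasurable (isOpen_extChartAt_target p).measurableSet

/-- The inverse chart is controlled only on its target; replacing it by a constant elsewhere gives a
globally measurable map with the same preimage inside the target. -/
lemma measurableSet_preimage_symm (p : X) {s : Set X} (hs : MeasurableSet s) :
    MeasurableSet ((extChartAt I p).symm ⁻¹' s ∩ (extChartAt I p).target) := by
  classical
  have h := ContinuousOn.measurable_piecewise (continuousOn_extChartAt_symm (I := I) p)
    (continuousOn_const (c := p)) (isOpen_extChartAt_target p).measurableSet
  have h2 : (extChartAt I p).symm ⁻¹' s ∩ (extChartAt I p).target =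
      (extChartAt I p).target.piecewise (extChartAt I p).symm (fun _ => p) ⁻¹' s ∩
        (extChartAt I p).target := by
    ext y
    simp only [mem_inter_iff, mem_preimage]
    refine and_congr_left fun hy => ?_
    rw [piecewise_eq_of_mem _ _ _ hy]
  rw [h2]
  exact (h hs).inter (isOpen_extChartAt_target p).measurableSet

lemma chartVolume_restrict (e : Module.Basis ι ℝ E) (T : FormField I X) (p : X) {s : Set X}
    (hs : MeasurableSet s) : (chartVolume I e T p).restrict s =
      ((e.addHaar.restrict ((extChartAt I p).symm ⁻¹' s ∩ (extChartAt I p).target)).withDensity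
        fun y => ENNReal.ofReal (Real.sqrt (localForm I e T p y).det)).map (extChartAt I p).symm := by
  rw [chartVolume, Measure.restrict_map_of_aemeasurable ((aemeasurable_extChartAt_symm p _).mono_ac
    (withDensity_absolutelyContinuous _ _)) hs, restrict_withDensity',
    Measure.restrict_restrict' (isOpen_extChartAt_target p).measurableSet]

lemma chartVolume_apply (e : Module.Basis ι ℝ E) (T : FormField I X) (p : X) {s : Set X}
    (hs : MeasurableSet s) : chartVolume I e T p s =
      ∫⁻ y in (extChartAt I p).symm ⁻¹' s ∩ (extChartAt I p).target,
        ENNReal.ofReal (Real.sqrt (localForm I e T p y).det) ∂e.addHaar := by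
  rw [chartVolume, Measure.map_apply_of_aemeasurable ((aemeasurable_extChartAt_symm p _).mono_ac
    (withDensity_absolutelyContinuous _ _)) hs, withDensity_apply',
    Measure.restrict_restrict' (isOpen_extChartAt_target p).measurableSet]

/-- The integral over a chart is controlled by the integral for the chart measure; the integrand
need not be measurable. -/
lemma lintegral_chart_le (e : Module.Basis ι ℝ E) (T : FormField I X) (p : X) {s : Set X}
    (hs : MeasurableSet s)
    (hT : AEMeasurable (fun y => ENNReal.ofReal (Real.sqrt (localForm I e T p y).det))
      (e.addHaar.restrict ((extChartAt I p).symm ⁻¹' s ∩ (extChartAt I p).target)))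
    (f : X → ENNReal) :
    ∫⁻ y in (extChartAt I p).symm ⁻¹' s ∩ (extChartAt I p).target,
      ENNReal.ofReal (Real.sqrt (localForm I e T p y).det) * f ((extChartAt I p).symm y) ∂e.addHaar ≤
    ∫⁻ x in s, f x ∂(riemannianVolume I e T) := by
  classical
  set A := (extChartAt I p).symm ⁻¹' s ∩ (extChartAt I p).target with hA
  have hAm : MeasurableSet A := measurableSet_preimage_symm p hs
  set d : E → ENNReal := fun y => ENNReal.ofReal (Real.sqrt (localForm I e T p y).det) with hd
  have h1 : ∫⁻ y in A, d y * f ((extChartAt I p).symm y) ∂e.addHaar =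
      ∫⁻ y, f ((extChartAt I p).symm y) ∂((e.addHaar.restrict A).withDensity d) :=
    (lintegral_withDensity_eq_lintegral_mul_non_measurable₀ _ hT
      (Eventually.of_forall fun _ => ENNReal.ofReal_lt_top) _).symm
  have h2 : ∫⁻ x in s, f x ∂(chartVolume I e T p) ≤ ∫⁻ x in s, f x ∂(riemannianVolume I e T) :=
    lintegral_mono' (Measure.restrict_mono le_rfl (le_iSup (chartVolume I e T) p)) le_rfl
  rw [h1]
  refine le_trans ?_ h2
  rw [chartVolume_restrict e T p hs]
  -- The lower integral is attained by a measurable minorant. Carried to `X` by the chart and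
  -- extended by zero it is a measurable minorant of `f`, to which the formula for image measures
  -- applies.
  obtain ⟨G, hG, hGf, hGe⟩ := exists_measurable_le_lintegral_eq
    ((e.addHaar.restrict A).withDensity d) fun y => f ((extChartAt I p).symm y)
  rw [hGe]
  have hsymm : AEMeasurable (extChartAt I p).symm ((e.addHaar.restrict A).withDensity d) :=
    ((aemeasurable_extChartAt_symm p e.addHaar).mono_measure
      (Measure.restrict_mono inter_subset_right le_rfl)).mono_ac (withDensity_absolutelyContinuous _ _)
  have hφ : Measurable ((extChartAt I p).source.piecewise (extChartAt I p) fun _ => 0) :=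
    ContinuousOn.measurable_piecewise (continuousOn_extChartAt p) continuousOn_const
      (isOpen_extChartAt_source p).measurableSet
  set G' : X → ENNReal := (extChartAt I p).source.indicator fun x =>
    G ((extChartAt I p).source.piecewise (extChartAt I p) (fun _ => 0) x) with hG'
  have hG'm : Measurable G' := (hG.comp hφ).indicator (isOpen_extChartAt_source p).measurableSet
  have hG'f : G' ≤ f := by
    intro x
    by_cases hx : x ∈ (extChartAt I p).source
    · rw [hG', indicator_of_mem hx, piecewise_eq_of_mem _ _ _ hx]
      refine (hGf _).trans ?_
      simp only [(extChartAt I p).left_inv hx, le_refl]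
    · rw [hG', indicator_of_notMem hx]
      exact zero_le
  refine le_trans (le_of_eq ?_) (lintegral_mono hG'f)
  rw [lintegral_map' hG'm.aemeasurable hsymm]
  refine lintegral_congr_ae ((withDensity_absolutelyContinuous _ _).ae_le ?_)
  filter_upwards [ae_restrict_mem hAm] with y hy
  have hy' := (extChartAt I p).map_target hy.2
  rw [hG', indicator_of_mem hy', piecewise_eq_of_mem _ _ _ hy', (extChartAt I p).right_inv hy.2]

variable [IsManifold I ∞ X]

omit [FiniteDimensional ℝ E] [MeasurableSpace E] [BorelSpace E] [MeasurableSpace X] [BorelSpace X] in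
lemma det_fderiv_eq_jac (e : Module.Basis ι ℝ E) {ψ : E → E} {y : E} (hψ : DifferentiableAt ℝ ψ y) :
    (fderiv ℝ ψ y).det = (jac e ψ y).det := by
  rw [ContinuousLinearMap.det, ← LinearMap.det_toMatrix e]
  congr 1
  ext a i
  rw [jac_apply e hψ, LinearMap.toMatrix_apply]
  rfl

variable {T : FormField I X}

/-- Change of variables by the transition map: `√det` is multiplied by `|det J|`, the Jacobian
factor of the integral. An inequality suffices, since it is applied to every chart of the supremum.
-/
lemma chartVolume_restrict_source_le (e : Module.Basis ι ℝ E) (hbil : ∀ x, IsBilinAt T x) (p q : X) :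
    (chartVolume I e T q).restrict (extChartAt I p).source ≤ chartVolume I e T p := by
  refine Measure.le_iff.2 fun s hs => ?_
  have hsrc : MeasurableSet (extChartAt I p).source := (isOpen_extChartAt_source p).measurableSet
  rw [Measure.restrict_apply hs, chartVolume_apply e T q (hs.inter hsrc), chartVolume_apply e T p hs]
  set A := (extChartAt I q).symm ⁻¹' (s ∩ (extChartAt I p).source) ∩ (extChartAt I q).target with hA
  have hAm : MeasurableSet A := measurableSet_preimage_symm q (hs.inter hsrc)
  have hAd : A ⊆ transitionDomain I q p := fun y hy => ⟨hy.2, hy.1.2⟩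
  set ψ := transition I q p with hψ
  have hd : ∀ y ∈ A, DifferentiableAt ℝ ψ y := fun y hy =>
    (contDiffAt_transition (hAd hy)).differentiableAt (by simp)
  have hinj : InjOn ψ A := by
    intro y hy y' hy' h
    rw [← transition_transition (hAd hy), ← transition_transition (hAd hy'), ← hψ, h]
  have h1 : ∫⁻ y in A, ENNReal.ofReal (Real.sqrt (localForm I e T q y).det) ∂e.addHaar =
      ∫⁻ y in ψ '' A, ENNReal.ofReal (Real.sqrt (localForm I e T p y).det) ∂e.addHaar := by
    rw [lintegral_image_eq_lintegral_abs_det_fderiv_mul e.addHaar hAm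
      (fun y hy => (hd y hy).hasFDerivAt.hasFDerivWithinAt) hinj]
    refine setLIntegral_congr_fun hAm fun y hy => ?_
    rw [← ENNReal.ofReal_mul (abs_nonneg _), det_fderiv_eq_jac e (hd y hy),
      localForm_transition e (hAd hy) (hbil _), Matrix.det_mul, Matrix.det_mul,
      Matrix.det_transpose, ← hψ, show (jac e ψ y).det * (localForm I e T p (ψ y)).det *
        (jac e ψ y).det = (jac e ψ y).det ^ 2 * (localForm I e T p (ψ y)).det by ring,
      Real.sqrt_mul (sq_nonneg _), Real.sqrt_sq_eq_abs]
  rw [h1]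
  refine lintegral_mono_set ?_
  rintro _ ⟨y, hy, rfl⟩
  refine ⟨?_, (transition_mem (hAd hy)).1⟩
  rw [mem_preimage, hψ, symm_transition (hAd hy)]
  exact hy.1.1

/-- The Riemannian measure restricts to the chart measures. -/
lemma riemannianVolume_restrict_source (e : Module.Basis ι ℝ E) (hbil : ∀ x, IsBilinAt T x) (p : X) :
    (riemannianVolume I e T).restrict (extChartAt I p).source = chartVolume I e T p := by
  set S := (extChartAt I p).source with hS
  have hSm : MeasurableSet S := (isOpen_extChartAt_source p).measurableSet
  have hself : (chartVolume I e T p).restrict S = chartVolume I e T p := by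
    rw [chartVolume_restrict e T p hSm, chartVolume]
    congr 3
    exact inter_eq_right.2 fun y hy => (extChartAt I p).map_target hy
  refine le_antisymm ?_ ?_
  -- On the chart domain every chart measure lies below the one at `p`, and off the domain below the
  -- supremum. The sum of these two bounds therefore dominates the supremum.
  · have h1 : riemannianVolume I e T ≤
        chartVolume I e T p + (riemannianVolume I e T).restrict Sᶜ := by
      refine iSup_le fun q => ?_
      rw [← Measure.restrict_add_restrict_compl (μ := chartVolume I e T q) hSm]
      exact add_le_add (chartVolume_restrict_source_le e hbil p q)
        (Measure.restrict_mono le_rfl (le_iSup (chartVolume I e T) q))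
    refine (Measure.restrict_mono le_rfl h1).trans ?_
    rw [Measure.restrict_add, hself, Measure.restrict_restrict hSm, inter_compl_self,
      Measure.restrict_empty, add_zero]
  · rw [← hself]
    exact Measure.restrict_mono le_rfl (le_iSup (chartVolume I e T) p)

lemma chartVolume_lt_top_of_isCompact (e : Module.Basis ι ℝ E) {p : X}
    (hc : ContinuousOn (fun y => Real.sqrt (localForm I e T p y).det) (extChartAt I p).target)
    {K : Set E} (hK : IsCompact K) (hKT : K ⊆ (extChartAt I p).target) :
    ∫⁻ y in K, ENNReal.ofReal (Real.sqrt (localForm I e T p y).det) ∂e.addHaar < ⊤ := by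
  obtain ⟨C, hC⟩ := hK.exists_bound_of_continuousOn (hc.mono hKT)
  refine (setLIntegral_lt_top_of_isCompact (μ := e.addHaar) hK.measure_lt_top.ne hK
    (f := fun _ => C.toNNReal) continuous_const).trans_le' ?_
  refine setLIntegral_mono' hK.measurableSet fun y hy => ?_
  exact ENNReal.ofReal_le_ofReal ((le_abs_self _).trans (hC y hy))

/-- A point has a compact neighbourhood inside a chart, on which the density `√det` is bounded. -/
lemma isLocallyFiniteMeasure_riemannianVolume [T2Space X] (e : Module.Basis ι ℝ E)
    (hbil : ∀ x, IsBilinAt T x)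
    (hc : ∀ p, ContinuousOn (fun y => Real.sqrt (localForm I e T p y).det) (extChartAt I p).target) :
    IsLocallyFiniteMeasure (riemannianVolume I e T) := by
  refine ⟨fun x => ?_⟩
  obtain ⟨K, hKx, hKT, hK⟩ := local_compact_nhds
    ((isOpen_extChartAt_target (I := I) x).mem_nhds (mem_extChartAt_target x))
  have hKs : (extChartAt I x).symm '' K ⊆ (extChartAt I x).source := by
    rintro _ ⟨y, hy, rfl⟩; exact (extChartAt I x).map_target (hKT hy)
  have hcK : IsCompact ((extChartAt I x).symm '' K) :=
    hK.image_of_continuousOn ((continuousOn_extChartAt_symm x).mono hKT)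
  refine ⟨(extChartAt I x).symm '' K, ?_, ?_⟩
  · have h1 : (extChartAt I x) ⁻¹' K ∈ 𝓝 x := (continuousAt_extChartAt x).preimage_mem_nhds hKx
    filter_upwards [h1, extChartAt_source_mem_nhds (I := I) x] with y hy hy'
    exact ⟨_, hy, (extChartAt I x).left_inv hy'⟩
  · have hm := hcK.measurableSet
    rw [← inter_eq_left.2 hKs, ← Measure.restrict_apply hm,
      riemannianVolume_restrict_source e hbil x, chartVolume_apply e T x hm]
    refine lt_of_le_of_lt (lintegral_mono_set ?_) (chartVolume_lt_top_of_isCompact e (hc x) hK hKT)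
    rintro y ⟨⟨y', hy', h⟩, hy⟩
    have := (extChartAt I x).symm.injOn (hKT hy') hy h
    rwa [← this]

/-- The integral of a function supported in a chart domain. -/
lemma integral_riemannianVolume_of_support (e : Module.Basis ι ℝ E) (hbil : ∀ x, IsBilinAt T x)
    {p : X} (hc : ContinuousOn (fun y => Real.sqrt (localForm I e T p y).det) (extChartAt I p).target)
    {f : X → ℝ} (hf : Measurable f) (hsupp : ∀ x ∉ (extChartAt I p).source, f x = 0) :
    ∫ x, f x ∂(riemannianVolume I e T) = ∫ y in (extChartAt I p).target,
      Real.sqrt (localForm I e T p y).det * f ((extChartAt I p).symm y) ∂e.addHaar := by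
  have hm := (isOpen_extChartAt_target (I := I) p).measurableSet
  rw [← setIntegral_eq_integral_of_forall_compl_eq_zero hsupp,
    riemannianVolume_restrict_source e hbil p, chartVolume,
    integral_map ((aemeasurable_extChartAt_symm p _).mono_ac
      (withDensity_absolutelyContinuous _ _)) hf.aestronglyMeasurable,
    integral_withDensity_eq_integral_toReal_smul₀ (hc.aemeasurable hm).ennreal_ofReal
      (Eventually.of_forall fun _ => ENNReal.ofReal_lt_top)]
  refine integral_congr_ae (Eventually.of_forall fun y => ?_)
  simp only [ENNReal.toReal_ofReal (Real.sqrt_nonneg _), smul_eq_mul]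

end ChartVolume

/-! ### Differentiation of integrals over the slices `{r = R}` in a chart. -/

section Slices

open Matrix

variable {E : Type*} [NormedAddCommGroup E] [NormedSpace ℝ E]
  {ι : Type*} [Fintype ι] [DecidableEq ι]

/-- The mass vector contains one derivative of the metrics and of `V`, so `C²` data make it `C¹`:
just enough for a continuous divergence. -/
lemma contDiffAt_massVector {e : Module.Basis ι ℝ E} {G B : E → Matrix ι ι ℝ} {V : E → ℝ} {y : E}
    (hG : IsMetricAt G y) (hB : IsMetricAt B y) (hV : ContDiffAt ℝ 2 V y) (i : ι) :
    ContDiffAt ℝ 1 (massVector e G B V i) y := by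
  have hi : ∀ a b, ContDiffAt ℝ 1 (fun z => (G z)⁻¹ a b) y := fun a b =>
    (hG.contDiffAt_inv a b).of_le (by norm_num)
  have hg : ∀ a b, ContDiffAt ℝ 1 (fun z => G z a b) y := fun a b =>
    (hG.contDiff a b).of_le (by norm_num)
  have hb : ∀ a b, ContDiffAt ℝ 1 (fun z => B z a b) y := fun a b =>
    (hB.contDiff a b).of_le (by norm_num)
  have hs : ContDiffAt ℝ 1 (fun z => Real.sqrt (G z).det) y :=
    hG.contDiffAt_sqrt_det.of_le (by norm_num)
  have hdV : ∀ a, ContDiffAt ℝ 1 (pd e a V) y := fun a => contDiffAt_pd e a hV (by norm_num)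
  have hup : ∀ a, ContDiffAt ℝ 1 (gradUp e G V a) y := fun a =>
    ContDiffAt.sum fun j _ => (hi a j).mul (hdV j)
  have hcov : ∀ a b c, ContDiffAt ℝ 1 (covDeriv e B G a b c) y := fun a b c =>
    (contDiffAt_pd e a (hG.contDiff b c) (by norm_num)).sub (ContDiffAt.sum fun q _ =>
      ((hB.contDiffAt_christoffel e q a b).mul (hg q c)).add
        ((hB.contDiffAt_christoffel e q a c).mul (hg b q)))
  unfold massVector
  exact (contDiffAt_const.mul hs).mul (((hV.of_le (by norm_num)).mul (ContDiffAt.sum fun j _ =>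
    ContDiffAt.sum fun k _ => ContDiffAt.sum fun l _ => (contDiffAt_const.mul
      (((hi i k).mul (hi j l)).sub ((hi i j).mul (hi k l)))).mul (hcov j k l))).add
    (ContDiffAt.sum fun j _ => ContDiffAt.sum fun k _ => (contDiffAt_const.mul
      (((hup i).mul (hi j k)).sub ((hup j).mul (hi i k)))).mul ((hg j k).sub (hb j k))))

/-- Provides measurability of the curvature integrand in a chart, which allows the integral of the
bound on the divergence to be split. -/
lemma continuousAt_scalar {e : Module.Basis ι ℝ E} {G : E → Matrix ι ι ℝ} {y : E}
    (hG : IsMetricAt G y) : ContinuousAt (scalar e G) y := by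
  have hi : ∀ a b, ContinuousAt (fun z => (G z)⁻¹ a b) y := fun a b =>
    (hG.contDiffAt_inv a b).continuousAt
  have hc : ∀ a b c, ContinuousAt (christoffel e G a b c) y := fun a b c =>
    (hG.contDiffAt_christoffel e a b c).continuousAt
  have hd : ∀ q a b c, ContinuousAt (pd e q (christoffel e G a b c)) y := fun q a b c =>
    (contDiffAt_pd (k := 0) e q (hG.contDiffAt_christoffel e a b c) (by norm_num)).continuousAt
  unfold scalar
  refine tendsto_finsetSum _ fun i _ => tendsto_finsetSum _ fun j _ => (hi i j).mul ?_
  unfold ricci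
  exact ContinuousAt.add (tendsto_finsetSum _ fun q _ => (hd _ _ _ _).sub (hd _ _ _ _))
    (tendsto_finsetSum _ fun q _ => tendsto_finsetSum _ fun l _ =>
      ((hc _ _ _).mul (hc _ _ _)).sub ((hc _ _ _).mul (hc _ _ _)))

variable {m : ℕ} {r₀ R : ℝ} {K : Set (ModelN m)} {w : ℝ × ModelN m → ℝ}

lemma integrable_slice {μ : Measure (ModelN m)} [IsFiniteMeasureOnCompacts μ]
    (hw : ContinuousOn w (Ioi r₀ ×ˢ univ)) (hR : r₀ < R) (hK : IsCompact K)
    (hsupp : ∀ z, r₀ < z.1 → z.2 ∉ K → w z = 0) : Integrable (fun y => w (R, y)) μ := by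
  have hc : Continuous fun y => w (R, y) :=
    hw.comp_continuous (by fun_prop) fun y => ⟨hR, mem_univ _⟩
  exact hc.integrable_of_hasCompactSupport
    (HasCompactSupport.intro hK fun y hy => hsupp (R, y) hR hy)

lemma pd_eq_zero_of_support (hK : IsCompact K) (hsupp : ∀ z, r₀ < z.1 → z.2 ∉ K → w z = 0)
    (i : Unit ⊕ Fin m) (z : ℝ × ModelN m) (hz : r₀ < z.1) (hzK : z.2 ∉ K) :
    pd (basisEnd m) i w z = 0 := by
  have h1 : w =ᶠ[𝓝 z] fun _ => 0 := by
    have hO : IsOpen (Ioi r₀ ×ˢ Kᶜ : Set (ℝ × ModelN m)) := isOpen_Ioi.prod hK.isClosed.isOpen_compl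
    filter_upwards [hO.mem_nhds ⟨hz, hzK⟩] with y hy using hsupp y hy.1 hy.2
  rw [pd_congr _ _ h1, pd_const]

lemma isOpen_slab : IsOpen (Ioi r₀ ×ˢ univ : Set (ℝ × ModelN m)) := isOpen_Ioi.prod isOpen_univ

lemma continuousOn_pd_slab (hw : ContDiffOn ℝ 1 w (Ioi r₀ ×ˢ univ)) (i : Unit ⊕ Fin m) :
    ContinuousOn (pd (basisEnd m) i w) (Ioi r₀ ×ˢ univ) := fun z hz =>
  (contDiffAt_pd (k := 0) (basisEnd m) i (hw.contDiffAt (isOpen_slab.mem_nhds hz))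
    (by norm_num)).continuousAt.continuousWithinAt

/-- Differentiation under the integral sign: for radii in a compact interval the radial derivative
is supported in `K` and bounded there, so a constant on `K` dominates. -/
lemma hasDerivAt_integral_slice {μ : Measure (ModelN m)} [IsFiniteMeasureOnCompacts μ]
    (hw : ContDiffOn ℝ 1 w (Ioi r₀ ×ˢ univ)) (hR : r₀ < R) (hK : IsCompact K)
    (hsupp : ∀ z, r₀ < z.1 → z.2 ∉ K → w z = 0) :
    HasDerivAt (fun s => ∫ y, w (s, y) ∂μ) (∫ y, pd (basisEnd m) (Sum.inl ()) w (R, y) ∂μ) R := by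
  obtain ⟨a, ha, haR⟩ := exists_between hR
  set J : Set ℝ := Icc a (R + 1) with hJ
  have hJr : ∀ s ∈ J, r₀ < s := fun s hs => ha.trans_le hs.1
  obtain ⟨C, hC⟩ := (isCompact_Icc.prod hK : IsCompact (J ×ˢ K)).exists_bound_of_continuousOn
    ((continuousOn_pd_slab hw (Sum.inl ())).mono fun z hz => ⟨hJr _ hz.1, mem_univ _⟩)
  refine (hasDerivAt_integral_of_dominated_loc_of_deriv_le (s := J)
    (bound := K.indicator fun _ => C) (F' := fun s y => pd (basisEnd m) (Sum.inl ()) w (s, y))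
    (Icc_mem_nhds haR (by linarith)) ?_ (integrable_slice hw.continuousOn hR hK hsupp)
    (integrable_slice (continuousOn_pd_slab hw _) hR hK
      (pd_eq_zero_of_support hK hsupp _)).aestronglyMeasurable
    (Eventually.of_forall fun y s hs => ?_) ?_ (Eventually.of_forall fun y s hs => ?_)).2
  · filter_upwards [lt_mem_nhds hR] with s hs using
      (integrable_slice hw.continuousOn hs hK hsupp).aestronglyMeasurable
  · by_cases hy : y ∈ K
    · rw [indicator_of_mem hy]; exact hC (s, y) ⟨hs, hy⟩
    · rw [indicator_of_notMem hy, pd_eq_zero_of_support hK hsupp _ _ (hJr s hs) hy, norm_zero]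
  · exact (integrable_indicator_iff hK.measurableSet).2 (integrableOn_const hK.measure_lt_top.ne)
  · have h1 := ((hw.contDiffAt (isOpen_slab.mem_nhds (mk_mem_prod (hJr s hs) (mem_univ y)))).differentiableAt
      (by norm_num)).hasFDerivAt.comp_hasDerivAt s ((hasDerivAt_id s).prodMk (hasDerivAt_const s y))
    rw [pd, basisEnd_inl]
    exact h1

/-- Integration by parts against the constant function 1; the compact support removes boundary
terms. -/
lemma integral_pd_slice_eq_zero {μ : Measure (ModelN m)} [μ.IsAddHaarMeasure]
    (hw : ContDiffOn ℝ 1 w (Ioi r₀ ×ˢ univ)) (hR : r₀ < R) (hK : IsCompact K)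
    (hsupp : ∀ z, r₀ < z.1 → z.2 ∉ K → w z = 0) (A : Fin m) :
    ∫ y, pd (basisEnd m) (Sum.inr A) w (R, y) ∂μ = 0 := by
  have hd : ∀ y, HasFDerivAt (fun y => w (R, y)) ((fderiv ℝ w (R, y)).comp
      (ContinuousLinearMap.inr ℝ ℝ (ModelN m))) y := fun y =>
    ((hw.contDiffAt (isOpen_slab.mem_nhds (mk_mem_prod hR (mem_univ y)))).differentiableAt
      (by norm_num)).hasFDerivAt.comp y (hasFDerivAt_prodMk_right R y)
  have he : ∀ y, fderiv ℝ (fun y => w (R, y)) y (basisN m A) =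
      pd (basisEnd m) (Sum.inr A) w (R, y) := fun y => by
    rw [(hd y).fderiv, pd, basisEnd_inr]; rfl
  have h1 := integral_mul_fderiv_eq_neg_fderiv_mul_of_integrable (μ := μ) (𝕜 := ℝ)
    (f := fun _ : ModelN m => (1 : ℝ)) (g := fun y => w (R, y)) (v := basisN m A) (by simp)
    (by
      simp only [he, one_mul]
      exact integrable_slice (continuousOn_pd_slab hw _) hR hK (pd_eq_zero_of_support hK hsupp _))
    (by
      simp only [one_mul]
      exact integrable_slice hw.continuousOn hR hK hsupp)
    (fun y _ => differentiableAt_const _) (fun y _ => (hd y).differentiableAt)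
  simpa [he] using h1

/-- Differentiation of the integral of `η uʳ` over the slices `{r = R}`. -/
lemma hasDerivAt_integral_mul {μ : Measure (ModelN m)} [μ.IsAddHaarMeasure]
    {u : Unit ⊕ Fin m → ℝ × ModelN m → ℝ} {O : Set (ModelN m)} (hO : IsOpen O)
    (hu : ∀ i, ContDiffOn ℝ 1 (u i) (Ioi r₀ ×ˢ O)) {η : ModelN m → ℝ} (hη : ContDiff ℝ 1 η)
    (hR : r₀ < R) (hK : IsCompact K) (hKO : K ⊆ O) (hηK : ∀ y ∉ K, η y = 0) :
    HasDerivAt (fun s => ∫ y, η y * u (Sum.inl ()) (s, y) ∂μ)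
      ((∫ y, η y * ∑ i, pd (basisEnd m) i (u i) (R, y) ∂μ) +
        ∫ y, ∑ A, pd (basisN m) A η y * u (Sum.inr A) (R, y) ∂μ) R := by
  -- Multiplying by the cutoff extends the field by zero to all of the slab; away from `K` the
  -- extension vanishes in a neighbourhood, so it stays `C¹`.
  set w : Unit ⊕ Fin m → ℝ × ModelN m → ℝ := fun i z => η z.2 * u i z with hw_def
  have hsupp : ∀ i z, r₀ < z.1 → z.2 ∉ K → w i z = 0 := fun i z _ hz => by
    simp only [hw_def, hηK _ hz, zero_mul]
  have hOo : IsOpen (Ioi r₀ ×ˢ O : Set (ℝ × ModelN m)) := isOpen_Ioi.prod hO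
  have huo : ∀ i z, z ∈ Ioi r₀ ×ˢ O → ContDiffAt ℝ 1 (u i) z := fun i z hz =>
    (hu i).contDiffAt (hOo.mem_nhds hz)
  have hw : ∀ i, ContDiffOn ℝ 1 (w i) (Ioi r₀ ×ˢ univ) := by
    intro i z hz
    refine ContDiffAt.contDiffWithinAt ?_
    by_cases hzK : z.2 ∈ K
    · exact (hη.contDiffAt.comp z contDiffAt_snd).mul (huo i z ⟨hz.1, hKO hzK⟩)
    · have hU : IsOpen (Ioi r₀ ×ˢ Kᶜ : Set (ℝ × ModelN m)) :=
        isOpen_Ioi.prod hK.isClosed.isOpen_compl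
      refine (contDiffAt_const (c := 0)).congr_of_eventuallyEq ?_
      filter_upwards [hU.mem_nhds ⟨hz.1, hzK⟩] with y hy using hsupp i y hy.1 hy.2
  have hpd : ∀ i y, pd (basisEnd m) i (w i) (R, y) = η y * pd (basisEnd m) i (u i) (R, y) +
      pd (basisEnd m) i (fun z => η z.2) (R, y) * u i (R, y) := by
    intro i y
    by_cases hyK : y ∈ K
    · have hη' : DifferentiableAt ℝ (fun z : ℝ × ModelN m => η z.2) (R, y) :=
        (hη.differentiable (by norm_num)).differentiableAt.comp (R, y) differentiableAt_snd
      refine (pd_mul (basisEnd m) i hη'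
        ((huo i (R, y) ⟨hR, hKO hyK⟩).differentiableAt (by norm_num))).trans ?_
      ring
    · rw [pd_eq_zero_of_support hK (hsupp i) i (R, y) hR hyK, pd_eq_zero_of_support (r₀ := r₀) hK
        (w := fun z => η z.2) (fun z _ hz => hηK _ hz) i (R, y) hR hyK, hηK y hyK]
      ring
  have hηl : ∀ y, pd (basisEnd m) (Sum.inl ()) (fun z => η z.2) (R, y) = 0 := fun y => by
    have := pd_inl_mul (f := fun _ => (1 : ℝ)) (η := η) (z := (R, y)) (differentiableAt_const _)
      (hη.differentiable (by norm_num)).differentiableAt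
    simpa using this
  have hηr : ∀ A y, pd (basisEnd m) (Sum.inr A) (fun z => η z.2) (R, y) = pd (basisN m) A η y :=
    fun A y => by
      have := pd_inr_mul A (f := fun _ => (1 : ℝ)) (η := η) (z := (R, y)) (differentiableAt_const _)
        (hη.differentiable (by norm_num)).differentiableAt
      simpa using this
  have hint : ∀ i, Integrable (fun y => pd (basisEnd m) i (w i) (R, y)) μ := fun i =>
    integrable_slice (continuousOn_pd_slab (hw i) i) hR hK (pd_eq_zero_of_support hK (hsupp i) i)
  have hcO : ∀ i, ContinuousOn (pd (basisEnd m) i (u i)) (Ioi r₀ ×ˢ O) := fun i z hz =>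
    (contDiffAt_pd (k := 0) (basisEnd m) i (huo i z hz) (by norm_num)).continuousAt.continuousWithinAt
  have hint2 : ∀ A, Integrable (fun y => pd (basisN m) A η y * u (Sum.inr A) (R, y)) μ := by
    intro A
    have h0 : ∀ y ∉ K, pd (basisN m) A η y = 0 := fun y hy => by
      rw [← hηr]
      exact pd_eq_zero_of_support (r₀ := r₀) hK (w := fun z => η z.2) (fun z _ hz => hηK _ hz) _ _
        hR hy
    refine Continuous.integrable_of_hasCompactSupport ?_
      (HasCompactSupport.intro hK fun y hy => by simp only [h0 y hy, zero_mul])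
    refine continuous_iff_continuousAt.2 fun y => ?_
    by_cases hy : y ∈ K
    · refine ContinuousAt.mul (contDiffAt_pd (k := 0) (basisN m) A hη.contDiffAt
        (by norm_num)).continuousAt ?_
      exact ContinuousAt.comp (g := u (Sum.inr A)) (f := fun y => (R, y))
        (huo _ (R, y) ⟨hR, hKO hy⟩).continuousAt (by fun_prop)
    · refine (continuousAt_const (y := (0 : ℝ))).congr ?_
      filter_upwards [hK.isClosed.isOpen_compl.mem_nhds hy] with z hz
      rw [h0 z hz, zero_mul]
  have h1 := hasDerivAt_integral_slice (μ := μ) (hw (Sum.inl ())) hR hK (hsupp _)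
  -- The tangential derivatives integrate to zero over the slice, so they can be added to complete
  -- the radial derivative to a full divergence.
  have h2 : ∫ y, pd (basisEnd m) (Sum.inl ()) (w (Sum.inl ())) (R, y) ∂μ =
      ∫ y, ∑ i, pd (basisEnd m) i (w i) (R, y) ∂μ := by
    rw [integral_finsetSum _ fun i _ => hint i, Fintype.sum_sum_type]
    simp only [integral_pd_slice_eq_zero (hw _) hR hK (hsupp _), Finset.sum_const_zero, add_zero,
      Finset.univ_unique, Finset.sum_singleton, PUnit.default_eq_unit]
  have h3 : ∀ y, ∑ i, pd (basisEnd m) i (w i) (R, y) =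
      η y * ∑ i, pd (basisEnd m) i (u i) (R, y) +
        ∑ A, pd (basisN m) A η y * u (Sum.inr A) (R, y) := fun y => by
    simp only [hpd, Finset.sum_add_distrib, ← Finset.mul_sum]
    congr 1
    simp only [Fintype.sum_sum_type, hηl, hηr, zero_mul, Finset.sum_const_zero, zero_add]
  have hsum := integrable_finsetSum (μ := μ) Finset.univ fun (A : Fin m) _ => hint2 A
  have hsum' := integrable_finsetSum (μ := μ) Finset.univ fun (i : Unit ⊕ Fin m) _ => hint i
  rw [← integral_add _ hsum]
  · simp only [← h3]
    rw [← h2]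
    exact h1
  · refine (hsum'.sub hsum).congr (Eventually.of_forall fun y => ?_)
    simp only [Pi.sub_apply, h3, add_sub_cancel_right]

end Slices

/-! ### The derivative of the flux by a partition of unity on `N`. -/

section FluxDerivative

open Matrix

variable {m : ℕ} {N : Type*} [TopologicalSpace N] [ChartedSpace (ModelN m) N]

lemma continuous_of_charts {f : N → ℝ} {F : N → ModelN m → ℝ}
    (hF : ∀ p, ContinuousOn (F p) (extChartAt (𝓡 m) p).target)
    (hf : ∀ p, ∀ y ∈ (extChartAt (𝓡 m) p).target, f ((extChartAt (𝓡 m) p).symm y) = F p y) :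
    Continuous f := by
  refine continuous_iff_continuousAt.2 fun x => ?_
  have h1 : ContinuousAt (F x) (extChartAt (𝓡 m) x x) :=
    (hF x).continuousAt ((isOpen_extChartAt_target x).mem_nhds (mem_extChartAt_target x))
  refine (ContinuousAt.comp (f := extChartAt (𝓡 m) x) h1 (continuousAt_extChartAt x)).congr ?_
  filter_upwards [extChartAt_source_mem_nhds (I := 𝓡 m) x] with y hy
  rw [Function.comp, ← hf x _ ((extChartAt (𝓡 m) x).map_source hy),
    (extChartAt (𝓡 m) x).left_inv hy]

/-- A function `χ` supported in the domain of the chart at `p`, as a function on the model space. -/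
def chartCutoff (χ : N → ℝ) (p : N) : ModelN m → ℝ :=
  (extChartAt (𝓡 m) p).target.indicator (localFun (𝓡 m) χ p)

lemma chartCutoff_of_mem {χ : N → ℝ} {p : N} {y : ModelN m}
    (hy : y ∈ (extChartAt (𝓡 m) p).target) :
    chartCutoff χ p y = χ ((extChartAt (𝓡 m) p).symm y) := indicator_of_mem hy _

lemma pd_chartCutoff {χ : N → ℝ} {p : N} {y : ModelN m}
    (hy : y ∈ (extChartAt (𝓡 m) p).target) (A : Fin m) :
    pd (basisN m) A (chartCutoff χ p) y = pd (basisN m) A (localFun (𝓡 m) χ p) y := by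
  refine pd_congr _ _ ?_
  filter_upwards [(isOpen_extChartAt_target p).mem_nhds hy] with z hz using indicator_of_mem hz _

/-- The image of the support of `χ` in the chart at `p`. -/
def chartSupport (χ : N → ℝ) (p : N) : Set (ModelN m) := extChartAt (𝓡 m) p '' tsupport χ

lemma chartSupport_subset {χ : N → ℝ} {p : N} (hχ : tsupport χ ⊆ (extChartAt (𝓡 m) p).source) :
    chartSupport χ p ⊆ (extChartAt (𝓡 m) p).target ∩ (extChartAt (𝓡 m) p).symm ⁻¹' tsupport χ := by
  rintro _ ⟨x, hx, rfl⟩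
  exact ⟨(extChartAt (𝓡 m) p).map_source (hχ hx), by
    rw [mem_preimage, (extChartAt (𝓡 m) p).left_inv (hχ hx)]; exact hx⟩

lemma isCompact_chartSupport [CompactSpace N] {χ : N → ℝ} {p : N}
    (hχ : tsupport χ ⊆ (extChartAt (𝓡 m) p).source) :
    IsCompact (chartSupport χ p : Set (ModelN m)) :=
  (isClosed_tsupport χ).isCompact.image_of_continuousOn ((continuousOn_extChartAt p).mono hχ)

lemma chartCutoff_eq_zero {χ : N → ℝ} {p : N} {y : ModelN m} (hy : y ∉ chartSupport χ p) :
    chartCutoff χ p y = 0 := by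
  by_cases hyt : y ∈ (extChartAt (𝓡 m) p).target
  · rw [chartCutoff_of_mem hyt]
    refine image_eq_zero_of_notMem_tsupport fun h => hy ⟨_, h, (extChartAt (𝓡 m) p).right_inv hyt⟩
  · exact indicator_of_notMem hyt _

variable [IsManifold (𝓡 m) ∞ N]

lemma contDiffOn_localFun {χ : N → ℝ} (hχ : ContMDiff (𝓡 m) 𝓘(ℝ, ℝ) ∞ χ) (p : N) :
    ContDiffOn ℝ ∞ (localFun (𝓡 m) χ p) (extChartAt (𝓡 m) p).target :=
  contMDiffOn_iff_contDiffOn.1 (hχ.comp_contMDiffOn (contMDiffOn_extChartAt_symm p))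

/-- The support of `χ` is compact in the chart domain, so the extension by zero is smooth across the
boundary of the chart target. -/
lemma contDiff_chartCutoff [CompactSpace N] {χ : N → ℝ} (hχ : ContMDiff (𝓡 m) 𝓘(ℝ, ℝ) ∞ χ) {p : N}
    (hχp : tsupport χ ⊆ (extChartAt (𝓡 m) p).source) :
    ContDiff ℝ 1 (chartCutoff χ p : ModelN m → ℝ) := by
  refine contDiff_iff_contDiffAt.2 fun y => ?_
  by_cases hy : y ∈ chartSupport χ p
  · have ho := (isOpen_extChartAt_target (I := 𝓡 m) p).mem_nhds (chartSupport_subset hχp hy).1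
    refine (((contDiffOn_localFun hχ p).contDiffAt ho).of_le (by simp)).congr_of_eventuallyEq ?_
    filter_upwards [ho] with z hz using indicator_of_mem hz _
  · refine (contDiffAt_const (c := 0)).congr_of_eventuallyEq ?_
    filter_upwards [(isCompact_chartSupport hχp).isClosed.isOpen_compl.mem_nhds hy] with z hz using
      chartCutoff_eq_zero hz

section EndMass

variable {g b : FormField (modelEnd m) (ℝ × N)} {r₀ : ℝ} {V : ℝ × N → ℝ}

lemma contDiffOn_endMass (hg : IsEndMetric g r₀) (hb : IsEndMetric b r₀)
    (hV : ContMDiffOn (modelEnd m) 𝓘(ℝ, ℝ) 2 V (endSet N r₀)) (p : N) (i : Unit ⊕ Fin m) :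
    ContDiffOn ℝ 1 (endMass g b V p i) (endDomain m r₀ p) := fun _ hz =>
  (contDiffAt_massVector (hg.isMetricAt hz) (hb.isMetricAt hz)
    (contDiffAt_endFun hV hz) i).contDiffWithinAt

lemma continuousOn_endMass_slice (hg : IsEndMetric g r₀) (hb : IsEndMetric b r₀)
    (hV : ContMDiffOn (modelEnd m) 𝓘(ℝ, ℝ) 2 V (endSet N r₀)) (p : N) (i : Unit ⊕ Fin m) {R : ℝ}
    (hR : r₀ < R) :
    ContinuousOn (fun y => endMass g b V p i (R, y)) (extChartAt (𝓡 m) p).target :=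
  (contDiffOn_endMass hg hb hV p i).continuousOn.comp (by fun_prop) fun _ hy => ⟨hR, hy⟩

variable (h : Bundle.ContMDiffRiemannianMetric (𝓡 m) ∞ (ModelN m) (fun x : N => TangentSpace (𝓡 m) x))

lemma continuousOn_sqrt_det_riemannian (p : N) : ContinuousOn (fun y =>
    Real.sqrt (localForm (𝓡 m) (basisN m) (fun x u v => h.inner x u v) p y).det)
    (extChartAt (𝓡 m) p).target := fun _ hy =>
  (isMetricAt_riemannian h hy).contDiffAt_sqrt_det.continuousAt.continuousWithinAt

lemma sqrt_det_riemannian_ne_zero {p : N} {y : ModelN m} (hy : y ∈ (extChartAt (𝓡 m) p).target) :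
    Real.sqrt (localForm (𝓡 m) (basisN m) (fun x u v => h.inner x u v) p y).det ≠ 0 :=
  (Real.sqrt_pos.2 (isMetricAt_riemannian h hy).det_pos).ne'

/-- The pointwise definition uses a chart that jumps with the point; near any point `fluxDensity_eq`
replaces it by one chart, where continuity is visible. On the compact `N` this also gives
integrability for every `R > r₀`. -/
lemma continuous_fluxDensity (hg : IsEndMetric g r₀) (hb : IsEndMetric b r₀)
    (hV : ContMDiffOn (modelEnd m) 𝓘(ℝ, ℝ) 2 V (endSet N r₀)) {R : ℝ} (hR : r₀ < R) :
    Continuous (fluxDensity (fun x u v => h.inner x u v) g b V R) :=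
  continuous_of_charts (fun p => (continuousOn_endMass_slice hg hb hV p _ hR).div
    (continuousOn_sqrt_det_riemannian h p) fun _ hy => sqrt_det_riemannian_ne_zero h hy)
    fun _ _ hy => fluxDensity_eq h hg hb hV hR hy

/-- The density of `Uⁱ ∂ᵢη` at `{r = R}`, as a function on `N`. -/
def derivativeDensity (g b : FormField (modelEnd m) (ℝ × N)) (V : ℝ × N → ℝ) (R : ℝ) (η : N → ℝ)
    (x : N) : ℝ :=
  tangentialDensity (fun x u v => h.inner x u v) g b V R η x (extChartAt (𝓡 m) x x)

lemma differentiableAt_localFun {η : N → ℝ} (hη : ContMDiff (𝓡 m) 𝓘(ℝ, ℝ) ∞ η) {p : N}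
    {y : ModelN m} (hy : y ∈ (extChartAt (𝓡 m) p).target) :
    DifferentiableAt ℝ (localFun (𝓡 m) η p) y :=
  ((contDiffOn_localFun hη p).contDiffAt ((isOpen_extChartAt_target p).mem_nhds hy)).differentiableAt
    (by simp)

lemma derivativeDensity_eq (hg : IsEndMetric g r₀) (hb : IsEndMetric b r₀)
    (hV : ContMDiffOn (modelEnd m) 𝓘(ℝ, ℝ) 2 V (endSet N r₀)) {R : ℝ} (hR : r₀ < R) {η : N → ℝ}
    (hη : ContMDiff (𝓡 m) 𝓘(ℝ, ℝ) ∞ η) {p : N} {y : ModelN m}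
    (hy : y ∈ (extChartAt (𝓡 m) p).target) :
    derivativeDensity h g b V R η ((extChartAt (𝓡 m) p).symm y) =
      tangentialDensity (fun x u v => h.inner x u v) g b V R η p y := by
  have hs := IsEndMetric.mem_transitionDomain_self hy
  exact (tangentialDensity_transition h hg hb hV hR hs
    (differentiableAt_localFun hη (transition_mem hs).1)).symm

lemma continuous_derivativeDensity (hg : IsEndMetric g r₀) (hb : IsEndMetric b r₀)
    (hV : ContMDiffOn (modelEnd m) 𝓘(ℝ, ℝ) 2 V (endSet N r₀)) {R : ℝ} (hR : r₀ < R) {η : N → ℝ}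
    (hη : ContMDiff (𝓡 m) 𝓘(ℝ, ℝ) ∞ η) : Continuous (derivativeDensity h g b V R η) := by
  refine continuous_of_charts (fun p => (continuousOn_finsetSum _ fun A _ => ?_).div
    (continuousOn_sqrt_det_riemannian h p) fun _ hy => sqrt_det_riemannian_ne_zero h hy)
    fun _ _ hy => derivativeDensity_eq h hg hb hV hR hη hy
  refine ContinuousOn.mul (fun y hy => ?_) (continuousOn_endMass_slice hg hb hV p _ hR)
  exact (contDiffAt_pd (k := 0) (basisN m) A ((contDiffOn_localFun hη p).contDiffAt
    ((isOpen_extChartAt_target p).mem_nhds hy)) (by simp)).continuousAt.continuousWithinAt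

/-- The density is linear in the differential of the cutoff, and the differentials of a partition of
unity add up to that of the constant 1. -/
lemma sum_derivativeDensity {α : Type*} (s : Finset α) {χ : α → N → ℝ}
    (hχ : ∀ a ∈ s, ContMDiff (𝓡 m) 𝓘(ℝ, ℝ) ∞ (χ a)) (hsum : ∀ x, ∑ a ∈ s, χ a x = 1) (R : ℝ)
    (x : N) : ∑ a ∈ s, derivativeDensity h g b V R (χ a) x = 0 := by
  simp only [derivativeDensity, tangentialDensity]
  rw [← Finset.sum_div, Finset.sum_comm]
  refine (congrArg (· / _) (Finset.sum_eq_zero fun A _ => ?_)).trans (zero_div _)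
  rw [← Finset.sum_mul, ← pd_sum s (basisN m) A fun a ha =>
    differentiableAt_localFun (hχ a ha) (mem_extChartAt_target x)]
  have h1 : (fun y => ∑ a ∈ s, localFun (𝓡 m) (χ a) x y) = fun _ => 1 :=
    funext fun y => hsum _
  rw [h1, pd_const, zero_mul]

variable [MeasurableSpace N] [BorelSpace N] [CompactSpace N] [T2Space N]

lemma isFiniteMeasure_riemannianVolume :
    IsFiniteMeasure (riemannianVolume (𝓡 m) (basisN m) (fun x u v => h.inner x u v)) := by
  have := isLocallyFiniteMeasure_riemannianVolume (basisN m)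
    (T := fun x u v => h.inner x u v) (fun x => isBilinAt_inner h x)
    (continuousOn_sqrt_det_riemannian h)
  exact CompactSpace.isFiniteMeasure

lemma integrable_riemannianVolume {f : N → ℝ} (hf : Continuous f) :
    Integrable f (riemannianVolume (𝓡 m) (basisN m) (fun x u v => h.inner x u v)) := by
  have := isFiniteMeasure_riemannianVolume h
  exact hf.integrable_of_hasCompactSupport (HasCompactSupport.of_compactSpace f)

/-- Localization of the integral of a function supported in a chart domain. -/
lemma integral_riemannianVolume_chart {f : N → ℝ} (hf : Continuous f) {p : N}
    {χ : N → ℝ} (hχp : tsupport χ ⊆ (extChartAt (𝓡 m) p).source)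
    (hsupp : ∀ x ∉ tsupport χ, f x = 0) {F : ModelN m → ℝ} (hF0 : ∀ y ∉ chartSupport χ p, F y = 0)
    (hF : ∀ y ∈ (extChartAt (𝓡 m) p).target, Real.sqrt (localForm (𝓡 m) (basisN m)
      (fun x u v => h.inner x u v) p y).det * f ((extChartAt (𝓡 m) p).symm y) = F y) :
    ∫ x, f x ∂(riemannianVolume (𝓡 m) (basisN m) (fun x u v => h.inner x u v)) =
      ∫ y, F y ∂(basisN m).addHaar := by
  rw [integral_riemannianVolume_of_support (basisN m)
    (T := fun x u v => h.inner x u v) (fun x => isBilinAt_inner h x)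
    (continuousOn_sqrt_det_riemannian h p) hf.measurable fun x hx => hsupp x fun h => hx (hχp h),
    setIntegral_congr_fun (isOpen_extChartAt_target p).measurableSet hF]
  exact setIntegral_eq_integral_of_forall_compl_eq_zero fun y hy => hF0 y fun h =>
    hy (chartSupport_subset hχp h).1

lemma integral_mul_fluxDensity (hg : IsEndMetric g r₀) (hb : IsEndMetric b r₀)
    (hV : ContMDiffOn (modelEnd m) 𝓘(ℝ, ℝ) 2 V (endSet N r₀)) {R : ℝ} (hR : r₀ < R) {χ : N → ℝ}
    (hχ : ContMDiff (𝓡 m) 𝓘(ℝ, ℝ) ∞ χ) {p : N} (hχp : tsupport χ ⊆ (extChartAt (𝓡 m) p).source) :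
    ∫ x, χ x * fluxDensity (fun x u v => h.inner x u v) g b V R x
      ∂(riemannianVolume (𝓡 m) (basisN m) (fun x u v => h.inner x u v)) =
    ∫ y, chartCutoff χ p y * endMass g b V p (Sum.inl ()) (R, y) ∂(basisN m).addHaar := by
  refine integral_riemannianVolume_chart h (hχ.continuous.fun_mul (continuous_fluxDensity h hg hb hV hR))
    hχp (fun x hx => ?_) (fun y hy => ?_) fun y hy => ?_
  · rw [image_eq_zero_of_notMem_tsupport hx, zero_mul]
  · rw [chartCutoff_eq_zero hy, zero_mul]
  · simp only [fluxDensity_eq h hg hb hV hR hy, chartCutoff_of_mem hy]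
    field_simp [sqrt_det_riemannian_ne_zero h hy]

lemma integral_derivativeDensity (hg : IsEndMetric g r₀) (hb : IsEndMetric b r₀)
    (hV : ContMDiffOn (modelEnd m) 𝓘(ℝ, ℝ) 2 V (endSet N r₀)) {R : ℝ} (hR : r₀ < R) {χ : N → ℝ}
    (hχ : ContMDiff (𝓡 m) 𝓘(ℝ, ℝ) ∞ χ) {p : N} (hχp : tsupport χ ⊆ (extChartAt (𝓡 m) p).source) :
    ∫ x, derivativeDensity h g b V R χ x
      ∂(riemannianVolume (𝓡 m) (basisN m) (fun x u v => h.inner x u v)) =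
    ∫ y, ∑ A, pd (basisN m) A (chartCutoff χ p) y * endMass g b V p (Sum.inr A) (R, y)
      ∂(basisN m).addHaar := by
  refine integral_riemannianVolume_chart h (continuous_derivativeDensity h hg hb hV hR hχ)
    hχp (fun x hx => ?_) (fun y hy => ?_) fun y hy => ?_
  · have h1 : ∀ A, pd (basisN m) A (localFun (𝓡 m) χ x) (extChartAt (𝓡 m) x x) = 0 := fun A => by
      have h2 : localFun (𝓡 m) χ x =ᶠ[𝓝 (extChartAt (𝓡 m) x x)] fun _ => 0 := by
        have hc : Tendsto (extChartAt (𝓡 m) x).symm (𝓝 (extChartAt (𝓡 m) x x)) (𝓝 x) :=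
          ((continuousAt_extChartAt_symm x).tendsto).trans (by rw [extChartAt_to_inv])
        filter_upwards [hc.eventually ((isClosed_tsupport χ).isOpen_compl.mem_nhds hx)] with y hy
          using image_eq_zero_of_notMem_tsupport (f := χ) hy
      rw [pd_congr _ _ h2, pd_const]
    simp only [derivativeDensity, tangentialDensity, h1, zero_mul, Finset.sum_const_zero, zero_div]
  · refine Finset.sum_eq_zero fun A _ => ?_
    have h2 : chartCutoff χ p =ᶠ[𝓝 y] fun _ => 0 := by
      filter_upwards [(isCompact_chartSupport hχp).isClosed.isOpen_compl.mem_nhds hy] with z hz using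
        chartCutoff_eq_zero hz
    rw [pd_congr _ _ h2, pd_const, zero_mul]
  · simp only [derivativeDensity_eq h hg hb hV hR hχ hy, tangentialDensity, pd_chartCutoff hy]
    exact mul_div_cancel₀ _ (sqrt_det_riemannian_ne_zero h hy)

/-- The radial derivative of the flux, localized by a partition of unity. -/
theorem hasDerivAt_flux (hg : IsEndMetric g r₀) (hb : IsEndMetric b r₀)
    (hV : ContMDiffOn (modelEnd m) 𝓘(ℝ, ℝ) 2 V (endSet N r₀)) {α : Type*} (s : Finset α)
    {χ : α → N → ℝ} {c : α → N} (hχ : ∀ a ∈ s, ContMDiff (𝓡 m) 𝓘(ℝ, ℝ) ∞ (χ a))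
    (hsum : ∀ x, ∑ a ∈ s, χ a x = 1)
    (hχc : ∀ a ∈ s, tsupport (χ a) ⊆ (extChartAt (𝓡 m) (c a)).source) {R : ℝ} (hR : r₀ < R) :
    HasDerivAt (flux (fun x u v => h.inner x u v) g b V)
      (∑ a ∈ s, ∫ y, chartCutoff (χ a) (c a) y *
        ∑ i, pd (basisEnd m) i (endMass g b V (c a) i) (R, y) ∂(basisN m).addHaar) R := by
  have h1 : ∀ a ∈ s, HasDerivAt (fun t => ∫ y, chartCutoff (χ a) (c a) y *
      endMass g b V (c a) (Sum.inl ()) (t, y) ∂(basisN m).addHaar) _ R := fun a ha =>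
    hasDerivAt_integral_mul (isOpen_extChartAt_target (c a))
      (fun i => contDiffOn_endMass hg hb hV (c a) i) (contDiff_chartCutoff (hχ a ha) (hχc a ha)) hR
      (isCompact_chartSupport (hχc a ha))
      (fun y hy => (chartSupport_subset (hχc a ha) hy).1) fun y hy => chartCutoff_eq_zero hy
  have h2 := HasDerivAt.fun_sum h1
  -- The terms in which a derivative hits a cutoff live in different charts. Rewritten as integrals
  -- of invariant densities over `N` they can be added, and their sum vanishes pointwise.
  have h3 : ∑ a ∈ s, ∫ y, ∑ A, pd (basisN m) A (chartCutoff (χ a) (c a)) y *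
      endMass g b V (c a) (Sum.inr A) (R, y) ∂(basisN m).addHaar = 0 := by
    rw [← Finset.sum_congr rfl fun a ha =>
      integral_derivativeDensity h hg hb hV hR (hχ a ha) (hχc a ha), ← integral_finsetSum _ fun a ha =>
      integrable_riemannianVolume h (continuous_derivativeDensity h hg hb hV hR (hχ a ha))]
    simp only [sum_derivativeDensity h s hχ hsum, integral_zero]
  rw [Finset.sum_add_distrib, h3, add_zero] at h2
  refine h2.congr_of_eventuallyEq ?_
  filter_upwards [lt_mem_nhds hR] with t ht
  rw [← Finset.sum_congr rfl fun a ha => integral_mul_fluxDensity h hg hb hV ht (hχ a ha) (hχc a ha),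
    ← integral_finsetSum _ fun a ha => integrable_riemannianVolume h
      ((hχ a ha).continuous.fun_mul (continuous_fluxDensity h hg hb hV ht))]
  simp only [← Finset.sum_mul, hsum, one_mul, flux]

end EndMass

end FluxDerivative

/-! ### Integrability of the divergence over the end and convergence of the flux. -/

section FluxLimit

open Matrix

lemma addHaar_singleton : (Module.Basis.singleton Unit ℝ).addHaar = volume := by
  rw [← OrthonormalBasis.toBasis_singleton]
  exact (OrthonormalBasis.singleton Unit ℝ).addHaar_eq_volume

lemma addHaar_basisEnd (m : ℕ) :
    (basisEnd m).addHaar = (volume : Measure ℝ).prod (basisN m).addHaar := by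
  rw [basisEnd, Module.Basis.prod_addHaar, addHaar_singleton]

/-- The factor `⊤` in the filter encodes uniformity over `N`, so the bound holds on a whole end `[R,
∞) × N` with an explicit starting radius. -/
lemma _root_.Asymptotics.IsBigO.exists_principal_Ici {N : Type*} {f : ℝ × N → ℝ}
    (hf : f =O[atTop ×ˢ (⊤ : Filter N)] fun p => p.1) :
    ∃ a : ℝ, ∀ R ≥ a, f =O[𝓟 (Ici R ×ˢ univ)] fun p : ℝ × N => p.1 := by
  obtain ⟨C, hC⟩ := hf.bound
  obtain ⟨pa, ha, pb, hb, hab⟩ := eventually_prod_iff.1 hC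
  obtain ⟨a, ha'⟩ := eventually_atTop.1 ha
  refine ⟨a, fun R hR => IsBigO.of_bound C (eventually_principal.2 fun p hp => ?_)⟩
  exact hab (ha' _ (le_trans hR hp.1)) (eventually_top.1 hb _)

variable {m : ℕ} {N : Type*} [TopologicalSpace N] [ChartedSpace (ModelN m) N]
  [IsManifold (𝓡 m) ∞ N] [MeasurableSpace N] [BorelSpace N] {r₀ R₀ : ℝ}

/-- The integral over a part of a chart is controlled by the one over the end. -/
lemma lintegral_endMatrix_lt_top {g : FormField (modelEnd m) (ℝ × N)} (hg : IsEndMetric g r₀)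
    (hr : r₀ < R₀) {p : N} {K : Set (ModelN m)} {W : Set N} (hW : IsOpen W)
    (hKW : K ⊆ (extChartAt (𝓡 m) p).target ∩ (extChartAt (𝓡 m) p).symm ⁻¹' W) {f : ℝ × N → ENNReal}
    (hf : ∫⁻ q in Ioi r₀ ×ˢ W, f q ∂(riemannianVolume (modelEnd m) (basisEnd m) g) < ⊤) :
    ∫⁻ z in Ici R₀ ×ˢ K, ENNReal.ofReal (Real.sqrt (endMatrix g p z).det) *
      f (z.1, (extChartAt (𝓡 m) p).symm z.2) ∂(basisEnd m).addHaar < ⊤ := by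
  have hs : MeasurableSet (Ioi r₀ ×ˢ W : Set (ℝ × N)) := measurableSet_Ioi.prod hW.measurableSet
  refine lt_of_le_of_lt ?_ hf
  refine le_trans (lintegral_mono_set ?_) (lintegral_chart_le (I := modelEnd m) (basisEnd m) g
    ((0 : ℝ), p) hs ?_ f)
  · exact fun z hz => ⟨⟨hr.trans_le hz.1, (hKW hz.2).2⟩, mem_extChartAt_end_target.2 (hKW hz.2).1⟩
  · refine (ContinuousOn.aemeasurable (fun z hz => ?_)
      (measurableSet_preimage_symm _ hs)).ennreal_ofReal
    exact (hg.isMetricAt (a := p) ⟨hz.1.1, mem_extChartAt_end_target.1 hz.2⟩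
      ).contDiffAt_sqrt_det.continuousAt.continuousWithinAt

variable [CompactSpace N] {k : ℝ} {W : Set N}

/-- The localized divergence of the mass vector is integrable. -/
theorem integrableOn_integral_divergence
    (h : Bundle.ContMDiffRiemannianMetric (𝓡 m) ∞ (ModelN m) (fun x : N => TangentSpace (𝓡 m) x))
    (hr₀ : 0 ≤ r₀) (hr₀k : 0 ≤ r₀ ^ 2 + k) (hk : -1 ≤ k) (hk' : k ≤ 1) (hr : r₀ < R₀) (hR : 2 ≤ R₀)
    {g : FormField (modelEnd m) (ℝ × N)} (hg : IsEndMetric g r₀)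
    (hequiv : UniformlyEquivalent r₀ g (refMetric (fun x u v => h.inner x u v) k))
    {V : ℝ × N → ℝ} (hV : V ∈ staticPotentials (modelEnd m) (basisEnd m)
      (refMetric (fun x u v => h.inner x u v) k) (endSet N r₀))
    (hVO : V =O[𝓟 (Ici R₀ ×ˢ univ)] fun p => p.1)
    (hdVO : differentialNorm (modelEnd m) (basisEnd m) (refMetric (fun x u v => h.inner x u v) k) V
      =O[𝓟 (Ici R₀ ×ˢ univ)] fun p => p.1) (hW : IsOpen W)
    {ε : Fin m → ∀ x : N, TangentSpace (𝓡 m) x}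
    (hε : IsOrthonormalFrameOn (fun x u v => h.inner x u v) W ε)
    (hfin : ∫⁻ p in Ioi r₀ ×ˢ W, ENNReal.ofReal (frameEnergy g (frame k ε) p * p.1)
      ∂(riemannianVolume (modelEnd m) (basisEnd m) g) < ⊤)
    (hscal : ScalarDecay r₀ g (refMetric (fun x u v => h.inner x u v) k))
    {χ : N → ℝ} (hχ : ContMDiff (𝓡 m) 𝓘(ℝ, ℝ) ∞ χ) {p : N}
    (hχp : tsupport χ ⊆ W ∩ (extChartAt (𝓡 m) p).source) :
    IntegrableOn (fun R => ∫ y, chartCutoff χ p y * ∑ i, pd (basisEnd m) i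
      (endMass g (refMetric (fun x u v => h.inner x u v) k) V p i) (R, y) ∂(basisN m).addHaar)
      (Ioi R₀) := by
  set b := refMetric (fun x u v => h.inner x u v) k with hb_def
  have hb : IsEndMetric b r₀ := isEndMetric_refMetric h hr₀ hr₀k
  have hχs : tsupport χ ⊆ (extChartAt (𝓡 m) p).source := hχp.trans inter_subset_right
  set K : Set (ModelN m) := chartSupport χ p with hK_def
  have hK : IsCompact K := isCompact_chartSupport hχs
  have hKW : K ⊆ (extChartAt (𝓡 m) p).target ∩ (extChartAt (𝓡 m) p).symm ⁻¹' W := fun y hy =>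
    ⟨(chartSupport_subset hχs hy).1, (hχp (chartSupport_subset hχs hy).2).1⟩
  set D : ℝ × ModelN m → ℝ := fun z => ∑ i, pd (basisEnd m) i (endMass g b V p i) z with hD
  set S : Set (ℝ × ModelN m) := Ici R₀ ×ˢ K with hS
  have hSm : MeasurableSet S := measurableSet_Ici.prod hK.measurableSet
  have hSO : ∀ z ∈ S, z ∈ endDomain m r₀ p := fun z hz => ⟨hr.trans_le hz.1, (hKW hz.2).1⟩
  obtain ⟨C, hC, hbound⟩ := exists_abs_divergence_le h hr₀ hr₀k hk hk' hr hR hg hequiv hV hVO hdVO hW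
    hε hK hKW
  set d : ℝ × ModelN m → ENNReal := fun z => ENNReal.ofReal (Real.sqrt (endMatrix g p z).det) with hd
  set a₁ : ℝ × N → ENNReal := fun q => ENNReal.ofReal
    (|scalarCurvature (modelEnd m) (basisEnd m) g q - scalarCurvature (modelEnd m) (basisEnd m) b q|
      * q.1) with ha₁
  set a₂ : ℝ × N → ENNReal := fun q => ENNReal.ofReal (frameEnergy g (frame k ε) q * q.1) with ha₂
  have hfin₁ : ∫⁻ z in S, d z * a₁ (z.1, (extChartAt (𝓡 m) p).symm z.2) ∂(basisEnd m).addHaar < ⊤ :=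
    lintegral_endMatrix_lt_top hg hr hW hKW (lt_of_le_of_lt (lintegral_mono_set
      (prod_mono_right (subset_univ _))) hscal)
  have hfin₂ : ∫⁻ z in S, d z * a₂ (z.1, (extChartAt (𝓡 m) p).symm z.2) ∂(basisEnd m).addHaar < ⊤ :=
    lintegral_endMatrix_lt_top hg hr hW hKW hfin
  -- Additivity of the lower integral needs measurability of only one summand. The curvature term is
  -- measurable, so nothing has to be known about the measurability of the frame energy.
  have hmeas : AEMeasurable (fun z => d z * a₁ (z.1, (extChartAt (𝓡 m) p).symm z.2))
      ((basisEnd m).addHaar.restrict S) := by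
    refine AEMeasurable.mul (ContinuousOn.aemeasurable (fun z hz =>
      (hg.isMetricAt (hSO z hz)).contDiffAt_sqrt_det.continuousAt.continuousWithinAt)
      hSm).ennreal_ofReal (ContinuousOn.aemeasurable ?_ hSm).ennreal_ofReal
    have hc : ContinuousOn (fun z => |scalar (basisEnd m) (endMatrix g p) z -
        scalar (basisEnd m) (endMatrix b p) z| * z.1) S := fun z hz =>
      (((continuousAt_scalar (hg.isMetricAt (hSO z hz))).sub
        (continuousAt_scalar (hb.isMetricAt (hSO z hz)))).abs.mul
          continuousAt_fst).continuousWithinAt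
    exact hc.congr fun z hz => by
      simp only [hg.scalarCurvature_eq (hSO z hz), hb.scalarCurvature_eq (hSO z hz)]
  have hDfin : ∫⁻ z in S, ENNReal.ofReal |D z| ∂(basisEnd m).addHaar < ⊤ := by
    have h1 : ∀ z ∈ S, ENNReal.ofReal |D z| ≤ ENNReal.ofReal C *
        (d z * a₁ (z.1, (extChartAt (𝓡 m) p).symm z.2) +
          d z * a₂ (z.1, (extChartAt (𝓡 m) p).symm z.2)) := by
      intro z hz
      have hz0 : 0 ≤ z.1 := by linarith [hz.1.out]
      refine (ENNReal.ofReal_le_ofReal (hbound z hz)).trans (le_of_eq ?_)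
      rw [ENNReal.ofReal_mul hC, ENNReal.ofReal_mul (Real.sqrt_nonneg _),
        ENNReal.ofReal_add (mul_nonneg (abs_nonneg _) hz0)
          (mul_nonneg (frameEnergy_nonneg _ _ _) hz0), mul_add (ENNReal.ofReal (Real.sqrt _))]
    refine lt_of_le_of_lt (setLIntegral_mono' hSm h1) ?_
    rw [lintegral_const_mul' _ _ ENNReal.ofReal_ne_top, lintegral_add_left' hmeas]
    exact ENNReal.mul_lt_top ENNReal.ofReal_lt_top (ENNReal.add_lt_top.2 ⟨hfin₁, hfin₂⟩)
  set η : ModelN m → ℝ := chartCutoff χ p with hη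
  have hηc : Continuous η := (contDiff_chartCutoff hχ hχs).continuous
  have hη0 : ∀ y ∉ K, η y = 0 := fun y hy => chartCutoff_eq_zero hy
  obtain ⟨M, hM⟩ := hηc.bounded_above_of_compact_support (HasCompactSupport.intro hK hη0)
  have hM0 : 0 ≤ M := (norm_nonneg _).trans (hM 0)
  have hDc : ∀ z ∈ endDomain m r₀ p, ContinuousAt D z := fun z hz =>
    tendsto_finsetSum _ fun i _ => (contDiffAt_pd (k := 0) (basisEnd m) i
      ((contDiffOn_endMass hg hb hV.1 p i).contDiffAt ((isOpen_endDomain r₀ p).mem_nhds hz))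
      (by norm_num)).continuousAt
  -- The integrand itself is continuous, being zero near every point outside the support, so it is
  -- measurable; finiteness follows from the bound on the cutoff and the integrability of the
  -- divergence over `S`.
  have hint : IntegrableOn (fun z : ℝ × ModelN m => η z.2 * D z) (Ioi R₀ ×ˢ univ)
      ((volume : Measure ℝ).prod (basisN m).addHaar) := by
    rw [← addHaar_basisEnd]
    constructor
    · refine ContinuousOn.aestronglyMeasurable (fun z hz => ContinuousAt.continuousWithinAt ?_)
        (measurableSet_Ioi.prod MeasurableSet.univ)
      by_cases hzK : z.2 ∈ K
      · exact (hηc.continuousAt.comp continuousAt_snd).mul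
          (hDc z ⟨hr.trans hz.1, (hKW hzK).1⟩)
      · refine (continuousAt_const (y := (0 : ℝ))).congr ?_
        filter_upwards [(hK.isClosed.isOpen_compl.preimage continuous_snd).mem_nhds hzK] with y hy
        rw [hη0 _ hy, zero_mul]
    · have h2 : ∀ z ∈ (Ioi R₀ ×ˢ univ : Set (ℝ × ModelN m)), ‖η z.2 * D z‖ₑ ≤
          S.indicator (fun z => ENNReal.ofReal M * ENNReal.ofReal |D z|) z := by
        intro z hz
        by_cases hzK : z.2 ∈ K
        · rw [indicator_of_mem (show z ∈ S from ⟨hz.1.out.le, hzK⟩), enorm_mul,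
            ← ofReal_norm, ← ofReal_norm]
          exact mul_le_mul' (ENNReal.ofReal_le_ofReal (hM _)) le_rfl
        · rw [hη0 _ hzK, zero_mul, enorm_zero]
          exact zero_le
      refine lt_of_le_of_lt (setLIntegral_mono' (measurableSet_Ioi.prod MeasurableSet.univ) h2) ?_
      refine lt_of_le_of_lt (setLIntegral_le_lintegral _ _) ?_
      rw [lintegral_indicator hSm, lintegral_const_mul' _ _ ENNReal.ofReal_ne_top]
      exact ENNReal.mul_lt_top ENNReal.ofReal_lt_top hDfin
  -- Fubini: integrability over the slab makes the slice integrals an integrable function of `R`.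
  rw [IntegrableOn, ← Measure.prod_restrict, Measure.restrict_univ] at hint
  exact hint.integral_prod_left

/-- Convergence of the flux integrals. -/
theorem exists_tendsto_flux [T2Space N]
    (h : Bundle.ContMDiffRiemannianMetric (𝓡 m) ∞ (ModelN m) (fun x : N => TangentSpace (𝓡 m) x))
    (hr₀ : 0 ≤ r₀) (hr₀k : 0 ≤ r₀ ^ 2 + k) (hk : -1 ≤ k) (hk' : k ≤ 1)
    {g : FormField (modelEnd m) (ℝ × N)} (hg : IsEndMetric g r₀)
    (hmetric : MetricDecay (fun x u v => h.inner x u v) k r₀ g)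
    (hscal : ScalarDecay r₀ g (refMetric (fun x u v => h.inner x u v) k))
    (hequiv : UniformlyEquivalent r₀ g (refMetric (fun x u v => h.inner x u v) k))
    {V : ℝ × N → ℝ} (hV : V ∈ staticPotentials (modelEnd m) (basisEnd m)
      (refMetric (fun x u v => h.inner x u v) k) (endSet N r₀))
    (hgrowth : LinearGrowth (refMetric (fun x u v => h.inner x u v) k) V) :
    ∃ l : ℝ, Tendsto (flux (fun x u v => h.inner x u v) g
      (refMetric (fun x u v => h.inner x u v) k) V) atTop (𝓝 l) := by
  have hb : IsEndMetric (refMetric (fun x u v => h.inner x u v) k) r₀ :=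
    isEndMetric_refMetric h hr₀ hr₀k
  obtain ⟨a₁, ha₁⟩ := hgrowth.1.exists_principal_Ici
  obtain ⟨a₂, ha₂⟩ := hgrowth.2.exists_principal_Ici
  -- The radius lies beyond the thresholds for both growth bounds, beyond `r₀`, and beyond 2, where
  -- the symbol estimates for `r² + k` hold.
  obtain ⟨R₀, hR₀⟩ : ∃ R₀ : ℝ, max (max a₁ a₂) (max 2 r₀) < R₀ := exists_gt _
  simp only [max_lt_iff] at hR₀
  obtain ⟨⟨h1, h2⟩, h3, h4⟩ := hR₀
  choose W hWo hxW ε hε hfin using hmetric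
  have hU : ∀ x, IsOpen (W x ∩ (extChartAt (𝓡 m) x).source) := fun x =>
    (hWo x).inter (isOpen_extChartAt_source x)
  -- Each set of the cover lies both in a chart domain and in a domain carrying an orthonormal frame
  -- of finite weighted energy; finitely many suffice because `N` is compact.
  obtain ⟨t, ht⟩ := isCompact_univ.elim_finite_subcover _ hU fun x _ =>
    mem_iUnion.2 ⟨x, hxW x, mem_extChartAt_source x⟩
  obtain ⟨χ, hχ⟩ := SmoothPartitionOfUnity.exists_isSubordinate (𝓡 m) isClosed_univ
    (fun a : t => W a ∩ (extChartAt (𝓡 m) (a : N)).source) (fun a => hU a) (by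
      refine ht.trans (iUnion₂_subset fun a ha => ?_)
      exact subset_iUnion (fun a : t => W a ∩ (extChartAt (𝓡 m) (a : N)).source) ⟨a, ha⟩)
  have hsum : ∀ x, ∑ a, χ a x = 1 := fun x => by
    rw [← finsum_eq_sum_of_fintype]; exact χ.sum_eq_one (mem_univ x)
  -- An integrable derivative on `(R₀, ∞)` makes the flux converge, and the derivative is a finite
  -- sum of localised divergence integrals.
  refine ⟨_, tendsto_limUnder_of_hasDerivAt_of_integrableOn_Ioi (a := R₀) (fun R hR =>
    hasDerivAt_flux h hg hb hV.1 Finset.univ (χ := fun a x => χ a x) (c := fun a => (a : N))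
      (fun a _ => (χ a).contMDiff) hsum (fun a _ => (hχ a).trans inter_subset_right)
      (h4.trans hR)) ?_⟩
  refine integrable_finsetSum _ fun a _ => ?_
  exact integrableOn_integral_divergence h hr₀ hr₀k hk hk' h4 h3.le hg hequiv hV (ha₁ R₀ h1.le)
    (ha₂ R₀ h2.le) (hWo a) (hε a) (hfin a) hscal (χ a).contMDiff (hχ a)

end FluxLimit

end WarpedMass

end

open WarpedMass in
theorem proposition3p1
    -- the compact manifold `N` of dimension `m = n - 1 ≥ 1`, with its metric `h`
    (m : ℕ) (hm : 1 ≤ m)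
    {N : Type*} [TopologicalSpace N] [T2Space N] [CompactSpace N] [ChartedSpace (ModelN m) N]
    [IsManifold (𝓡 m) ∞ N] [MeasurableSpace N] [BorelSpace N]
    (h : Bundle.ContMDiffRiemannianMetric (𝓡 m) ∞ (ModelN m) (fun x : N => TangentSpace (𝓡 m) x))
    (k : ℝ) (hk : k = 0 ∨ k = 1 ∨ k = -1) (hk₁ : m = 1 → k = 1)
    (hcurv : ∀ x : N, scalarCurvature (𝓡 m) (basisN m) (fun x u v => h.inner x u v) x =
      m * (m - 1) * k)
    -- the Riemannian manifold `(M, g)`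
    {E : Type*} [NormedAddCommGroup E] [NormedSpace ℝ E]
    {H : Type*} [TopologicalSpace H] (J : ModelWithCorners ℝ E H)
    {M : Type*} [TopologicalSpace M] [ChartedSpace H M] [IsManifold J ∞ M]
    (g : Bundle.ContMDiffRiemannianMetric J 2 E (fun q : M => TangentSpace J q))
    -- the diffeomorphism `Φ` of `(r₀, ∞) × N` onto the end of `M`
    (r₀ : ℝ) (hr₀ : 0 ≤ r₀) (hr₀k : 0 ≤ r₀ ^ 2 + k)
    (Φ : PartialDiffeomorph (modelEnd m) J (ℝ × N) M ∞) (hΦ : Φ.source = endSet N r₀)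
    (b₀ : FormField (modelEnd m) (ℝ × N))
    (hb₀ : b₀ = refMetric (fun x u v => h.inner x u v) k)
    (gΦ : FormField (modelEnd m) (ℝ × N))
    (hgΦ : gΦ = pullback J Φ (fun q u v => g.inner q u v))
    (hmetric : MetricDecay (fun x u v => h.inner x u v) k r₀ gΦ)
    (hscalar : ScalarDecay r₀ gΦ b₀)
    (hequiv : UniformlyEquivalent r₀ gΦ b₀)
    (V : ℝ × N → ℝ)
    (hV : V ∈ staticPotentials (modelEnd m) (basisEnd m) b₀ (endSet N r₀))
    (hVgrowth : LinearGrowth b₀ V) :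
    (∀ R > r₀, MeasureTheory.Integrable
      (fluxDensity (fun x u v => h.inner x u v) gΦ b₀ V R)
      (riemannianVolume (𝓡 m) (basisN m) (fun x u v => h.inner x u v))) ∧
    ∃ massIntegral : ℝ, Tendsto (flux (fun x u v => h.inner x u v) gΦ b₀ V) atTop
      (𝓝 massIntegral) := by
  subst hb₀ hgΦ
  have hk_ge : -1 ≤ k := by rcases hk with rfl | rfl | rfl <;> norm_num
  have hk_le : k ≤ 1 := by rcases hk with rfl | rfl | rfl <;> norm_num
  have hb : IsEndMetric (refMetric (fun x u v => h.inner x u v) k) r₀ :=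
    isEndMetric_refMetric h hr₀ hr₀k
  -- Positive definiteness of the pull-back is read off from the lower bound by the reference
  -- metric.
  have hg : IsEndMetric (m := m) (pullback J Φ (fun q u v => g.inner q u v)) r₀ := by
    obtain ⟨C, hC, hCg⟩ := hequiv
    exact isEndMetric_pullback g Φ hΦ fun p hp v hv =>
      (mul_pos (inv_pos.2 hC) (hb.pos p hp v hv)).trans_le (hCg p hp v).1
  exact ⟨fun R hR => integrable_riemannianVolume h (continuous_fluxDensity h hg hb hV.1 hR),
    exists_tendsto_flux h hr₀ hr₀k hk_ge hk_le hg hmetric hscalar hequiv hV hVgrowth⟩
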